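/- Let $n\ge 5$. For a smooth Riemannian metric $g$ on an $n$-manifold let $\mathrm{Ric}_g$ and $R_g$ be its Ricci and scalar curvature, $A_g=\frac{1}{n-2}\left(\mathrm{Ric}_g-\frac{R_g}{2(n-1)}g\right)$ its Schouten tensor, $\sigma_2(g)=\sum_{i<j}\lambda_i\lambda_j$ the second elementary symmetric function of the eigenvalues $\lambda_1,\dots,\lambda_n$ of $g^{-1}A_g$, $dv_g$ its Riemannian measure and $\mathrm{Vol}(g)=\int_M dv_g$. Write $[g_0]=\{e^{2u}g_0 : u\in C^\infty(M)\}$ for the conformal class of $g_0$. (1) Let $M$ be any nonempty closed (compact, without boundary) smooth $n$-manifold and $g_0$ any smooth Riemannian metric on $M$. For every $g\in[g_0]$ one has $0<\mathrm{Vol}(g)<\infty$ and $\sigma_2(g)$ and $R_g$ are integrable with respect to $dv_g$; moreover $$\inf_{g\in[g_0]}\frac{\int_M\sigma_2(g)\,dv_g}{\mathrm{Vol}(g)^{\frac{n-4}{n}}}=-\infty ,\qquad \inf_{\substack{g\in[g_0]\\ \int_M R_g\,dv_g>0}}\frac{\int_M\sigma_2(g)\,dv_g}{\left(\int_M R_g\,dv_g\right)^{\frac{n-4}{n-2}}}=-\infty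 .$$ (No pointwise condition $R_g>0$ is imposed; in the second infimum only the total scalar curvature is required to be positive, so that the power is defined.) (2) Let $g_{\mathbb S^n}$ be the round metric of the unit sphere $\mathbb S^n\subset\mathbb R^{n+1}$, let $s=x_{n+1}$ be the last coordinate, and let $g_\ell=e^{-2\ell s^2}g_{\mathbb S^n}$ for $\ell\in\mathbb R$. Then, as $\ell\to+\infty$, $$\frac{\int_{\mathbb S^n}\sigma_2(g_\ell)\,dv_{g_\ell}}{\mathrm{Vol}(g_\ell)^{\frac{n-4}{n}}}\to-\infty ,\qquad \frac{\int_{\mathbb S^n}\sigma_2(g_\ell)\,dv_{g_\ell}}{\left(\int_{\mathbb S^n}R_{g_\ell}\,dv_{g_\ell}\right)^{\frac{n-4}{n-2}}}\to-\infty ,$$ and $\int_{\mathbb S^n}R_{g_\ell}\,dv_{g_\ell}>0$ for all sufficiently large $\ell$. -/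

import Mathlib

open scoped Manifold ContDiff Matrix
open MeasureTheory Bundle

noncomputable section

namespace ConformalGeometry

/-! ### Curvature of a metric written in coordinates

In this part `G : ℝⁿ → Matrix` is the matrix `(g_{ij})` of a Riemannian metric in some coordinate
system. -/

section Coordinates

variable {n : ℕ}

/-- The partial derivative `∂ᵢ f`. -/
def partialDeriv (i : Fin n) (f : EuclideanSpace ℝ (Fin n) → ℝ) (y : EuclideanSpace ℝ (Fin n)) :
    ℝ :=
  fderiv ℝ f y (EuclideanSpace.single i 1)

/-- Christoffel symbols
`Γᵏᵢⱼ = ½ ∑ₗ gᵏˡ (∂ᵢ gⱼₗ + ∂ⱼ gᵢₗ - ∂ₗ gᵢⱼ)`. -/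
def christoffel (G : EuclideanSpace ℝ (Fin n) → Matrix (Fin n) (Fin n) ℝ) (k i j : Fin n)
    (y : EuclideanSpace ℝ (Fin n)) : ℝ :=
  (1 / 2) * ∑ l, (G y)⁻¹ k l *
    (partialDeriv i (fun z => G z j l) y + partialDeriv j (fun z => G z i l) y
      - partialDeriv l (fun z => G z i j) y)

/-- The Ricci tensor
`Ricᵢⱼ = ∑ₖ (∂ₖ Γᵏᵢⱼ - ∂ⱼ Γᵏᵢₖ) + ∑ₖₗ (Γᵏₖₗ Γˡᵢⱼ - Γᵏⱼₗ Γˡᵢₖ)`. -/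
def ricciCoord (G : EuclideanSpace ℝ (Fin n) → Matrix (Fin n) (Fin n) ℝ)
    (y : EuclideanSpace ℝ (Fin n)) : Matrix (Fin n) (Fin n) ℝ :=
  Matrix.of fun i j =>
    (∑ k, (partialDeriv k (christoffel G k i j) y - partialDeriv j (christoffel G k i k) y))
    + ∑ k, ∑ l, (christoffel G k k l y * christoffel G l i j y
        - christoffel G k j l y * christoffel G l i k y)

/-- The scalar curvature `R = ∑ᵢⱼ gⁱʲ Ricᵢⱼ`. -/
def scalarCoord (G : EuclideanSpace ℝ (Fin n) → Matrix (Fin n) (Fin n) ℝ)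
    (y : EuclideanSpace ℝ (Fin n)) : ℝ :=
  ∑ i, ∑ j, (G y)⁻¹ i j * ricciCoord G y i j

/-- The Schouten tensor `A = (Ric - R / (2 (n - 1)) g) / (n - 2)`. -/
def schoutenCoord (G : EuclideanSpace ℝ (Fin n) → Matrix (Fin n) (Fin n) ℝ)
    (y : EuclideanSpace ℝ (Fin n)) : Matrix (Fin n) (Fin n) ℝ :=
  (1 / ((n : ℝ) - 2)) • (ricciCoord G y - (scalarCoord G y / (2 * ((n : ℝ) - 1))) • G y)

/-- The second elementary symmetric function `∑_{i<j} λᵢ λⱼ` of the eigenvalues of a real matrix,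
counted with algebraic multiplicity. The eigenvalues of a general real matrix are complex; the sum
is real. -/
def sigmaTwoMatrix (A : Matrix (Fin n) (Fin n) ℝ) : ℝ :=
  ((A.map (algebraMap ℝ ℂ)).charpoly.roots.esymm 2).re

section SigmaTwo

open Polynomial

/-- `(∑ λᵢ)² = ∑ λᵢ² + 2 σ₂(λ)`. -/
theorem sum_sq_eq_add_esymm_two (s : Multiset ℂ) :
    s.sum ^ 2 = (s.map (· ^ 2)).sum + 2 * s.esymm 2 := by
  induction s using Multiset.induction with
  | empty => simp [Multiset.esymm, Multiset.powersetCard_zero_right]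
  | cons a s ih =>
    have : (a ::ₘ s).esymm 2 = s.esymm 2 + a * s.sum := by
      simp [Multiset.esymm, Multiset.powersetCard_cons, Multiset.powersetCard_one,
        -Multiset.map_id']
      simpa using Multiset.sum_map_mul_left (s := s) (f := fun x => x) (a := a)
    rw [this]
    simp only [Multiset.sum_cons, Multiset.map_cons]
    linear_combination ih

/-- `tr (B²)` is the sum of the squares of the eigenvalues of `B`. -/
theorem trace_mul_self_eq_sum_roots (B : Matrix (Fin n) (Fin n) ℂ) :
    (B * B).trace = (B.charpoly.roots.map (· ^ 2)).sum := by
  have hp : B.charpoly = (B.charpoly.roots.map (fun a => X - C a)).prod :=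
    (IsAlgClosed.splits B.charpoly).eq_prod_roots_of_monic B.charpoly_monic
  have hev (t : ℂ) : (Matrix.scalar (Fin n) t - B).det = (B.charpoly.roots.map (fun a => t - a)).prod := by
    rw [← Matrix.eval_charpoly]
    conv_lhs => rw [hp]
    simp [eval_multiset_prod]
  have hcard : B.charpoly.roots.card = n := by
    have := splits_iff_card_roots.1 (IsAlgClosed.splits B.charpoly)
    simpa [Matrix.charpoly_natDegree_eq_dim] using this
  have h2 : (B * B).charpoly = ((B.charpoly.roots.map (· ^ 2)).map (fun a => X - C a)).prod := by
    refine Polynomial.funext fun w => ?_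
    obtain ⟨t, rfl⟩ := IsAlgClosed.exists_pow_nat_eq w (n := 2) (by norm_num)
    have e : Matrix.scalar (Fin n) (t ^ 2) - B * B =
        (-1 : ℂ) • ((Matrix.scalar (Fin n) t - B) * (Matrix.scalar (Fin n) (-t) - B)) := by
      have hc := (Matrix.scalar_commute t (fun r => Commute.all t r) B).eq
      simp only [map_neg, map_pow, sub_mul, mul_sub, mul_neg, neg_smul, one_smul]
      rw [hc]
      noncomm_ring
    rw [Matrix.eval_charpoly, e, Matrix.det_smul, Matrix.det_mul, hev, hev]
    simp only [eval_multiset_prod, Multiset.map_map, Function.comp_def, eval_sub, eval_X, eval_C]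
    have hneg : (-1 : ℂ) ^ n = (B.charpoly.roots.map (fun _ => (-1 : ℂ))).prod := by
      simp [hcard]
    rw [← Multiset.prod_map_mul, Fintype.card_fin, hneg, ← Multiset.prod_map_mul]
    congr 1
    refine Multiset.map_congr rfl fun a _ => ?_
    ring
  rw [Matrix.trace_eq_sum_roots_charpoly, h2, roots_multiset_prod_X_sub_C]

/-- In particular the value of `σ₂` is real and equals `((tr A)² - tr (A²)) / 2`. -/
theorem sigmaTwoMatrix_eq_trace (A : Matrix (Fin n) (Fin n) ℝ) :
    sigmaTwoMatrix A = (A.trace ^ 2 - (A * A).trace) / 2 := by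
  have h1 := sum_sq_eq_add_esymm_two (A.map (algebraMap ℝ ℂ)).charpoly.roots
  rw [← trace_mul_self_eq_sum_roots, ← Matrix.trace_eq_sum_roots_charpoly, ← Matrix.map_mul] at h1
  have t1 : (A.map (algebraMap ℝ ℂ)).trace = (A.trace : ℂ) := by
    simp [Matrix.trace]
  have t2 : ((A * A).map (algebraMap ℝ ℂ)).trace = ((A * A).trace : ℂ) := by
    simp [Matrix.trace]
  rw [t1, t2] at h1
  have h2 : (A.map (algebraMap ℝ ℂ)).charpoly.roots.esymm 2
      = (((A.trace ^ 2 - (A * A).trace) / 2 : ℝ) : ℂ) := by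
    push_cast
    linear_combination (-1 / 2) * h1
  rw [sigmaTwoMatrix, h2, Complex.ofReal_re]

end SigmaTwo

end Coordinates

/-! ### Riemannian manifolds -/

section Manifold

variable {n : ℕ} {M : Type*} [TopologicalSpace M] [ChartedSpace (EuclideanSpace ℝ (Fin n)) M]
  [IsManifold (𝓡 n) ∞ M]

variable (n M) in
/-- Smooth Riemannian metrics on a smooth `n`-manifold without boundary. -/
abbrev SmoothMetric :=
  Bundle.ContMDiffRiemannianMetric (𝓡 n) ∞ (EuclideanSpace ℝ (Fin n))
    (TangentSpace (𝓡 n) : M → Type _)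

/-- The matrix `g(∂ᵢ, ∂ⱼ)` of the metric in the coordinates given by the preferred chart at `x₀`,
at the point with coordinates `y`. -/
def gramInChart (g : SmoothMetric n M) (x₀ : M) (y : EuclideanSpace ℝ (Fin n)) :
    Matrix (Fin n) (Fin n) ℝ :=
  Matrix.of fun i j =>
    g.inner ((extChartAt (𝓡 n) x₀).symm y)
      (mfderiv (𝓡 n) (𝓡 n) (extChartAt (𝓡 n) x₀).symm y (EuclideanSpace.single i (1 : ℝ)))
      (mfderiv (𝓡 n) (𝓡 n) (extChartAt (𝓡 n) x₀).symm y (EuclideanSpace.single j (1 : ℝ)))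

/-- The scalar curvature `R_g`. -/
def scalarCurvature (g : SmoothMetric n M) (x : M) : ℝ :=
  scalarCoord (gramInChart g x) (extChartAt (𝓡 n) x x)

/-- The `σ₂`-curvature: `σ₂` of the endomorphism `g⁻¹ A_g`, where `A_g` is the Schouten tensor. -/
def sigmaTwo (g : SmoothMetric n M) (x : M) : ℝ :=
  sigmaTwoMatrix ((gramInChart g x (extChartAt (𝓡 n) x x))⁻¹ *
    schoutenCoord (gramInChart g x) (extChartAt (𝓡 n) x x))

variable [MeasurableSpace M]

/-- The measure `√(det g_{ij}) dy` on the domain of the preferred chart at `x₀`, extended by zero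
to the manifold. -/
def chartVolume (g : SmoothMetric n M) (x₀ : M) : Measure M :=
  ((volume.restrict (extChartAt (𝓡 n) x₀).target).withDensity
    fun y => ENNReal.ofReal (Real.sqrt (gramInChart g x₀ y).det)).map (extChartAt (𝓡 n) x₀).symm

/-- The Riemannian measure `dvol_g`. The measures `√(det g_{ij}) dy` agree on overlaps of charts,
and the measure glued from them is their least upper bound. -/
def riemannianVolume (g : SmoothMetric n M) : Measure M :=
  ⨆ x₀ : M, chartVolume g x₀

/-- The total volume `vol(g)`. -/
def totalVolume (g : SmoothMetric n M) : ℝ :=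
  (riemannianVolume g).real Set.univ

/-- `∫ σ₂(g) dvol_g`. -/
def totalSigmaTwo (g : SmoothMetric n M) : ℝ :=
  ∫ x, sigmaTwo g x ∂(riemannianVolume g)

/-- `∫ R_g dvol_g`. -/
def totalScalar (g : SmoothMetric n M) : ℝ :=
  ∫ x, scalarCurvature g x ∂(riemannianVolume g)

/-- `∫ σ₂(g) dvol_g / vol(g) ^ ((n - 4) / n)`. -/
def volumeQuotient (g : SmoothMetric n M) : ℝ :=
  totalSigmaTwo g / totalVolume g ^ (((n : ℝ) - 4) / n)

/-- `∫ σ₂(g) dvol_g / (∫ R_g dvol_g) ^ ((n - 4) / (n - 2))`. -/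
def scalarQuotient (g : SmoothMetric n M) : ℝ :=
  totalSigmaTwo g / totalScalar g ^ (((n : ℝ) - 4) / ((n : ℝ) - 2))

end Manifold

section Conformal

variable {n : ℕ} {M : Type*} [TopologicalSpace M] [ChartedSpace (EuclideanSpace ℝ (Fin n)) M]
  [IsManifold (𝓡 n) ∞ M]

/-- The conformal metric `e^{2u} g`. -/
def conformalMetric (g : SmoothMetric n M) (u : M → ℝ) (hu : ContMDiff (𝓡 n) 𝓘(ℝ, ℝ) ∞ u) :
    SmoothMetric n M where
  inner x := Real.exp (2 * u x) • g.inner x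
  symm x v w := by simp [g.symm x v w]
  pos x v hv := by
    have := g.pos x v hv
    have h2 := Real.exp_pos (2 * u x)
    simpa using mul_pos h2 this
  isVonNBounded x := by
    have h := (g.isVonNBounded x).image
      (Real.exp (-u x) • ContinuousLinearMap.id ℝ (TangentSpace (𝓡 n) x))
    refine h.subset fun v hv => (Set.mem_image _ _ _).2 ⟨Real.exp (u x) • v, ?_, ?_⟩
    · have e : Real.exp (2 * u x) = Real.exp (u x) * Real.exp (u x) := by
        rw [← Real.exp_add]; ring_nf
      simp only [Set.mem_ofPred_eq, e] at hv ⊢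
      simpa [mul_assoc] using hv
    · simp [smul_smul, ← Real.exp_add]
  contMDiff := by
    have h1 : ContMDiff (𝓡 n) 𝓘(ℝ, ℝ) ∞ fun x => Real.exp (2 * u x) :=
      Real.contDiff_exp.contMDiff.comp (contMDiff_const.mul hu)
    intro x₀
    have h2 := g.contMDiff x₀
    rw [contMDiffAt_section] at h2 ⊢
    refine ((h1 x₀).smul h2).congr_of_eventuallyEq ?_
    filter_upwards [(trivializationAt (EuclideanSpace ℝ (Fin n)) (TangentSpace (𝓡 n) : M → Type _) x₀).open_baseSet.mem_nhds (FiberBundle.mem_baseSet_trivializationAt' x₀)] with x hx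
    ext v w
    simp only [hom_trivializationAt_apply, Pi.smul_apply']
    rw [inCoordinates_apply_eq₂ hx hx (by simp), smul_apply, smul_apply, smul_apply, smul_apply,
      inCoordinates_apply_eq₂ hx hx (by simp)]
    simp

/-- The conformal class `[g₀]`: all metrics `e^{2u} g₀` with `u` smooth. -/
def conformalClass (g₀ : SmoothMetric n M) : Set (SmoothMetric n M) :=
  {g | ∃ (u : M → ℝ) (hu : ContMDiff (𝓡 n) 𝓘(ℝ, ℝ) ∞ u), g = conformalMetric g₀ u hu}

end Conformal

section Sphere

/-- The bilinear form `(v, w) ↦ ⟪D v, D w⟫`. -/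
def pullbackInner {n m : ℕ} (D : EuclideanSpace ℝ (Fin n) →L[ℝ] EuclideanSpace ℝ (Fin m)) :
    EuclideanSpace ℝ (Fin n) →L[ℝ] EuclideanSpace ℝ (Fin n) →L[ℝ] ℝ :=
  (innerSL ℝ : EuclideanSpace ℝ (Fin m) →L[ℝ] EuclideanSpace ℝ (Fin m) →L[ℝ] ℝ).bilinearComp D D

theorem pullbackInner_apply {n m : ℕ} (D : EuclideanSpace ℝ (Fin n) →L[ℝ] EuclideanSpace ℝ (Fin m))
    (v w : EuclideanSpace ℝ (Fin n)) : pullbackInner D v w = inner ℝ (D v) (D w) := rfl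

theorem isVonNBounded_pullbackInner {n m : ℕ}
    (D : EuclideanSpace ℝ (Fin n) →L[ℝ] EuclideanSpace ℝ (Fin m)) (hi : Function.Injective D) :
    Bornology.IsVonNBounded ℝ {v | pullbackInner D v v < 1} := by
  obtain ⟨K, -, hK⟩ := LinearMap.exists_antilipschitzWith
    (D : EuclideanSpace ℝ (Fin n) →ₗ[ℝ] EuclideanSpace ℝ (Fin m)) (LinearMap.ker_eq_bot.2 hi)
  have hb := NormedSpace.isVonNBounded_ball ℝ (EuclideanSpace ℝ (Fin n)) (K + 1)
  refine hb.subset fun v hv => ?_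
  rw [Set.mem_ofPred_eq, pullbackInner_apply, real_inner_self_eq_norm_sq] at hv
  have h1 : ‖D v‖ ≤ 1 := by nlinarith [norm_nonneg (D v)]
  have h2 : ‖v‖ ≤ K * ‖D v‖ := by
    have := hK.le_mul_dist v 0
    simpa using this
  have h3 : (K : ℝ) * ‖D v‖ ≤ K := by
    nlinarith [K.coe_nonneg]
  rw [mem_ball_zero_iff]
  linarith

theorem contDiff_pullbackInner {n m : ℕ} :
    ContDiff ℝ ∞ (pullbackInner (n := n) (m := m)) := by
  rw [contDiff_clm_apply_iff]
  intro v
  rw [contDiff_clm_apply_iff]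
  intro w
  simp only [pullbackInner_apply]
  exact (contDiff_id.clm_apply contDiff_const).inner ℝ (contDiff_id.clm_apply contDiff_const)

/-- The differential at `x` of the inclusion of the unit sphere `Sⁿ` in `ℝⁿ⁺¹`. -/
def sphereInclusionDeriv {n : ℕ} (x : Metric.sphere (0 : EuclideanSpace ℝ (Fin (n + 1))) 1) :
    EuclideanSpace ℝ (Fin n) →L[ℝ] EuclideanSpace ℝ (Fin (n + 1)) :=
  mfderiv (𝓡 n) (𝓡 (n + 1)) (fun p : Metric.sphere (0 : EuclideanSpace ℝ (Fin (n + 1))) 1 =>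
    (p : EuclideanSpace ℝ (Fin (n + 1)))) x

theorem sphereInclusionDeriv_injective {n : ℕ}
    (x : Metric.sphere (0 : EuclideanSpace ℝ (Fin (n + 1))) 1) :
    Function.Injective (sphereInclusionDeriv x) := by
  have : Fact (Module.finrank ℝ (EuclideanSpace ℝ (Fin (n + 1))) = n + 1) := ⟨by simp⟩
  exact injective_mvfderiv_subtypeVal_sphere (n := n) x

/-- The restriction of the Euclidean inner product to the tangent space of `Sⁿ` at `x`. -/
def roundInner {n : ℕ} (x : Metric.sphere (0 : EuclideanSpace ℝ (Fin (n + 1))) 1) :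
    TangentSpace (𝓡 n) x →L[ℝ] TangentSpace (𝓡 n) x →L[ℝ] ℝ :=
  pullbackInner (sphereInclusionDeriv x)

theorem contMDiff_roundInner (n : ℕ) :
    ContMDiff (𝓡 n) ((𝓡 n).prod 𝓘(ℝ, EuclideanSpace ℝ (Fin n) →L[ℝ] EuclideanSpace ℝ (Fin n) →L[ℝ] ℝ)) ∞
      (fun x : Metric.sphere (0 : EuclideanSpace ℝ (Fin (n + 1))) 1 =>
        TotalSpace.mk' (EuclideanSpace ℝ (Fin n) →L[ℝ] EuclideanSpace ℝ (Fin n) →L[ℝ] ℝ)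
        (E := fun x => TangentSpace (𝓡 n) x →L[ℝ] TangentSpace (𝓡 n) x →L[ℝ] ℝ) x (roundInner x)) := by
  have : Fact (Module.finrank ℝ (EuclideanSpace ℝ (Fin (n + 1))) = n + 1) := ⟨by simp⟩
  intro x₀
  have hs := (contMDiff_coe_sphere (n := n) (m := ∞) (E := EuclideanSpace ℝ (Fin (n + 1)))) x₀
  have hd := hs.mfderiv_const (m := ∞) (by simp)
  refine (contMDiffAt_section x₀).2 ?_
  refine (contDiff_pullbackInner.contMDiff.contMDiffAt.comp x₀ hd).congr_of_eventuallyEq ?_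
  filter_upwards [(trivializationAt (EuclideanSpace ℝ (Fin n)) (TangentSpace (𝓡 n) :
    Metric.sphere (0 : EuclideanSpace ℝ (Fin (n + 1))) 1 → Type _) x₀).open_baseSet.mem_nhds
      (FiberBundle.mem_baseSet_trivializationAt' x₀)] with x hx
  ext v w
  rw [hom_trivializationAt_apply]
  rw [inCoordinates_apply_eq₂ hx hx (by simp)]
  simp only [Function.comp, pullbackInner_apply, inTangentCoordinates, id]
  rw [ContinuousLinearMap.inCoordinates_eq hx (show _ ∈ _ from Set.mem_univ _)]
  simp
  rfl

/-- The round metric of the unit sphere `Sⁿ ⊆ ℝⁿ⁺¹`. -/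
def roundMetric (n : ℕ) :
    SmoothMetric n (Metric.sphere (0 : EuclideanSpace ℝ (Fin (n + 1))) 1) where
  inner x := roundInner x
  symm x v w := real_inner_comm (sphereInclusionDeriv x w) (sphereInclusionDeriv x v)
  pos x v hv := by
    refine (real_inner_self_pos (F := EuclideanSpace ℝ (Fin (n + 1)))).2 fun h =>
      hv (sphereInclusionDeriv_injective x ?_)
    exact h.trans (map_zero (sphereInclusionDeriv x)).symm
  isVonNBounded x := isVonNBounded_pullbackInner _ (sphereInclusionDeriv_injective x)
  contMDiff := contMDiff_roundInner n

/-- The function `-ℓ s²` on `Sⁿ`, where `s = xₙ₊₁` is the last coordinate. -/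
def bandFactor (n : ℕ) (ℓ : ℝ) (x : Metric.sphere (0 : EuclideanSpace ℝ (Fin (n + 1))) 1) : ℝ :=
  -ℓ * ((x : EuclideanSpace ℝ (Fin (n + 1))) (Fin.last n)) ^ 2

theorem contMDiff_bandFactor (n : ℕ) (ℓ : ℝ) :
    ContMDiff (𝓡 n) 𝓘(ℝ, ℝ) ∞ (bandFactor n ℓ) := by
  have : Fact (Module.finrank ℝ (EuclideanSpace ℝ (Fin (n + 1))) = n + 1) := ⟨by simp⟩
  have hs := contMDiff_coe_sphere (n := n) (m := ∞) (E := EuclideanSpace ℝ (Fin (n + 1)))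
  have h : ContDiff ℝ ∞ fun y : EuclideanSpace ℝ (Fin (n + 1)) => -ℓ * (y (Fin.last n)) ^ 2 := by
    fun_prop
  exact h.contMDiff.comp hs

/-- The metric `e^{-2ℓs²} g_{Sⁿ}`, where `s = xₙ₊₁`. -/
def bandMetric (n : ℕ) (ℓ : ℝ) :
    SmoothMetric n (Metric.sphere (0 : EuclideanSpace ℝ (Fin (n + 1))) 1) :=
  conformalMetric (roundMetric n) (bandFactor n ℓ) (contMDiff_bandFactor n ℓ)

end Sphere

end ConformalGeometry

end

/-! Take a conformal factor u = F(t), with t a fixed smooth function and F a smooth function of one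
variable. Give F' weight 1 and F'' weight 2. The Schouten tensor of e^{2u} g is A - ∇²u + du⊗du -
|du|² g/2, and dt⊗dt has rank one, so e^{4u} σ₂ has the weight-4 part (n-1)/2 |∇t|⁴ (F'² F'' +
(n-4)/4 F'⁴), while everything else has weight at most 3. There is no F''² term.

Multiply by the remaining factor e^{(n-4)F} of the volume form. Since (e^{(n-4)F} F'³)' = e^{(n-4)F}
(3 F'² F'' + (n-4) F'⁴), the F'' term can be integrated by parts along ∇t: for fixed t, ∫ Φ'(t)
|∇t|⁴ is bounded by C ∫ |Φ(t)|, uniformly in Φ. What is left is -(n-1)(n-4)/24 ∫ e^{(n-4)F} F'⁴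
|∇t|⁴, which is negative for n ≥ 5 (`exists_totalSigmaTwo_bound`). In the same way the total scalar
curvature is (n-1)(n-2) ∫ e^{(n-2)F} F'² |∇t|², up to weight at most 1 (`exists_totalScalar_bound`).
No sign of the curvature of g is used.

On an arbitrary closed manifold take for F the sine or the cosine of λs. The factor stays bounded,
so the volume does; the total σ₂ is at most -cλ⁴ + Cλ³ and the total scalar curvature lies between
cλ² - Cλ and Cλ². Both exponents in the quotients lie in [0, 1], so both quotients tend to -∞
(`exists_oscillating_family`, `exists_quotients_lt`).

On the sphere t is the height s and F(s) = -r² s², with ℓ = r². In the variable w = rs the main term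
has size r⁴ on a slab of width about 1/r near the equator, hence order r³. The error is r³ times a
Gaussian mass that tends to 0 because the equator is a null set (`exists_bandMetric_bounds`).

The rest makes this calculus legitimate for curvatures defined in preferred charts: the Levi-Civita
connection is unique, so Christoffel symbols, curvature and σ₂ transform correctly under changes of
charts and under conformal changes, and the chart measures glue. -/

noncomputable section

set_option maxSynthPendingDepth 3
set_option linter.unusedSectionVars false

namespace ConformalGeometry

/-! ### The Levi-Civita connection in coordinates -/

section LeviCivita

variable {n : ℕ}

/-- The model space `ℝⁿ`. -/
abbrev Eucl (n : ℕ) := EuclideanSpace ℝ (Fin n)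

/-- The standard basis vectors. -/
abbrev stdVec (i : Fin n) : Eucl n := EuclideanSpace.single i 1

theorem sum_smul_stdVec (v : Eucl n) : ∑ i, v i • stdVec i = v := by
  ext j
  simp [Finset.sum_apply, Pi.single_apply]

/-- Multilinear identities are reduced to basis vectors with this principle, one slot at a time. -/
theorem eucl_induction {P : Eucl n → Prop} (zero : P 0) (single : ∀ i, P (stdVec i))
    (add : ∀ v w, P v → P w → P (v + w)) (smul : ∀ (c : ℝ) v, P v → P (c • v))
    (v : Eucl n) : P v := by
  rw [← sum_smul_stdVec v]
  exact Finset.sum_induction _ P add zero fun i _ => smul _ _ (single i)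

/-- `G` is the coordinate matrix of a smooth Riemannian metric on the open set `U`. -/
structure MetricOn (G : Eucl n → Matrix (Fin n) (Fin n) ℝ) (U : Set (Eucl n)) : Prop where
  isOpen : IsOpen U
  contDiffAt : ∀ y ∈ U, ∀ i j, ContDiffAt ℝ ∞ (fun z => G z i j) y
  posDef : ∀ y ∈ U, (G y).PosDef

/-- The bilinear form with matrix `G y`. -/
def metricForm (G : Eucl n → Matrix (Fin n) (Fin n) ℝ) (y : Eucl n) :
    Eucl n →L[ℝ] Eucl n →L[ℝ] ℝ :=
  ∑ i, ∑ j, G y i j • (EuclideanSpace.proj i : Eucl n →L[ℝ] ℝ).smulRight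
    (EuclideanSpace.proj j : Eucl n →L[ℝ] ℝ)

/-- The Christoffel symbols, as a bilinear map. -/
def christoffelMap (G : Eucl n → Matrix (Fin n) (Fin n) ℝ) (y : Eucl n) :
    Eucl n →L[ℝ] Eucl n →L[ℝ] Eucl n :=
  ∑ k, ∑ i, ∑ j, christoffel G k i j y • (EuclideanSpace.proj i : Eucl n →L[ℝ] ℝ).smulRight
    ((EuclideanSpace.proj j : Eucl n →L[ℝ] ℝ).smulRight (stdVec k))

theorem metricForm_apply (G : Eucl n → Matrix (Fin n) (Fin n) ℝ) (y v w : Eucl n) :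
    metricForm G y v w = ∑ i, ∑ j, G y i j * (v i * w j) := by
  simp [metricForm]

theorem metricForm_stdVec (G : Eucl n → Matrix (Fin n) (Fin n) ℝ) (y : Eucl n) (i j : Fin n) :
    metricForm G y (stdVec i) (stdVec j) = G y i j := by
  simp [metricForm_apply]

theorem christoffelMap_apply (G : Eucl n → Matrix (Fin n) (Fin n) ℝ) (y v w : Eucl n)
    (k : Fin n) :
    christoffelMap G y v w k = ∑ i, ∑ j, christoffel G k i j y * (v i * w j) := by
  simp [christoffelMap, Finset.sum_apply, Pi.single_apply]

theorem christoffelMap_stdVec (G : Eucl n → Matrix (Fin n) (Fin n) ℝ) (y : Eucl n)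
    (i j k : Fin n) :
    christoffelMap G y (stdVec i) (stdVec j) k = christoffel G k i j y := by
  simp [christoffelMap_apply]

theorem contDiffAt_partialDeriv {f : Eucl n → ℝ} {y : Eucl n} (hf : ContDiffAt ℝ ∞ f y)
    (i : Fin n) : ContDiffAt ℝ ∞ (partialDeriv i f) y :=
  (hf.fderiv_right (m := ∞) (by simp)).clm_apply contDiffAt_const

/-! ### Smoothness, symmetry and metric compatibility of the Christoffel symbols -/

namespace MetricOn

variable {G : Eucl n → Matrix (Fin n) (Fin n) ℝ} {U : Set (Eucl n)}

theorem symm (h : MetricOn G U) {y : Eucl n} (hy : y ∈ U) (i j : Fin n) : G y i j = G y j i := by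
  simpa using (h.posDef y hy).isHermitian.apply j i

theorem det_pos (h : MetricOn G U) {y : Eucl n} (hy : y ∈ U) : 0 < (G y).det :=
  (h.posDef y hy).det_pos

theorem isUnit_det (h : MetricOn G U) {y : Eucl n} (hy : y ∈ U) : IsUnit (G y).det :=
  (h.det_pos hy).ne'.isUnit

theorem mem_nhds (h : MetricOn G U) {y : Eucl n} (hy : y ∈ U) : U ∈ nhds y :=
  h.isOpen.mem_nhds hy

theorem contDiffAt_det (h : MetricOn G U) {y : Eucl n} (hy : y ∈ U) :
    ContDiffAt ℝ ∞ (fun z => (G z).det) y := by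
  simp only [Matrix.det_apply']
  exact ContDiffAt.sum fun σ _ => contDiffAt_const.mul
    (contDiffAt_prod fun i _ => h.contDiffAt y hy _ _)

theorem contDiffAt_inv (h : MetricOn G U) {y : Eucl n} (hy : y ∈ U) (i j : Fin n) :
    ContDiffAt ℝ ∞ (fun z => (G z)⁻¹ i j) y := by
  have : (fun z => (G z)⁻¹ i j) = fun z => (G z).det⁻¹ * (G z).adjugate i j := by
    ext z
    simp [Matrix.inv_def]
  rw [this]
  refine ((h.contDiffAt_det hy).inv (h.det_pos hy).ne').mul ?_
  simp only [Matrix.adjugate_apply, Matrix.det_apply']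
  refine ContDiffAt.sum fun σ _ => contDiffAt_const.mul (contDiffAt_prod fun k _ => ?_)
  simp only [Matrix.updateRow_apply]
  split_ifs
  · exact contDiffAt_const
  · exact h.contDiffAt y hy _ _

theorem contDiffAt_christoffel (h : MetricOn G U) {y : Eucl n} (hy : y ∈ U) (k i j : Fin n) :
    ContDiffAt ℝ ∞ (christoffel G k i j) y := by
  unfold christoffel
  refine contDiffAt_const.mul (ContDiffAt.sum fun l _ => (h.contDiffAt_inv hy _ _).mul ?_)
  exact ((contDiffAt_partialDeriv (h.contDiffAt y hy _ _) _).add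
    (contDiffAt_partialDeriv (h.contDiffAt y hy _ _) _)).sub
    (contDiffAt_partialDeriv (h.contDiffAt y hy _ _) _)

theorem contDiffAt_metricForm (h : MetricOn G U) {y : Eucl n} (hy : y ∈ U) :
    ContDiffAt ℝ ∞ (metricForm G) y := by
  unfold metricForm
  exact ContDiffAt.sum fun i _ => ContDiffAt.sum fun j _ =>
    (h.contDiffAt y hy i j).smul contDiffAt_const

theorem contDiffAt_christoffelMap (h : MetricOn G U) {y : Eucl n} (hy : y ∈ U) :
    ContDiffAt ℝ ∞ (christoffelMap G) y := by
  unfold christoffelMap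
  exact ContDiffAt.sum fun k _ => ContDiffAt.sum fun i _ => ContDiffAt.sum fun j _ =>
    (h.contDiffAt_christoffel hy k i j).smul contDiffAt_const

theorem hasFDerivAt_metricForm (h : MetricOn G U) {y : Eucl n} (hy : y ∈ U) :
    HasFDerivAt (metricForm G) (fderiv ℝ (metricForm G) y) y :=
  ((h.contDiffAt_metricForm hy).differentiableAt (by simp)).hasFDerivAt

theorem hasFDerivAt_christoffelMap (h : MetricOn G U) {y : Eucl n} (hy : y ∈ U) :
    HasFDerivAt (christoffelMap G) (fderiv ℝ (christoffelMap G) y) y :=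
  ((h.contDiffAt_christoffelMap hy).differentiableAt (by simp)).hasFDerivAt

theorem fderiv_metricForm_stdVec (h : MetricOn G U) {y : Eucl n} (hy : y ∈ U) (l i j : Fin n) :
    fderiv ℝ (metricForm G) y (stdVec l) (stdVec i) (stdVec j)
      = partialDeriv l (fun z => G z i j) y := by
  have h1 := ((h.hasFDerivAt_metricForm hy).clm_apply
    (hasFDerivAt_const (stdVec i) y)).clm_apply (hasFDerivAt_const (stdVec j) y)
  simp only [metricForm_stdVec] at h1
  rw [partialDeriv, h1.fderiv]
  simp

theorem fderiv_christoffelMap_stdVec (h : MetricOn G U) {y : Eucl n} (hy : y ∈ U)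
    (l i j k : Fin n) :
    fderiv ℝ (christoffelMap G) y (stdVec l) (stdVec i) (stdVec j) k
      = partialDeriv l (christoffel G k i j) y := by
  have h1 := (((EuclideanSpace.proj k : Eucl n →L[ℝ] ℝ).hasFDerivAt).comp y
    (((h.hasFDerivAt_christoffelMap hy).clm_apply
    (hasFDerivAt_const (stdVec i) y)).clm_apply (hasFDerivAt_const (stdVec j) y)))
  have h2 : (⇑(EuclideanSpace.proj k : Eucl n →L[ℝ] ℝ) ∘
      fun z => christoffelMap G z (stdVec i) (stdVec j)) = christoffel G k i j := by
    ext z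
    simp [christoffelMap_stdVec]
  rw [h2] at h1
  rw [partialDeriv, h1.fderiv]
  simp

theorem metricForm_symm (h : MetricOn G U) {y : Eucl n} (hy : y ∈ U) (v w : Eucl n) :
    metricForm G y v w = metricForm G y w v := by
  rw [metricForm_apply, metricForm_apply, Finset.sum_comm]
  refine Finset.sum_congr rfl fun i _ => Finset.sum_congr rfl fun j _ => ?_
  rw [h.symm hy]
  ring

theorem metricForm_pos (h : MetricOn G U) {y : Eucl n} (hy : y ∈ U) {v : Eucl n} (hv : v ≠ 0) :
    0 < metricForm G y v v := by
  have h0 : (v : Fin n → ℝ) ≠ 0 := fun e => hv (by ext i; exact congrFun e i)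
  have := (h.posDef y hy).dotProduct_mulVec_pos h0
  rw [metricForm_apply]
  refine this.trans_eq ?_
  simp only [dotProduct, Matrix.mulVec, Finset.mul_sum]
  refine Finset.sum_congr rfl fun i _ => Finset.sum_congr rfl fun j _ => ?_
  simp
  ring

theorem eq_of_metricForm_eq (h : MetricOn G U) {y : Eucl n} (hy : y ∈ U) {v w : Eucl n}
    (hvw : ∀ z, metricForm G y v z = metricForm G y w z) : v = w := by
  by_contra hne
  have := h.metricForm_pos hy (sub_ne_zero.2 hne)
  have e : metricForm G y (v - w) (v - w) = 0 := by
    rw [map_sub (metricForm G y), sub_apply, hvw, sub_self]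
  exact this.ne' e

theorem partialDeriv_symm (h : MetricOn G U) {y : Eucl n} (hy : y ∈ U) (l i j : Fin n) :
    partialDeriv l (fun z => G z i j) y = partialDeriv l (fun z => G z j i) y := by
  unfold partialDeriv
  rw [Filter.EventuallyEq.fderiv_eq]
  filter_upwards [h.mem_nhds hy] with z hz using h.symm hz i j

theorem christoffel_symm (h : MetricOn G U) {y : Eucl n} (hy : y ∈ U) (k i j : Fin n) :
    christoffel G k i j y = christoffel G k j i y := by
  unfold christoffel
  congr 1
  refine Finset.sum_congr rfl fun l _ => ?_
  rw [h.partialDeriv_symm hy l i j]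
  ring

theorem sum_mul_christoffel (h : MetricOn G U) {y : Eucl n} (hy : y ∈ U) (m i j : Fin n) :
    ∑ k, G y m k * christoffel G k i j y = (1 / 2) *
      (partialDeriv i (fun z => G z j m) y + partialDeriv j (fun z => G z i m) y
      - partialDeriv m (fun z => G z i j) y) := by
  have h1 : G y * (G y)⁻¹ = 1 := Matrix.mul_nonsing_inv _ (h.isUnit_det hy)
  set a : Fin n → ℝ := fun l => partialDeriv i (fun z => G z j l) y
    + partialDeriv j (fun z => G z i l) y - partialDeriv l (fun z => G z i j) y with ha
  have h2 : (G y * (G y)⁻¹) *ᵥ a = a := by rw [h1, Matrix.one_mulVec]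
  rw [← Matrix.mulVec_mulVec] at h2
  have h3 := congrFun h2 m
  simp only [Matrix.mulVec, dotProduct] at h3
  change _ = 1 / 2 * a m
  rw [← h3, Finset.mul_sum]
  refine Finset.sum_congr rfl fun k _ => ?_
  simp only [christoffel, ha]
  ring

/-- Lowering the upper index turns each sum into half of three first derivatives of the metric; in
the total, four of the six cancel in pairs by the symmetry of `G`. -/
theorem partialDeriv_eq_christoffel (h : MetricOn G U) {y : Eucl n} (hy : y ∈ U) (l i j : Fin n) :
    partialDeriv l (fun z => G z i j) y =
      ∑ k, G y j k * christoffel G k l i y + ∑ k, G y i k * christoffel G k l j y := by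
  rw [h.sum_mul_christoffel hy, h.sum_mul_christoffel hy]
  linarith [h.partialDeriv_symm hy l j i, h.partialDeriv_symm hy i l j,
    h.partialDeriv_symm hy j i l]

theorem christoffelMap_symm (h : MetricOn G U) {y : Eucl n} (hy : y ∈ U) (v w : Eucl n) :
    christoffelMap G y v w = christoffelMap G y w v := by
  ext k
  rw [christoffelMap_apply, christoffelMap_apply, Finset.sum_comm]
  refine Finset.sum_congr rfl fun i _ => Finset.sum_congr rfl fun j _ => ?_
  rw [h.christoffel_symm hy]
  ring

theorem metricForm_stdVec_left (y w : Eucl n) (j : Fin n) :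
    metricForm G y (stdVec j) w = ∑ k, G y j k * w k := by
  rw [metricForm_apply, Finset.sum_eq_single j] <;> simp +contextual

/-- This is ∇g = 0 without indices. Together with `christoffelMap_symm` it characterizes the
connection, and later arguments use only these two properties. -/
theorem fderiv_metricForm (h : MetricOn G U) {y : Eucl n} (hy : y ∈ U) (u v w : Eucl n) :
    fderiv ℝ (metricForm G) y u v w =
      metricForm G y (christoffelMap G y u v) w + metricForm G y v (christoffelMap G y u w) := by
  induction u using eucl_induction with
  | zero => simp
  | add a b ha hb => simp only [map_add, add_apply, ha, hb]; ring
  | smul c a ha => simp only [map_smul, smul_apply, ha, smul_eq_mul]; ring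
  | single l =>
  induction v using eucl_induction with
  | zero => simp
  | add a b ha hb => simp only [map_add, add_apply, ha, hb]; ring
  | smul c a ha => simp only [map_smul, smul_apply, ha, smul_eq_mul]; ring
  | single i =>
  induction w using eucl_induction with
  | zero => simp
  | add a b ha hb => simp only [map_add, ha, hb]; ring
  | smul c a ha => simp only [map_smul, ha, smul_eq_mul]; ring
  | single j =>
  rw [h.fderiv_metricForm_stdVec hy, h.partialDeriv_eq_christoffel hy,
    h.metricForm_symm hy _ (stdVec j), metricForm_stdVec_left, metricForm_stdVec_left]
  simp only [christoffelMap_stdVec]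

end MetricOn

/-- A trilinear form which is symmetric in the first two arguments and antisymmetric in the last
two vanishes. -/
theorem eq_zero_of_symm_antisymm {V : Type*} {T : V → V → V → ℝ}
    (h1 : ∀ u v w, T u v w = T v u w) (h2 : ∀ u v w, T u v w + T u w v = 0) (u v w : V) :
    T u v w = 0 := by
  linarith [h2 u v w, h1 u w v, h2 w u v, h1 w v u, h2 v w u, h1 v u w]

/-- The Levi-Civita connection is the only symmetric connection compatible with the metric. -/
theorem MetricOn.eq_christoffelMap {G : Eucl n → Matrix (Fin n) (Fin n) ℝ} {U : Set (Eucl n)}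
    (h : MetricOn G U) {y : Eucl n} (hy : y ∈ U) {Γ : Eucl n → Eucl n → Eucl n}
    (hs : ∀ v w, Γ v w = Γ w v)
    (hc : ∀ u v w, fderiv ℝ (metricForm G) y u v w
      = metricForm G y (Γ u v) w + metricForm G y v (Γ u w)) (v w : Eucl n) :
    christoffelMap G y v w = Γ v w := by
  refine h.eq_of_metricForm_eq hy fun z => ?_
  have := eq_zero_of_symm_antisymm
    (T := fun u v w => metricForm G y (christoffelMap G y u v) w - metricForm G y (Γ u v) w)
    (fun u v w => by simp only [h.christoffelMap_symm hy u v, hs u v])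
    (fun u v w => by
      have e1 := hc u v w
      rw [h.fderiv_metricForm hy] at e1
      rw [h.metricForm_symm hy v, h.metricForm_symm hy v] at e1
      linarith) v w z
  linarith

end LeviCivita

/-! ### Curvature and changes of coordinates -/

section Curvature

section General

variable {E : Type*} [NormedAddCommGroup E] [NormedSpace ℝ E]

/-- The curvature `R(u, v) w` of the connection with Christoffel symbols `Γ`. -/
def curvatureMap (Γ : E → E →L[ℝ] E →L[ℝ] E) (y u v w : E) : E :=
  fderiv ℝ Γ y u v w - fderiv ℝ Γ y v u w + Γ y u (Γ y v w) - Γ y v (Γ y u w)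

/-- The curvature is natural under changes of coordinates `φ`. -/
theorem fderiv_curvatureMap {Γ₀ Γ₁ : E → E →L[ℝ] E →L[ℝ] E} {φ : E → E} {y : E}
    (hφ : ContDiffAt ℝ ∞ φ y) (h₀ : DifferentiableAt ℝ Γ₀ y) (h₁ : DifferentiableAt ℝ Γ₁ (φ y))
    (hΓ : ∀ᶠ z in nhds y, ∀ v w, fderiv ℝ φ z (Γ₀ z v w)
      = Γ₁ (φ z) (fderiv ℝ φ z v) (fderiv ℝ φ z w) + fderiv ℝ (fderiv ℝ φ) z v w) (u v w : E) :
    fderiv ℝ φ y (curvatureMap Γ₀ y u v w) =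
      curvatureMap Γ₁ (φ y) (fderiv ℝ φ y u) (fderiv ℝ φ y v) (fderiv ℝ φ y w) := by
  have d1 : HasFDerivAt φ (fderiv ℝ φ y) y := (hφ.differentiableAt (by simp)).hasFDerivAt
  have c1 : ContDiffAt ℝ ∞ (fderiv ℝ φ) y := hφ.fderiv_right (by simp)
  have d2 : HasFDerivAt (fderiv ℝ φ) (fderiv ℝ (fderiv ℝ φ) y) y :=
    (c1.differentiableAt (by simp)).hasFDerivAt
  have c2 : ContDiffAt ℝ ∞ (fderiv ℝ (fderiv ℝ φ)) y := c1.fderiv_right (by simp)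
  have d3 : HasFDerivAt (fderiv ℝ (fderiv ℝ φ)) (fderiv ℝ (fderiv ℝ (fderiv ℝ φ)) y) y :=
    (c2.differentiableAt (by simp)).hasFDerivAt
  have sym2 := (hφ.isSymmSndFDerivAt (by simpa using ENat.LEInfty.out)).eq
  have sym3 := (c1.isSymmSndFDerivAt (by simpa using ENat.LEInfty.out)).eq
  -- The transformation law holds near `y`, so it can be differentiated there in the direction `u`.
  have key (u v w : E) : fderiv ℝ (fderiv ℝ φ) y u (Γ₀ y v w)
      + fderiv ℝ φ y (fderiv ℝ Γ₀ y u v w)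
      = fderiv ℝ Γ₁ (φ y) (fderiv ℝ φ y u) (fderiv ℝ φ y v) (fderiv ℝ φ y w)
        + Γ₁ (φ y) (fderiv ℝ (fderiv ℝ φ) y u v) (fderiv ℝ φ y w)
        + Γ₁ (φ y) (fderiv ℝ φ y v) (fderiv ℝ (fderiv ℝ φ) y u w)
        + fderiv ℝ (fderiv ℝ (fderiv ℝ φ)) y u v w := by
    have L := d2.clm_apply ((h₀.hasFDerivAt.clm_apply (hasFDerivAt_const v y)).clm_apply
      (hasFDerivAt_const w y))
    have R := (((h₁.hasFDerivAt.comp y d1).clm_apply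
      (d2.clm_apply (hasFDerivAt_const v y))).clm_apply
      (d2.clm_apply (hasFDerivAt_const w y))).add
      ((d3.clm_apply (hasFDerivAt_const v y)).clm_apply (hasFDerivAt_const w y))
    have := congrArg (fun A => A u) (L.unique (R.congr_of_eventuallyEq
      (hΓ.mono fun z hz => hz v w)))
    simp at this
    rw [add_comm, this]
    abel
  have hy := hΓ.self_of_nhds
  -- Antisymmetrizing in `u` and `v` removes the third derivative of `φ` and the term with D²φ(u,
  -- v), both symmetric. The other second derivatives cancel against those produced by the quadratic
  -- terms in `e1` and `e2`.
  have k1 := key u v w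
  have k2 := key v u w
  rw [sym3 v u] at k2
  rw [sym2 v u] at k2
  have e1 := hy u (Γ₀ y v w)
  have e2 := hy v (Γ₀ y u w)
  rw [hy v w, map_add] at e1
  rw [hy u w, map_add] at e2
  simp only [curvatureMap, map_add, map_sub]
  rw [e1, e2, ← sub_eq_zero]
  rw [← sub_eq_zero] at k1 k2
  rw [← sub_eq_zero.2 (k1.trans k2.symm)]
  abel

end General

variable {n : ℕ}

theorem trace_eq_sum (A : Eucl n →ₗ[ℝ] Eucl n) :
    LinearMap.trace ℝ _ A = ∑ k, A (stdVec k) k := by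
  rw [LinearMap.trace_eq_matrix_trace ℝ (EuclideanSpace.basisFun (Fin n) ℝ).toBasis, Matrix.trace]
  simp [LinearMap.toMatrix_apply]

/-- The endomorphism `u ↦ R(u, v) w`. -/
def curvatureEnd (Γ : Eucl n → Eucl n →L[ℝ] Eucl n →L[ℝ] Eucl n) (y v w : Eucl n) :
    Eucl n →ₗ[ℝ] Eucl n where
  toFun u := curvatureMap Γ y u v w
  map_add' a b := by simp only [curvatureMap, map_add, add_apply]; abel
  map_smul' c a := by
    simp only [curvatureMap, map_smul, smul_apply, RingHom.id_apply, smul_sub, smul_add]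

/-- As a trace, Ricci inherits its transformation laws from the curvature. The lower indices of the
Christoffel symbols come in a different order on the two sides, also under a derivative, which is
why symmetry is needed on a neighbourhood (`hsym`). -/
theorem MetricOn.ricciCoord_eq_trace {G : Eucl n → Matrix (Fin n) (Fin n) ℝ} {U : Set (Eucl n)}
    (h : MetricOn G U) {y : Eucl n} (hy : y ∈ U) (i j : Fin n) :
    ricciCoord G y i j =
      LinearMap.trace ℝ _ (curvatureEnd (christoffelMap G) y (stdVec j) (stdVec i)) := by
  have comp (v : Eucl n) (k i : Fin n) : christoffelMap G y (stdVec i) v k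
      = ∑ l, christoffel G k i l y * v l := by
    rw [christoffelMap_apply, Finset.sum_eq_single i] <;> simp +contextual
  have hsym (k j i l : Fin n) : partialDeriv l (christoffel G k i j) y
      = partialDeriv l (christoffel G k j i) y := by
    unfold partialDeriv
    rw [Filter.EventuallyEq.fderiv_eq]
    filter_upwards [h.mem_nhds hy] with z hz using h.christoffel_symm hz k i j
  rw [trace_eq_sum, ricciCoord, Matrix.of_apply, ← Finset.sum_add_distrib]
  refine Finset.sum_congr rfl fun k _ => ?_
  simp only [curvatureEnd, curvatureMap, LinearMap.coe_mk, AddHom.coe_mk, PiLp.add_apply,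
    PiLp.sub_apply, h.fderiv_christoffelMap_stdVec hy]
  rw [comp, comp, Finset.sum_sub_distrib, hsym k j i k, hsym k i k j]
  simp only [christoffelMap_stdVec, h.christoffel_symm hy _ i]
  abel

/-- The Ricci endomorphism `g⁻¹ Ric`. -/
def ricciOp (G : Eucl n → Matrix (Fin n) (Fin n) ℝ) (y : Eucl n) : Matrix (Fin n) (Fin n) ℝ :=
  (G y)⁻¹ * ricciCoord G y

/-- The Schouten endomorphism `g⁻¹ A`. -/
def schoutenOp (G : Eucl n → Matrix (Fin n) (Fin n) ℝ) (y : Eucl n) : Matrix (Fin n) (Fin n) ℝ :=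
  (G y)⁻¹ * schoutenCoord G y

theorem MetricOn.scalarCoord_eq_trace {G : Eucl n → Matrix (Fin n) (Fin n) ℝ} {U : Set (Eucl n)}
    (h : MetricOn G U) {y : Eucl n} (hy : y ∈ U) : scalarCoord G y = (ricciOp G y).trace := by
  have hs : (G y)⁻¹ᵀ = (G y)⁻¹ := by
    rw [Matrix.transpose_nonsing_inv]
    congr 1
    ext i j
    exact h.symm hy j i
  simp only [scalarCoord, ricciOp, Matrix.trace, Matrix.diag, Matrix.mul_apply]
  rw [Finset.sum_comm]
  refine Finset.sum_congr rfl fun i _ => Finset.sum_congr rfl fun j _ => ?_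
  rw [← hs, Matrix.transpose_apply, hs]

/-- Only the Ricci endomorphism and the identity occur here, so the behaviour of `ricciOp` under
isometries and conformal changes decides that of the Schouten endomorphism. -/
theorem MetricOn.schoutenOp_eq {G : Eucl n → Matrix (Fin n) (Fin n) ℝ} {U : Set (Eucl n)}
    (h : MetricOn G U) {y : Eucl n} (hy : y ∈ U) :
    schoutenOp G y = (1 / ((n : ℝ) - 2)) •
      (ricciOp G y - ((ricciOp G y).trace / (2 * ((n : ℝ) - 1))) • 1) := by
  rw [schoutenOp, schoutenCoord, h.scalarCoord_eq_trace hy, Matrix.mul_smul, Matrix.mul_sub,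
    Matrix.mul_smul, Matrix.nonsing_inv_mul _ (h.isUnit_det hy), ricciOp]

/-- The matrix of a differential. -/
def jacobianMatrix (φ : Eucl n → Eucl n) (y : Eucl n) : Matrix (Fin n) (Fin n) ℝ :=
  Matrix.of fun i j => fderiv ℝ φ y (stdVec j) i

/-- `φ` is an isometry of the metric `G₀` on `U₀` to the metric `G₁` on `U₁`. -/
structure IsometryOn (φ : Eucl n → Eucl n) (G₀ : Eucl n → Matrix (Fin n) (Fin n) ℝ)
    (U₀ : Set (Eucl n)) (G₁ : Eucl n → Matrix (Fin n) (Fin n) ℝ) (U₁ : Set (Eucl n)) : Prop where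
  left : MetricOn G₀ U₀
  right : MetricOn G₁ U₁
  contDiffAt : ∀ y ∈ U₀, ContDiffAt ℝ ∞ φ y
  mapsTo : Set.MapsTo φ U₀ U₁
  metric_eq : ∀ y ∈ U₀, G₀ y = (jacobianMatrix φ y)ᵀ * G₁ (φ y) * jacobianMatrix φ y

theorem metricForm_eq_of_stdVec {G₀ G₁ : Eucl n → Matrix (Fin n) (Fin n) ℝ} {y z : Eucl n}
    {A : Eucl n →L[ℝ] Eucl n}
    (hA : ∀ i j, G₀ y i j = metricForm G₁ z (A (stdVec i)) (A (stdVec j))) (v w : Eucl n) :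
    metricForm G₀ y v w = metricForm G₁ z (A v) (A w) := by
  induction v using eucl_induction with
  | zero => simp
  | add a b ha hb => simp only [map_add, add_apply, ha, hb]
  | smul c a ha => simp only [map_smul, smul_apply, ha]
  | single i =>
  induction w using eucl_induction with
  | zero => simp
  | add a b ha hb => simp only [map_add, ha, hb]
  | smul c a ha => simp only [map_smul, ha]
  | single j => rw [metricForm_stdVec, hA]

/-! ### Invariance of the curvatures under isometries -/

namespace IsometryOn

variable {φ : Eucl n → Eucl n} {G₀ G₁ : Eucl n → Matrix (Fin n) (Fin n) ℝ} {U₀ U₁ : Set (Eucl n)}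

theorem hasFDerivAt (h : IsometryOn φ G₀ U₀ G₁ U₁) {y : Eucl n} (hy : y ∈ U₀) :
    HasFDerivAt φ (fderiv ℝ φ y) y :=
  ((h.contDiffAt y hy).differentiableAt (by simp)).hasFDerivAt

theorem metricForm_eq (h : IsometryOn φ G₀ U₀ G₁ U₁) {y : Eucl n} (hy : y ∈ U₀) (v w : Eucl n) :
    metricForm G₀ y v w = metricForm G₁ (φ y) (fderiv ℝ φ y v) (fderiv ℝ φ y w) := by
  refine metricForm_eq_of_stdVec (fun i j => ?_) v w
  rw [h.metric_eq y hy, metricForm_apply]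
  simp only [Matrix.mul_apply, Matrix.transpose_apply, jacobianMatrix, Matrix.of_apply,
    Finset.sum_mul]
  rw [Finset.sum_comm]
  refine Finset.sum_congr rfl fun a _ => Finset.sum_congr rfl fun b _ => ?_
  ring

theorem injective_fderiv (h : IsometryOn φ G₀ U₀ G₁ U₁) {y : Eucl n} (hy : y ∈ U₀) :
    Function.Injective (fderiv ℝ φ y) := by
  refine (injective_iff_map_eq_zero _).2 fun v hv => ?_
  by_contra hne
  have := h.left.metricForm_pos hy hne
  rw [h.metricForm_eq hy, hv] at this
  simp at this

theorem surjective_fderiv (h : IsometryOn φ G₀ U₀ G₁ U₁) {y : Eucl n} (hy : y ∈ U₀) :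
    Function.Surjective (fderiv ℝ φ y) :=
  (LinearMap.injective_iff_surjective (f := (fderiv ℝ φ y : Eucl n →ₗ[ℝ] Eucl n))).1
    (h.injective_fderiv hy)

/-- The uniqueness argument for the Levi-Civita connection: the difference of the two sides, paired
with a third vector, is symmetric in the first two slots since D²φ is, and antisymmetric in the last
two by differentiating the isometry equation. Such a form vanishes, and Dφ is onto. -/
theorem fderiv_christoffelMap (h : IsometryOn φ G₀ U₀ G₁ U₁) {y : Eucl n} (hy : y ∈ U₀)
    (v w : Eucl n) : fderiv ℝ φ y (christoffelMap G₀ y v w)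
      = christoffelMap G₁ (φ y) (fderiv ℝ φ y v) (fderiv ℝ φ y w)
        + fderiv ℝ (fderiv ℝ φ) y v w := by
  have hy' := h.mapsTo hy
  have d2 : HasFDerivAt (fderiv ℝ φ) (fderiv ℝ (fderiv ℝ φ) y) y :=
    (((h.contDiffAt y hy).fderiv_right (m := ∞) (by simp)).differentiableAt (by simp)).hasFDerivAt
  have sym2 := ((h.contDiffAt y hy).isSymmSndFDerivAt (by simpa using ENat.LEInfty.out)).eq
  have key (u v w : Eucl n) :
      metricForm G₁ (φ y) (fderiv ℝ φ y (christoffelMap G₀ y u v)) (fderiv ℝ φ y w)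
      + metricForm G₁ (φ y) (fderiv ℝ φ y v) (fderiv ℝ φ y (christoffelMap G₀ y u w))
      = metricForm G₁ (φ y) (christoffelMap G₁ (φ y) (fderiv ℝ φ y u) (fderiv ℝ φ y v)
          + fderiv ℝ (fderiv ℝ φ) y u v) (fderiv ℝ φ y w)
      + metricForm G₁ (φ y) (fderiv ℝ φ y v) (christoffelMap G₁ (φ y) (fderiv ℝ φ y u)
          (fderiv ℝ φ y w) + fderiv ℝ (fderiv ℝ φ) y u w) := by
    have L := ((h.left.hasFDerivAt_metricForm hy).clm_apply (hasFDerivAt_const v y)).clm_apply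
      (hasFDerivAt_const w y)
    have R := (((h.right.hasFDerivAt_metricForm hy').comp y (h.hasFDerivAt hy)).clm_apply
      (d2.clm_apply (hasFDerivAt_const v y))).clm_apply (d2.clm_apply (hasFDerivAt_const w y))
    have := congrArg (fun A => A u) (L.unique (R.congr_of_eventuallyEq (by
      filter_upwards [h.left.mem_nhds hy] with z hz using h.metricForm_eq hz v w)))
    simp only [ContinuousLinearMap.comp_zero, zero_add, add_apply,
      ContinuousLinearMap.flip_apply, ContinuousLinearMap.comp_apply, Function.comp_apply,
      h.left.fderiv_metricForm hy, h.right.fderiv_metricForm hy'] at this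
    rw [← h.metricForm_eq hy, ← h.metricForm_eq hy, this]
    simp only [map_add, add_apply]
    ring
  refine h.right.eq_of_metricForm_eq hy' fun z => ?_
  obtain ⟨z, rfl⟩ := h.surjective_fderiv hy z
  have := eq_zero_of_symm_antisymm
    (T := fun u v w =>
      metricForm G₁ (φ y) (fderiv ℝ φ y (christoffelMap G₀ y u v)) (fderiv ℝ φ y w)
      - metricForm G₁ (φ y) (christoffelMap G₁ (φ y) (fderiv ℝ φ y u) (fderiv ℝ φ y v)
          + fderiv ℝ (fderiv ℝ φ) y u v) (fderiv ℝ φ y w))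
    (fun u v w => by
      simp only [h.left.christoffelMap_symm hy u v, sym2 u v,
        h.right.christoffelMap_symm hy' (fderiv ℝ φ y u) (fderiv ℝ φ y v)])
    (fun u v w => by
      have e1 := key u v w
      rw [h.right.metricForm_symm hy' (fderiv ℝ φ y v),
        h.right.metricForm_symm hy' (fderiv ℝ φ y v)] at e1
      linarith) v w z
  linarith

/-- By naturality of the curvature, Dφ conjugates one endomorphism into the other. -/
theorem trace_curvatureEnd (h : IsometryOn φ G₀ U₀ G₁ U₁) {y : Eucl n} (hy : y ∈ U₀)
    (v w : Eucl n) :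
    LinearMap.trace ℝ _ (curvatureEnd (christoffelMap G₀) y v w) = LinearMap.trace ℝ _
      (curvatureEnd (christoffelMap G₁) (φ y) (fderiv ℝ φ y v) (fderiv ℝ φ y w)) := by
  let e : Eucl n ≃ₗ[ℝ] Eucl n := LinearEquiv.ofBijective (fderiv ℝ φ y : Eucl n →ₗ[ℝ] Eucl n)
    ⟨h.injective_fderiv hy, h.surjective_fderiv hy⟩
  rw [← LinearMap.trace_conj' _ e]
  congr 1
  ext1 u
  obtain ⟨u, rfl⟩ := e.surjective u
  rw [LinearEquiv.conj_apply_apply, e.symm_apply_apply]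
  exact fderiv_curvatureMap (h.contDiffAt y hy)
    ((h.left.contDiffAt_christoffelMap hy).differentiableAt (by simp))
    ((h.right.contDiffAt_christoffelMap (h.mapsTo hy)).differentiableAt (by simp))
    (by filter_upwards [h.left.mem_nhds hy] with z hz using h.fderiv_christoffelMap hz) u v w

theorem ricciCoord_eq (h : IsometryOn φ G₀ U₀ G₁ U₁) {y : Eucl n} (hy : y ∈ U₀) :
    ricciCoord G₀ y = (jacobianMatrix φ y)ᵀ * ricciCoord G₁ (φ y) * jacobianMatrix φ y := by
  have add1 (z a b w : Eucl n) : curvatureEnd (christoffelMap G₁) z (a + b) w =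
      curvatureEnd (christoffelMap G₁) z a w + curvatureEnd (christoffelMap G₁) z b w := by
    ext1 u
    simp only [curvatureEnd, curvatureMap, LinearMap.coe_mk, AddHom.coe_mk, map_add, add_apply,
      LinearMap.add_apply]
    abel
  have smul1 (z a w : Eucl n) (c : ℝ) : curvatureEnd (christoffelMap G₁) z (c • a) w =
      c • curvatureEnd (christoffelMap G₁) z a w := by
    ext1 u
    simp only [curvatureEnd, curvatureMap, LinearMap.coe_mk, AddHom.coe_mk, map_smul, smul_apply,
      LinearMap.smul_apply]
    module
  have add2 (z a b w : Eucl n) : curvatureEnd (christoffelMap G₁) z w (a + b) =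
      curvatureEnd (christoffelMap G₁) z w a + curvatureEnd (christoffelMap G₁) z w b := by
    ext1 u
    simp only [curvatureEnd, curvatureMap, LinearMap.coe_mk, AddHom.coe_mk, map_add,
      LinearMap.add_apply]
    abel
  have smul2 (z a w : Eucl n) (c : ℝ) : curvatureEnd (christoffelMap G₁) z w (c • a) =
      c • curvatureEnd (christoffelMap G₁) z w a := by
    ext1 u
    simp only [curvatureEnd, curvatureMap, LinearMap.coe_mk, AddHom.coe_mk, map_smul,
      LinearMap.smul_apply]
    module
  -- The trace is bilinear in the two remaining arguments, so the images of the basis vectors under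
  -- Dφ can be expanded; their coefficients are the entries of the Jacobian.
  have expand (z v w : Eucl n) : LinearMap.trace ℝ _ (curvatureEnd (christoffelMap G₁) z w v)
      = ∑ a, ∑ b, v a * w b * LinearMap.trace ℝ _
        (curvatureEnd (christoffelMap G₁) z (stdVec b) (stdVec a)) := by
    let B : Eucl n →ₗ[ℝ] Eucl n →ₗ[ℝ] ℝ := LinearMap.mk₂ ℝ
      (fun v w => LinearMap.trace ℝ _ (curvatureEnd (christoffelMap G₁) z w v))
      (fun a b c => by rw [add2, map_add]) (fun c a b => by rw [smul2, map_smul])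
      (fun a b c => by rw [add1, map_add]) (fun c a b => by rw [smul1, map_smul])
    change B v w = ∑ a, ∑ b, v a * w b * B (stdVec a) (stdVec b)
    conv_lhs => rw [← sum_smul_stdVec v, ← sum_smul_stdVec w]
    simp only [map_sum, map_smul, LinearMap.sum_apply, LinearMap.smul_apply, smul_eq_mul,
      Finset.mul_sum, mul_assoc]
    rw [Finset.sum_comm]
    refine Finset.sum_congr rfl fun a _ => Finset.sum_congr rfl fun b _ => ?_
    ring
  ext i j
  rw [h.left.ricciCoord_eq_trace hy, h.trace_curvatureEnd hy, expand]
  simp only [Matrix.mul_apply, Matrix.transpose_apply, jacobianMatrix, Matrix.of_apply,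
    Finset.sum_mul, h.right.ricciCoord_eq_trace (h.mapsTo hy)]
  rw [Finset.sum_comm]
  refine Finset.sum_congr rfl fun a _ => Finset.sum_congr rfl fun b _ => ?_
  ring

theorem isUnit_det_jacobianMatrix (h : IsometryOn φ G₀ U₀ G₁ U₁) {y : Eucl n} (hy : y ∈ U₀) :
    IsUnit (jacobianMatrix φ y).det := by
  have := h.left.isUnit_det hy
  rw [h.metric_eq y hy, Matrix.det_mul, IsUnit.mul_iff] at this
  exact this.2

/-- Raising an index turns the congruence law of bilinear forms into conjugation by the Jacobian,
under which traces do not change. -/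
theorem inv_mul_eq (h : IsometryOn φ G₀ U₀ G₁ U₁) {y : Eucl n} (hy : y ∈ U₀)
    (B : Matrix (Fin n) (Fin n) ℝ) :
    (G₀ y)⁻¹ * ((jacobianMatrix φ y)ᵀ * B * jacobianMatrix φ y)
      = (jacobianMatrix φ y)⁻¹ * ((G₁ (φ y))⁻¹ * B) * jacobianMatrix φ y := by
  have hJ := h.isUnit_det_jacobianMatrix hy
  have hJ' : IsUnit (jacobianMatrix φ y)ᵀ.det := by rwa [Matrix.det_transpose]
  rw [h.metric_eq y hy, Matrix.mul_inv_rev, Matrix.mul_inv_rev]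
  simp only [Matrix.mul_assoc]
  rw [Matrix.nonsing_inv_mul_cancel_left _ _ hJ']

theorem ricciOp_eq (h : IsometryOn φ G₀ U₀ G₁ U₁) {y : Eucl n} (hy : y ∈ U₀) :
    ricciOp G₀ y = (jacobianMatrix φ y)⁻¹ * ricciOp G₁ (φ y) * jacobianMatrix φ y := by
  rw [ricciOp, h.ricciCoord_eq hy, h.inv_mul_eq hy, ricciOp]

theorem trace_conj (h : IsometryOn φ G₀ U₀ G₁ U₁) {y : Eucl n} (hy : y ∈ U₀)
    (B : Matrix (Fin n) (Fin n) ℝ) :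
    ((jacobianMatrix φ y)⁻¹ * B * jacobianMatrix φ y).trace = B.trace := by
  rw [Matrix.mul_assoc, Matrix.trace_mul_comm, Matrix.mul_assoc,
    Matrix.mul_nonsing_inv _ (h.isUnit_det_jacobianMatrix hy), Matrix.mul_one]

theorem scalarCoord_eq (h : IsometryOn φ G₀ U₀ G₁ U₁) {y : Eucl n} (hy : y ∈ U₀) :
    scalarCoord G₀ y = scalarCoord G₁ (φ y) := by
  rw [h.left.scalarCoord_eq_trace hy, h.right.scalarCoord_eq_trace (h.mapsTo hy), h.ricciOp_eq hy,
    h.trace_conj hy]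

/-- The Schouten endomorphisms are conjugate, and σ₂ is a polynomial in tr A and tr A². -/
theorem sigmaTwoMatrix_eq (h : IsometryOn φ G₀ U₀ G₁ U₁) {y : Eucl n} (hy : y ∈ U₀) :
    sigmaTwoMatrix (schoutenOp G₀ y) = sigmaTwoMatrix (schoutenOp G₁ (φ y)) := by
  have hJ := h.isUnit_det_jacobianMatrix hy
  have e : schoutenOp G₀ y =
      (jacobianMatrix φ y)⁻¹ * schoutenOp G₁ (φ y) * jacobianMatrix φ y := by
    rw [h.left.schoutenOp_eq hy, h.right.schoutenOp_eq (h.mapsTo hy), h.ricciOp_eq hy,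
      h.trace_conj hy]
    simp only [Matrix.mul_smul, Matrix.smul_mul, Matrix.mul_sub, Matrix.sub_mul, Matrix.mul_one,
      Matrix.nonsing_inv_mul _ hJ]
  have e2 : schoutenOp G₀ y * schoutenOp G₀ y = (jacobianMatrix φ y)⁻¹ *
      (schoutenOp G₁ (φ y) * schoutenOp G₁ (φ y)) * jacobianMatrix φ y := by
    rw [e]
    simp only [Matrix.mul_assoc]
    rw [Matrix.mul_nonsing_inv_cancel_left _ _ hJ]
  rw [sigmaTwoMatrix_eq_trace, sigmaTwoMatrix_eq_trace, e2, e, h.trace_conj hy, h.trace_conj hy]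

end IsometryOn

end Curvature

/-! ### Conformal changes of the metric in coordinates -/

section ConformalChange

variable {n : ℕ}

/-- The conformal metric `e^{2u} G`. -/
def conformalCoord (G : Eucl n → Matrix (Fin n) (Fin n) ℝ) (u : Eucl n → ℝ) (y : Eucl n) :
    Matrix (Fin n) (Fin n) ℝ :=
  Real.exp (2 * u y) • G y

/-- The covariant Hessian of a function. -/
def hessMatrix (G : Eucl n → Matrix (Fin n) (Fin n) ℝ) (u : Eucl n → ℝ) (y : Eucl n) :
    Matrix (Fin n) (Fin n) ℝ :=
  Matrix.of fun i j => fderiv ℝ (fderiv ℝ u) y (stdVec i) (stdVec j)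
    - fderiv ℝ u y (christoffelMap G y (stdVec i) (stdVec j))

/-- The matrix `∂ᵢu ∂ⱼu`. -/
def diffSqMatrix (u : Eucl n → ℝ) (y : Eucl n) : Matrix (Fin n) (Fin n) ℝ :=
  Matrix.vecMulVec (fun i => partialDeriv i u y) (fun i => partialDeriv i u y)

/-- The endomorphism `g⁻¹ ∇²u`. -/
def hessOp (G : Eucl n → Matrix (Fin n) (Fin n) ℝ) (u : Eucl n → ℝ) (y : Eucl n) :
    Matrix (Fin n) (Fin n) ℝ :=
  (G y)⁻¹ * hessMatrix G u y

/-- The endomorphism `g⁻¹ (du ⊗ du)`. -/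
def diffSqOp (G : Eucl n → Matrix (Fin n) (Fin n) ℝ) (u : Eucl n → ℝ) (y : Eucl n) :
    Matrix (Fin n) (Fin n) ℝ :=
  (G y)⁻¹ * diffSqMatrix u y

/-- `|∇u|²`. -/
def gradSq (G : Eucl n → Matrix (Fin n) (Fin n) ℝ) (u : Eucl n → ℝ) (y : Eucl n) : ℝ :=
  (diffSqOp G u y).trace

/-- The gradient of a function. -/
def gradVec (G : Eucl n → Matrix (Fin n) (Fin n) ℝ) (u : Eucl n → ℝ) (y : Eucl n) : Eucl n :=
  ∑ k, (∑ l, (G y)⁻¹ k l * partialDeriv l u y) • stdVec k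

theorem gradVec_apply (G : Eucl n → Matrix (Fin n) (Fin n) ℝ) (u : Eucl n → ℝ) (y : Eucl n)
    (k : Fin n) : gradVec G u y k = ∑ l, (G y)⁻¹ k l * partialDeriv l u y := by
  simp [gradVec, Finset.sum_apply, Pi.single_apply]

theorem gradSq_eq (G : Eucl n → Matrix (Fin n) (Fin n) ℝ) (u : Eucl n → ℝ) (y : Eucl n) :
    gradSq G u y = ∑ k, partialDeriv k u y * gradVec G u y k := by
  simp only [gradSq, diffSqOp, diffSqMatrix, Matrix.trace, Matrix.diag, Matrix.mul_apply,
    gradVec_apply, Matrix.vecMulVec_apply, Finset.mul_sum]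
  refine Finset.sum_congr rfl fun a _ => Finset.sum_congr rfl fun b _ => ?_
  ring

/-- A rank-one endomorphism satisfies P² = (tr P) P. This is what eliminates F''² from σ₂. -/
theorem diffSqOp_mul_self (G : Eucl n → Matrix (Fin n) (Fin n) ℝ) (u : Eucl n → ℝ) (y : Eucl n) :
    diffSqOp G u y * diffSqOp G u y = gradSq G u y • diffSqOp G u y := by
  have e : diffSqOp G u y = Matrix.vecMulVec ((G y)⁻¹ *ᵥ fun i => partialDeriv i u y)
      (fun i => partialDeriv i u y) := by
    rw [diffSqOp, diffSqMatrix, Matrix.mul_vecMulVec]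
  rw [gradSq, e, Matrix.trace_vecMulVec]
  ext i j
  simp only [Matrix.mul_apply, Matrix.vecMulVec_apply, Matrix.smul_apply, smul_eq_mul, dotProduct,
    Finset.sum_mul]
  refine Finset.sum_congr rfl fun k _ => ?_
  ring

theorem sum_mul_eq_map (A : Eucl n →L[ℝ] ℝ) (b : Eucl n) : ∑ k, A (stdVec k) * b k = A b := by
  conv_rhs => rw [← sum_smul_stdVec b]
  simp [mul_comm]

/-! ### Connection, Ricci, Schouten and σ₂ of a conformal metric -/

namespace MetricOn

variable {G : Eucl n → Matrix (Fin n) (Fin n) ℝ} {U : Set (Eucl n)} {u : Eucl n → ℝ}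

theorem conformalCoord (h : MetricOn G U) (hu : ∀ y ∈ U, ContDiffAt ℝ ∞ u y) :
    MetricOn (conformalCoord G u) U where
  isOpen := h.isOpen
  contDiffAt y hy i j := by
    have : (fun z => ConformalGeometry.conformalCoord G u z i j)
        = fun z => Real.exp (2 * u z) * G z i j := by
      ext z; simp [ConformalGeometry.conformalCoord]
    rw [this]
    exact ((contDiffAt_const.mul (hu y hy)).exp).mul (h.contDiffAt y hy i j)
  posDef y hy := (h.posDef y hy).smul (Real.exp_pos _)

theorem metricForm_conformalCoord (G : Eucl n → Matrix (Fin n) (Fin n) ℝ) (u : Eucl n → ℝ)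
    (y v w : Eucl n) : metricForm (ConformalGeometry.conformalCoord G u) y v w
      = Real.exp (2 * u y) * metricForm G y v w := by
  simp only [metricForm_apply, ConformalGeometry.conformalCoord, Matrix.smul_apply, smul_eq_mul,
    Finset.mul_sum, mul_assoc]

theorem contDiffAt_gradVec (h : MetricOn G U) {y : Eucl n} (hy : y ∈ U)
    (hu : ContDiffAt ℝ ∞ u y) : ContDiffAt ℝ ∞ (gradVec G u) y := by
  unfold gradVec
  exact ContDiffAt.sum fun k _ => (ContDiffAt.sum fun l _ => (h.contDiffAt_inv hy _ _).mul
    (contDiffAt_partialDeriv hu _)).smul contDiffAt_const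

theorem metricForm_gradVec (h : MetricOn G U) {y : Eucl n} (hy : y ∈ U) (w : Eucl n) :
    metricForm G y (gradVec G u y) w = fderiv ℝ u y w := by
  induction w using eucl_induction with
  | zero => simp
  | add a b ha hb => simp only [map_add, ha, hb]
  | smul c a ha => simp only [map_smul, ha]
  | single j =>
  have h1 : G y * (G y)⁻¹ = 1 := Matrix.mul_nonsing_inv _ (h.isUnit_det hy)
  have h2 : (G y * (G y)⁻¹) *ᵥ (fun l => partialDeriv l u y) = fun l => partialDeriv l u y := by
    rw [h1, Matrix.one_mulVec]
  rw [← Matrix.mulVec_mulVec] at h2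
  rw [h.metricForm_symm hy, metricForm_stdVec_left]
  simp only [gradVec_apply]
  exact congrFun h2 j

theorem fderiv_gradVec_eq_gradSq (y : Eucl n) : fderiv ℝ u y (gradVec G u y) = gradSq G u y := by
  rw [gradSq_eq, ← sum_mul_eq_map]
  rfl

/-- The right side is symmetric and compatible with e^{2u} G, so it is the Levi-Civita connection by
uniqueness; nothing is computed from the formula for Christoffel symbols. -/
theorem christoffelMap_conformalCoord (h : MetricOn G U) (hu : ∀ y ∈ U, ContDiffAt ℝ ∞ u y)
    {y : Eucl n} (hy : y ∈ U) (v w : Eucl n) :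
    christoffelMap (ConformalGeometry.conformalCoord G u) y v w = christoffelMap G y v w
      + (fderiv ℝ u y v • w + fderiv ℝ u y w • v - metricForm G y v w • gradVec G u y) := by
  refine (h.conformalCoord hu).eq_christoffelMap hy (Γ := fun v w => christoffelMap G y v w
      + (fderiv ℝ u y v • w + fderiv ℝ u y w • v - metricForm G y v w • gradVec G u y))
    (fun v w => ?_) (fun a v w => ?_) v w
  · rw [h.christoffelMap_symm hy, h.metricForm_symm hy, add_comm (fderiv ℝ u y v • w)]
  · have hu' := ((hu y hy).differentiableAt (by simp)).hasFDerivAt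
    have L := (((h.conformalCoord hu).hasFDerivAt_metricForm hy).clm_apply
      (hasFDerivAt_const v y)).clm_apply (hasFDerivAt_const w y)
    have R := ((hu'.const_mul 2).exp).mul (((h.hasFDerivAt_metricForm hy).clm_apply
      (hasFDerivAt_const v y)).clm_apply (hasFDerivAt_const w y))
    have := congrArg (fun A => A a) (L.unique (R.congr_of_eventuallyEq
      (Filter.Eventually.of_forall fun z => metricForm_conformalCoord G u z v w)))
    simp at this
    rw [this, metricForm_conformalCoord, metricForm_conformalCoord, h.fderiv_metricForm hy]
    simp only [map_add, map_sub, map_smul, add_apply, sub_apply, smul_apply, smul_eq_mul,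
      h.metricForm_gradVec hy, h.metricForm_symm hy _ (gradVec G u y), h.metricForm_symm hy v a]
    ring

/-- The covariant derivative of the gradient. -/
def gradDeriv (G : Eucl n → Matrix (Fin n) (Fin n) ℝ) (u : Eucl n → ℝ) (y : Eucl n) :
    Eucl n →L[ℝ] Eucl n :=
  fderiv ℝ (gradVec G u) y + (christoffelMap G y).flip (gradVec G u y)

theorem hasFDerivAt_gradVec (h : MetricOn G U) {y : Eucl n} (hy : y ∈ U)
    (hu : ContDiffAt ℝ ∞ u y) : HasFDerivAt (gradVec G u) (fderiv ℝ (gradVec G u) y) y :=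
  ((h.contDiffAt_gradVec hy hu).differentiableAt (by simp)).hasFDerivAt

/-- Differentiate g(∇u, c) = du(c) for constant `c` and use metric compatibility: the covariant
derivative of the gradient is the Hessian with an index raised. -/
theorem metricForm_gradDeriv (h : MetricOn G U) (hu : ∀ y ∈ U, ContDiffAt ℝ ∞ u y)
    {y : Eucl n} (hy : y ∈ U) (a c : Eucl n) : metricForm G y (gradDeriv G u y a) c
      = fderiv ℝ (fderiv ℝ u) y a c - fderiv ℝ u y (christoffelMap G y a c) := by
  have d2 : HasFDerivAt (fderiv ℝ u) (fderiv ℝ (fderiv ℝ u) y) y :=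
    (((hu y hy).fderiv_right (m := ∞) (by simp)).differentiableAt (by simp)).hasFDerivAt
  have L := ((h.hasFDerivAt_metricForm hy).clm_apply
    (h.hasFDerivAt_gradVec hy (hu y hy))).clm_apply (hasFDerivAt_const c y)
  have R := d2.clm_apply (hasFDerivAt_const c y)
  have := congrArg (fun A => A a) (L.unique (R.congr_of_eventuallyEq (by
    filter_upwards [h.mem_nhds hy] with z hz using h.metricForm_gradVec hz c)))
  simp [h.fderiv_metricForm hy, h.metricForm_gradVec hy] at this
  rw [← this]
  simp only [gradDeriv, map_add, add_apply, ContinuousLinearMap.flip_apply]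
  ring

theorem fderiv_christoffelMap_conformalCoord (h : MetricOn G U)
    (hu : ∀ y ∈ U, ContDiffAt ℝ ∞ u y) {y : Eucl n} (hy : y ∈ U) (a v w : Eucl n) :
    fderiv ℝ (christoffelMap (ConformalGeometry.conformalCoord G u)) y a v w
      = fderiv ℝ (christoffelMap G) y a v w + (fderiv ℝ (fderiv ℝ u) y a v • w
        + fderiv ℝ (fderiv ℝ u) y a w • v
        - (metricForm G y (christoffelMap G y a v) w + metricForm G y v (christoffelMap G y a w)) •
          gradVec G u y - metricForm G y v w • fderiv ℝ (gradVec G u) y a) := by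
  have d2 : HasFDerivAt (fderiv ℝ u) (fderiv ℝ (fderiv ℝ u) y) y :=
    (((hu y hy).fderiv_right (m := ∞) (by simp)).differentiableAt (by simp)).hasFDerivAt
  have L := (((h.conformalCoord hu).hasFDerivAt_christoffelMap hy).clm_apply
      (hasFDerivAt_const v y)).clm_apply (hasFDerivAt_const w y)
  have R := (((h.hasFDerivAt_christoffelMap hy).clm_apply
      (hasFDerivAt_const v y)).clm_apply (hasFDerivAt_const w y)).add
    ((((d2.clm_apply (hasFDerivAt_const v y)).smul_const w).add
      ((d2.clm_apply (hasFDerivAt_const w y)).smul_const v)).sub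
      ((((h.hasFDerivAt_metricForm hy).clm_apply
      (hasFDerivAt_const v y)).clm_apply (hasFDerivAt_const w y)).smul
        (h.hasFDerivAt_gradVec hy (hu y hy))))
  have := congrArg (fun A => A a) (L.unique (R.congr_of_eventuallyEq (by
    filter_upwards [h.mem_nhds hy] with z hz using h.christoffelMap_conformalCoord hu hz v w)))
  simp [h.fderiv_metricForm hy] at this
  rw [this]
  module

/-- After substituting the conformal connection and its derivative, the coordinate derivatives of ∇u
and the old Christoffel symbols combine into `gradDeriv`; what remains is algebra in `a`, `b`, `c`
and ∇u. -/
theorem curvatureMap_conformalCoord (h : MetricOn G U)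
    (hu : ∀ y ∈ U, ContDiffAt ℝ ∞ u y) {y : Eucl n} (hy : y ∈ U) (a b c : Eucl n) :
    curvatureMap (christoffelMap (ConformalGeometry.conformalCoord G u)) y a b c
      = curvatureMap (christoffelMap G) y a b c
      + metricForm G y (gradDeriv G u y a) c • b - metricForm G y (gradDeriv G u y b) c • a
      - metricForm G y b c • gradDeriv G u y a + metricForm G y a c • gradDeriv G u y b
      + (fderiv ℝ u y b * fderiv ℝ u y c) • a - (fderiv ℝ u y a * fderiv ℝ u y c) • b
      - (metricForm G y b c * gradSq G u y) • a + (metricForm G y a c * gradSq G u y) • b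
      - (fderiv ℝ u y b * metricForm G y a c) • gradVec G u y
      + (fderiv ℝ u y a * metricForm G y b c) • gradVec G u y := by
  have sym2 := ((hu y hy).isSymmSndFDerivAt (by simpa using ENat.LEInfty.out)).eq
  rw [h.metricForm_gradDeriv hu hy, h.metricForm_gradDeriv hu hy]
  simp only [curvatureMap, h.fderiv_christoffelMap_conformalCoord hu hy,
    h.christoffelMap_conformalCoord hu hy, gradDeriv, map_add, map_sub, map_smul, add_apply,
    smul_eq_mul, ContinuousLinearMap.flip_apply,
    h.metricForm_symm hy _ (gradVec G u y), h.metricForm_gradVec hy, fderiv_gradVec_eq_gradSq]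
  rw [h.christoffelMap_symm hy b a, sym2 b a, h.metricForm_symm hy b a]
  module

theorem trace_gradDeriv (h : MetricOn G U) (hu : ∀ y ∈ U, ContDiffAt ℝ ∞ u y)
    {y : Eucl n} (hy : y ∈ U) :
    ∑ k, gradDeriv G u y (stdVec k) k = (hessOp G u y).trace := by
  have e : hessMatrix G u y
      = G y * Matrix.of fun i j => gradDeriv G u y (stdVec j) i := by
    ext i j
    have sym2 := ((hu y hy).isSymmSndFDerivAt (by simpa using ENat.LEInfty.out)).eq
    rw [hessMatrix, Matrix.of_apply, sym2, h.christoffelMap_symm hy,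
      ← h.metricForm_gradDeriv hu hy, h.metricForm_symm hy, metricForm_stdVec_left,
      Matrix.mul_apply]
    rfl
  rw [hessOp, e, Matrix.nonsing_inv_mul_cancel_left _ _ (h.isUnit_det hy)]
  rfl

/-- The trace over the first slot of the conformal curvature formula. Multiples of that slot itself
contribute a factor n, and the trace of `gradDeriv` is the Laplacian. -/
theorem ricciCoord_conformalCoord (h : MetricOn G U) (hu : ∀ y ∈ U, ContDiffAt ℝ ∞ u y)
    {y : Eucl n} (hy : y ∈ U) :
    ricciCoord (ConformalGeometry.conformalCoord G u) y = ricciCoord G y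
      - ((n : ℝ) - 2) • (hessMatrix G u y - diffSqMatrix u y)
      - ((hessOp G u y).trace + ((n : ℝ) - 2) * gradSq G u y) • G y := by
  ext i j
  have t1 (c : Eucl n) (b : Eucl n) : ∑ k, metricForm G y (stdVec k) c * b k
      = metricForm G y b c := by
    simpa using sum_mul_eq_map ((metricForm G y).flip c) b
  have t2 (b : Eucl n) : ∑ k, fderiv ℝ u y (stdVec k) * b k = fderiv ℝ u y b :=
    sum_mul_eq_map _ _
  have t3 (c : Eucl n) (b : Eucl n) :
      ∑ k, metricForm G y (gradDeriv G u y (stdVec k)) c * b k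
      = metricForm G y (gradDeriv G u y b) c := by
    simpa using sum_mul_eq_map (((metricForm G y).flip c).comp (gradDeriv G u y)) b
  have t4 : ∑ k : Fin n, (stdVec k : Eucl n) k = n := by simp
  rw [(h.conformalCoord hu).ricciCoord_eq_trace hy, trace_eq_sum]
  simp only [curvatureEnd, LinearMap.coe_mk, AddHom.coe_mk, h.curvatureMap_conformalCoord hu hy,
    PiLp.add_apply, PiLp.sub_apply, PiLp.smul_apply, smul_eq_mul, Finset.sum_add_distrib,
    Finset.sum_sub_distrib]
  simp only [← Finset.mul_sum, t1, t3, t4, h.trace_gradDeriv hu hy, mul_right_comm _ (fderiv ℝ u y (stdVec i)), mul_assoc (fderiv ℝ u y (stdVec j)),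
    ← Finset.sum_mul, t2, mul_right_comm _ (metricForm G y (stdVec j) (stdVec i)),
    h.metricForm_gradVec hy, fderiv_gradVec_eq_gradSq]
  have t5 : ∑ k, metricForm G y (stdVec k) (stdVec i) * gradSq G u y * (stdVec j : Eucl n) k
      = metricForm G y (stdVec j) (stdVec i) * gradSq G u y := by
    rw [← t1 (stdVec i) (stdVec j), Finset.sum_mul]
    exact Finset.sum_congr rfl fun k _ => by ring
  have t6 : ∑ k, curvatureMap (christoffelMap G) y (stdVec k) (stdVec j) (stdVec i) k
      = ricciCoord G y i j := by
    rw [h.ricciCoord_eq_trace hy, trace_eq_sum]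
    rfl
  have t7 : metricForm G y (gradDeriv G u y (stdVec j)) (stdVec i) = hessMatrix G u y i j := by
    have sym2 := ((hu y hy).isSymmSndFDerivAt (by simpa using ENat.LEInfty.out)).eq
    rw [h.metricForm_gradDeriv hu hy, sym2, h.christoffelMap_symm hy]
    rfl
  have t8 : fderiv ℝ u y (stdVec i) * fderiv ℝ u y (stdVec j) = diffSqMatrix u y i j := rfl
  rw [t5, t6, t7, h.metricForm_symm hy, metricForm_stdVec]
  simp only [Matrix.sub_apply, Matrix.smul_apply, smul_eq_mul, ← t8]
  ring

theorem inv_conformalCoord (h : MetricOn G U) {y : Eucl n} (hy : y ∈ U) :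
    (ConformalGeometry.conformalCoord G u y)⁻¹ = Real.exp (-(2 * u y)) • (G y)⁻¹ := by
  refine Matrix.inv_eq_right_inv ?_
  rw [ConformalGeometry.conformalCoord, Matrix.smul_mul, Matrix.mul_smul, smul_smul,
    Matrix.mul_nonsing_inv _ (h.isUnit_det hy), ← Real.exp_add]
  simp

theorem ricciOp_conformalCoord (h : MetricOn G U) (hu : ∀ y ∈ U, ContDiffAt ℝ ∞ u y)
    {y : Eucl n} (hy : y ∈ U) :
    ricciOp (ConformalGeometry.conformalCoord G u) y = Real.exp (-(2 * u y)) • (ricciOp G y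
      - ((n : ℝ) - 2) • (hessOp G u y - diffSqOp G u y)
      - ((hessOp G u y).trace + ((n : ℝ) - 2) * gradSq G u y) • 1) := by
  rw [ricciOp, h.inv_conformalCoord hy, h.ricciCoord_conformalCoord hu hy, Matrix.smul_mul,
    Matrix.mul_sub, Matrix.mul_sub, Matrix.mul_smul, Matrix.mul_sub, Matrix.mul_smul,
    Matrix.nonsing_inv_mul _ (h.isUnit_det hy)]
  rfl

theorem scalarCoord_conformalCoord (h : MetricOn G U) (hu : ∀ y ∈ U, ContDiffAt ℝ ∞ u y)
    {y : Eucl n} (hy : y ∈ U) :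
    scalarCoord (ConformalGeometry.conformalCoord G u) y = Real.exp (-(2 * u y)) *
      (scalarCoord G y - 2 * ((n : ℝ) - 1) * (hessOp G u y).trace
      - ((n : ℝ) - 1) * ((n : ℝ) - 2) * gradSq G u y) := by
  rw [(h.conformalCoord hu).scalarCoord_eq_trace hy, h.scalarCoord_eq_trace hy,
    h.ricciOp_conformalCoord hu hy]
  simp only [Matrix.trace_smul, Matrix.trace_sub, Matrix.trace_one, Fintype.card_fin, smul_eq_mul]
  rw [← gradSq]
  ring

/-- The Schouten normalization cancels the Laplacian of the Ricci formula, leaving only the Hessian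
and first-order terms. The divisions by n - 1 and n - 2 are where the dimension enters. -/
theorem schoutenOp_conformalCoord (hn : 5 ≤ n) (h : MetricOn G U)
    (hu : ∀ y ∈ U, ContDiffAt ℝ ∞ u y) {y : Eucl n} (hy : y ∈ U) :
    schoutenOp (ConformalGeometry.conformalCoord G u) y = Real.exp (-(2 * u y)) • (schoutenOp G y
      - hessOp G u y + diffSqOp G u y - (gradSq G u y / 2) • 1) := by
  have hn' : (5 : ℝ) ≤ n := by exact_mod_cast hn
  have h1 : (n : ℝ) - 1 ≠ 0 := by linarith
  have h2 : (n : ℝ) - 2 ≠ 0 := by linarith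
  rw [(h.conformalCoord hu).schoutenOp_eq hy, h.schoutenOp_eq hy, h.ricciOp_conformalCoord hu hy]
  simp only [Matrix.trace_smul, Matrix.trace_sub, Matrix.trace_one, Fintype.card_fin, smul_eq_mul]
  rw [← gradSq]
  match_scalars <;> field_simp
  ring

/-- The Hessian of a composition `F ∘ t`. -/
theorem hessOp_comp {F : ℝ → ℝ} (hF : ContDiff ℝ ∞ F) {t : Eucl n → ℝ}
    {y : Eucl n} (ht : ContDiffAt ℝ ∞ t y) :
    hessOp G (fun z => F (t z)) y
      = deriv (deriv F) (t y) • diffSqOp G t y + deriv F (t y) • hessOp G t y := by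
  have d1 (z : Eucl n) (hz : ContDiffAt ℝ 1 t z) :
      HasFDerivAt (fun z => F (t z)) (deriv F (t z) • fderiv ℝ t z) z :=
    (hF.differentiable (by simp)).differentiableAt.hasDerivAt.comp_hasFDerivAt z
      (hz.differentiableAt (by simp)).hasFDerivAt
  have hF' : ContDiff ℝ ∞ (deriv F) := ((contDiff_infty_iff_deriv).1 hF).2
  have e1 : fderiv ℝ (fun z => F (t z)) =ᶠ[nhds y] fun z => deriv F (t z) • fderiv ℝ t z := by
    filter_upwards [(ht.of_le (by simp : (1 : WithTop ℕ∞) ≤ ∞)).eventually (by simp)] with z hz using (d1 z hz).fderiv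
  have d2 : HasFDerivAt (fderiv ℝ t) (fderiv ℝ (fderiv ℝ t) y) y :=
    ((ht.fderiv_right (m := ∞) (by simp)).differentiableAt (by simp)).hasFDerivAt
  have d3 : HasFDerivAt (fun z => deriv F (t z) • fderiv ℝ t z) _ y :=
    (((hF'.differentiable (by simp)).differentiableAt.hasDerivAt (x := t y)).comp_hasFDerivAt
      y (ht.differentiableAt (by simp)).hasFDerivAt).smul d2
  have e2 : hessMatrix G (fun z => F (t z)) y
      = deriv (deriv F) (t y) • diffSqMatrix t y + deriv F (t y) • hessMatrix G t y := by
    ext i j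
    simp only [hessMatrix, Matrix.of_apply, e1.fderiv_eq, (d1 y (ht.of_le (by simp))).fderiv]
    rw [HasFDerivAt.fderiv d3]
    simp [diffSqMatrix, Matrix.vecMulVec_apply, partialDeriv]
    ring
  rw [hessOp, e2, Matrix.mul_add, Matrix.mul_smul, Matrix.mul_smul]
  rfl

theorem diffSqOp_comp {F : ℝ → ℝ} (hF : ContDiff ℝ ∞ F) {t : Eucl n → ℝ}
    {y : Eucl n} (ht : ContDiffAt ℝ ∞ t y) :
    diffSqOp G (fun z => F (t z)) y = (deriv F (t y)) ^ 2 • diffSqOp G t y := by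
  have d1 : HasFDerivAt (fun z => F (t z)) (deriv F (t y) • fderiv ℝ t y) y :=
    (hF.differentiable (by simp)).differentiableAt.hasDerivAt.comp_hasFDerivAt y
      (ht.differentiableAt (by simp)).hasFDerivAt
  rw [diffSqOp, diffSqOp, ← Matrix.mul_smul]
  congr 1
  ext i j
  simp [diffSqMatrix, Matrix.vecMulVec_apply, partialDeriv, d1.fderiv]
  ring

theorem gradSq_comp {F : ℝ → ℝ} (hF : ContDiff ℝ ∞ F) {t : Eucl n → ℝ}
    {y : Eucl n} (ht : ContDiffAt ℝ ∞ t y) :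
    gradSq G (fun z => F (t z)) y = (deriv F (t y)) ^ 2 * gradSq G t y := by
  rw [gradSq, diffSqOp_comp hF ht, Matrix.trace_smul, gradSq, smul_eq_mul]

/-- Expansion of ((tr A)² - tr A²)/2 with ∇²u = F'' dt⊗dt + F' ∇²t. With `f₁` of weight 1 and `f₂`
of weight 2, the first summand collects weight 4; all others have weight at most 3, with
coefficients that depend on `G` and `t` but not on `F`. -/
theorem sigmaTwoMatrix_conformalCoord_comp (hn : 5 ≤ n) (h : MetricOn G U) {F : ℝ → ℝ}
    (hF : ContDiff ℝ ∞ F) {t : Eucl n → ℝ} (ht : ∀ y ∈ U, ContDiffAt ℝ ∞ t y)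
    {y : Eucl n} (hy : y ∈ U) (f₁ f₂ : ℝ) (h1 : deriv F (t y) = f₁)
    (h2 : deriv (deriv F) (t y) = f₂) :
    Real.exp (4 * F (t y)) *
      sigmaTwoMatrix (schoutenOp (ConformalGeometry.conformalCoord G fun z => F (t z)) y)
    = ((n : ℝ) - 1) / 2 * gradSq G t y ^ 2 * (f₁ ^ 2 * f₂ + ((n : ℝ) - 4) / 4 * f₁ ^ 4)
      + (((schoutenOp G y).trace ^ 2 - (schoutenOp G y * schoutenOp G y).trace) / 2
      + ((schoutenOp G y * hessOp G t y).trace - (schoutenOp G y).trace * (hessOp G t y).trace)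
        * f₁
      + ((schoutenOp G y * diffSqOp G t y).trace - (schoutenOp G y).trace * gradSq G t y) * f₂
      + (((hessOp G t y).trace ^ 2 - (hessOp G t y * hessOp G t y).trace) / 2
        + (3 - n) / 2 * (schoutenOp G y).trace * gradSq G t y
        - (schoutenOp G y * diffSqOp G t y).trace) * f₁ ^ 2
      + (gradSq G t y * (hessOp G t y).trace - (diffSqOp G t y * hessOp G t y).trace) * (f₁ * f₂)
      + ((diffSqOp G t y * hessOp G t y).trace
        + (n - 3) / 2 * gradSq G t y * (hessOp G t y).trace) * f₁ ^ 3) := by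
  have hu : ∀ y ∈ U, ContDiffAt ℝ ∞ (fun z => F (t z)) y := fun y hy =>
    hF.contDiffAt.comp y (ht y hy)
  have e0 : Real.exp (4 * F (t y)) * (Real.exp (-(2 * F (t y))) * Real.exp (-(2 * F (t y)))) = 1 := by
    rw [← Real.exp_add, ← Real.exp_add]
    ring_nf
    exact Real.exp_zero
  rw [h.schoutenOp_conformalCoord hn hu hy, hessOp_comp hF (ht y hy), diffSqOp_comp hF (ht y hy),
    gradSq_comp hF (ht y hy), h1, h2, sigmaTwoMatrix_eq_trace]
  simp only [Matrix.trace_smul, Matrix.smul_mul, Matrix.mul_smul, smul_eq_mul, Matrix.add_mul,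
    Matrix.mul_add, Matrix.sub_mul, Matrix.mul_sub, Matrix.mul_one, Matrix.one_mul,
    Matrix.trace_add, Matrix.trace_sub, diffSqOp_mul_self, Matrix.trace_one, Fintype.card_fin]
  rw [Matrix.trace_mul_comm (hessOp G t y) (schoutenOp G y),
    Matrix.trace_mul_comm (hessOp G t y) (diffSqOp G t y),
    Matrix.trace_mul_comm (diffSqOp G t y) (schoutenOp G y), ← gradSq]
  have hp : Real.exp (-(2 * F (t y))) ≠ 0 := Real.exp_ne_zero _
  -- With the exponentials as atoms p and q = p⁻², the identity is rational in the traces.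
  generalize Real.exp (-(2 * F (t y))) = p at *
  generalize Real.exp (4 * F (t y)) = q at *
  obtain rfl : q = (p * p)⁻¹ := eq_inv_of_mul_eq_one_left e0
  field_simp
  ring

end MetricOn

end ConformalChange

/-! ### The metric of a manifold in its charts -/

section Charts

variable {n : ℕ} {M : Type*} [TopologicalSpace M] [ChartedSpace (EuclideanSpace ℝ (Fin n)) M]
  [IsManifold (𝓡 n) ∞ M]

/-- The inner product `g_x`, on the model space. -/
def innerAt (g : SmoothMetric n M) (x : M) : Eucl n →L[ℝ] Eucl n →L[ℝ] ℝ := g.inner x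

/-- The differential of the parametrization inverse to a chart. -/
def symmDeriv (x₀ : M) (y : Eucl n) : Eucl n →L[ℝ] Eucl n :=
  mfderiv (𝓡 n) (𝓡 n) (extChartAt (𝓡 n) x₀).symm y

theorem innerAt_symm (g : SmoothMetric n M) (x : M) (v w : Eucl n) :
    innerAt g x v w = innerAt g x w v := g.symm x v w

theorem innerAt_pos (g : SmoothMetric n M) (x : M) {v : Eucl n} (hv : v ≠ 0) :
    0 < innerAt g x v v := g.pos x v hv

theorem gramInChart_apply (g : SmoothMetric n M) (x₀ : M) (y : Eucl n) (i j : Fin n) :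
    gramInChart g x₀ y i j = innerAt g ((extChartAt (𝓡 n) x₀).symm y)
      (symmDeriv x₀ y (stdVec i)) (symmDeriv x₀ y (stdVec j)) := rfl

theorem metricForm_gramInChart (g : SmoothMetric n M) (x₀ : M) (y v w : Eucl n) :
    metricForm (gramInChart g x₀) y v w = innerAt g ((extChartAt (𝓡 n) x₀).symm y)
      (symmDeriv x₀ y v) (symmDeriv x₀ y w) := by
  induction v using eucl_induction with
  | zero => simp
  | add a b ha hb => simp only [map_add, add_apply, ha, hb]
  | smul c a ha => simp only [map_smul, smul_apply, ha]
  | single i =>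
  induction w using eucl_induction with
  | zero => simp
  | add a b ha hb => simp only [map_add, ha, hb]
  | smul c a ha => simp only [map_smul, ha]
  | single j => rw [metricForm_stdVec, gramInChart_apply]

theorem symmDeriv_isInvertible {x₀ : M} {y : Eucl n} (hy : y ∈ (extChartAt (𝓡 n) x₀).target) :
    (symmDeriv x₀ y).IsInvertible := by
  have : IsManifold (𝓡 n) 1 M := IsManifold.of_le (n := ∞) (by simp)
  have := isInvertible_mfderivWithin_extChartAt_symm (I := 𝓡 n) hy
  rw [ModelWithCorners.range_eq_univ, mfderivWithin_univ] at this
  exact this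

theorem symmDeriv_injective {x₀ : M} {y : Eucl n} (hy : y ∈ (extChartAt (𝓡 n) x₀).target) :
    Function.Injective (symmDeriv x₀ y) :=
  (symmDeriv_isInvertible hy).bijective.1

/-- A coordinate field is the tangent map of the parametrization applied to a constant section,
hence a smooth section of the tangent bundle. -/
theorem contMDiffOn_symmDeriv (x₀ : M) (v : Eucl n) :
    ContMDiffOn (𝓡 n) ((𝓡 n).prod (𝓡 n)) ∞
      (fun y => TotalSpace.mk' (EuclideanSpace ℝ (Fin n)) (E := (TangentSpace (𝓡 n) : M → Type _))
        ((extChartAt (𝓡 n) x₀).symm y) (symmDeriv x₀ y v)) (extChartAt (𝓡 n) x₀).target := by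
  have h := contMDiffOn_extChartAt_symm (I := 𝓡 n) (n := ∞) x₀
  have ho := isOpen_extChartAt_target (I := 𝓡 n) x₀
  have h2 := h.contMDiffOn_tangentMapWithin (m := ∞) (by simp) ho.uniqueMDiffOn
  have h3 : ContMDiff (𝓡 n) ((𝓡 n).prod (𝓡 n)) ∞
      (fun y : Eucl n => (⟨y, v⟩ : TangentBundle (𝓡 n) (Eucl n))) :=
    contMDiff_vectorSpace_iff_contDiff.2 contDiff_const
  refine (h2.comp h3.contMDiffOn (fun y hy => hy)).congr fun y hy => ?_
  simp only [Function.comp, tangentMapWithin]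
  rw [mfderivWithin_of_isOpen ho hy]
  rfl

theorem contDiffOn_gramInChart (g : SmoothMetric n M) (x₀ : M) (i j : Fin n) :
    ContDiffOn ℝ ∞ (fun y => gramInChart g x₀ y i j) (extChartAt (𝓡 n) x₀).target := by
  have h := contMDiffOn_extChartAt_symm (I := 𝓡 n) (n := ∞) x₀
  have := ContMDiffOn.clm_bundle_apply₂ (F₁ := EuclideanSpace ℝ (Fin n))
    (F₂ := EuclideanSpace ℝ (Fin n)) (F₃ := ℝ) (E₃ := Bundle.Trivial M ℝ)
    (g.contMDiff.comp_contMDiffOn h)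
    (contMDiffOn_symmDeriv x₀ (stdVec i)) (contMDiffOn_symmDeriv x₀ (stdVec j))
  rw [← contMDiffOn_iff_contDiffOn]
  intro y hy
  have h2 := this y hy
  rw [contMDiffWithinAt_totalSpace] at h2
  exact h2.2

theorem metricOn_gramInChart (g : SmoothMetric n M) (x₀ : M) :
    MetricOn (gramInChart g x₀) (extChartAt (𝓡 n) x₀).target where
  isOpen := isOpen_extChartAt_target x₀
  contDiffAt y hy i j :=
    (contDiffOn_gramInChart g x₀ i j).contDiffAt ((isOpen_extChartAt_target x₀).mem_nhds hy)
  posDef y hy := by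
    refine Matrix.PosDef.of_dotProduct_mulVec_pos ?_ fun v hv => ?_
    · ext i j
      simp [gramInChart_apply, innerAt_symm g _ (symmDeriv x₀ y (stdVec i))]
    · have hv' : (WithLp.toLp 2 v : Eucl n) ≠ 0 := fun e => hv (by
        ext i; exact congrArg (fun w : Eucl n => w i) e)
      have := innerAt_pos g ((extChartAt (𝓡 n) x₀).symm y)
        (fun e => hv' (symmDeriv_injective hy (e.trans (map_zero _).symm)))
      rw [← metricForm_gramInChart, metricForm_apply] at this
      refine this.trans_eq ?_
      simp only [dotProduct, Matrix.mulVec, Finset.mul_sum]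
      refine Finset.sum_congr rfl fun i _ => Finset.sum_congr rfl fun j _ => ?_
      simp
      ring

/-- The change of charts. -/
def chartChange (x₀ x₁ : M) : Eucl n → Eucl n :=
  fun y => extChartAt (𝓡 n) x₁ ((extChartAt (𝓡 n) x₀).symm y)

/-- The domain of the change of charts. -/
def chartOverlap (x₀ x₁ : M) : Set (Eucl n) :=
  (extChartAt (𝓡 n) x₀).target ∩ (extChartAt (𝓡 n) x₀).symm ⁻¹' (extChartAt (𝓡 n) x₁).source

theorem isOpen_chartOverlap (x₀ x₁ : M) : IsOpen (chartOverlap (n := n) x₀ x₁) :=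
  (continuousOn_extChartAt_symm x₀).isOpen_inter_preimage (isOpen_extChartAt_target x₀)
    (isOpen_extChartAt_source x₁)

theorem contDiffAt_chartChange {x₀ x₁ : M} {y : Eucl n} (hy : y ∈ chartOverlap x₀ x₁) :
    ContDiffAt ℝ ∞ (chartChange x₀ x₁) y := by
  rw [← contMDiffAt_iff_contDiffAt]
  exact ContMDiffAt.comp y (contMDiffAt_extChartAt' (by simpa using hy.2))
    ((contMDiffOn_extChartAt_symm x₀).contMDiffAt ((isOpen_extChartAt_target x₀).mem_nhds hy.1))

theorem symmDeriv_chartChange {x₀ x₁ : M} {y : Eucl n} (hy : y ∈ chartOverlap x₀ x₁) :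
    symmDeriv x₀ y
      = (symmDeriv x₁ (chartChange x₀ x₁ y)).comp (fderiv ℝ (chartChange x₀ x₁) y) := by
  have h1 : (extChartAt (𝓡 n) x₀).symm =ᶠ[nhds y]
      (extChartAt (𝓡 n) x₁).symm ∘ chartChange x₀ x₁ := by
    filter_upwards [(isOpen_chartOverlap x₀ x₁).mem_nhds hy] with z hz
    exact ((extChartAt (𝓡 n) x₁).left_inv hz.2).symm
  have ht : chartChange x₀ x₁ y ∈ (extChartAt (𝓡 n) x₁).target :=
    (extChartAt (𝓡 n) x₁).map_source hy.2
  have d1 : MDifferentiableAt (𝓡 n) (𝓡 n) (extChartAt (𝓡 n) x₁).symm (chartChange x₀ x₁ y) :=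
    ((contMDiffOn_extChartAt_symm (n := ∞) x₁).contMDiffAt
      ((isOpen_extChartAt_target x₁).mem_nhds ht)).mdifferentiableAt (by simp)
  have d2 : MDifferentiableAt (𝓡 n) (𝓡 n) (chartChange (n := n) x₀ x₁) y :=
    ((contDiffAt_chartChange hy).differentiableAt (by simp)).mdifferentiableAt
  have := h1.mfderiv_eq (I := 𝓡 n) (I' := 𝓡 n)
  rw [symmDeriv, this, mfderiv_comp y d1 d2, mfderiv_eq_fderiv]
  rfl

/-- By the chain rule both Gram matrices represent the same inner products, so all invariance
results for isometries apply to changes of charts. -/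
theorem isometryOn_chartChange (g : SmoothMetric n M) (x₀ x₁ : M) :
    IsometryOn (chartChange x₀ x₁) (gramInChart g x₀) (chartOverlap x₀ x₁)
      (gramInChart g x₁) (extChartAt (𝓡 n) x₁).target where
  left :=
    { isOpen := isOpen_chartOverlap x₀ x₁
      contDiffAt := fun y hy => (metricOn_gramInChart g x₀).contDiffAt y hy.1
      posDef := fun y hy => (metricOn_gramInChart g x₀).posDef y hy.1 }
  right := metricOn_gramInChart g x₁
  contDiffAt y hy := contDiffAt_chartChange hy
  mapsTo y hy := (extChartAt (𝓡 n) x₁).map_source hy.2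
  metric_eq y hy := by
    ext i j
    have e : (extChartAt (𝓡 n) x₀).symm y
        = (extChartAt (𝓡 n) x₁).symm (chartChange x₀ x₁ y) :=
      ((extChartAt (𝓡 n) x₁).left_inv hy.2).symm
    rw [gramInChart_apply, symmDeriv_chartChange hy, e, ContinuousLinearMap.comp_apply,
      ContinuousLinearMap.comp_apply, ← metricForm_gramInChart, metricForm_apply]
    simp only [Matrix.mul_apply, Matrix.transpose_apply, jacobianMatrix, Matrix.of_apply,
      Finset.sum_mul]
    rw [Finset.sum_comm]
    refine Finset.sum_congr rfl fun a _ => Finset.sum_congr rfl fun b _ => ?_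
    ring

theorem extChartAt_mem_chartOverlap {x x₀ : M} (hx : x ∈ (extChartAt (𝓡 n) x₀).source) :
    extChartAt (𝓡 n) x x ∈ chartOverlap (n := n) x x₀ :=
  ⟨mem_extChartAt_target x, by simpa using hx⟩

theorem chartChange_extChartAt (x x₀ : M) :
    chartChange x x₀ (extChartAt (𝓡 n) x x) = extChartAt (𝓡 n) x₀ x := by
  simp [chartChange]

/-- The definition uses a different chart at each point. Independence of the chart allows one fixed
chart for all points near `x₀`, which continuity and estimates require. -/
theorem scalarCurvature_eq (g : SmoothMetric n M) {x x₀ : M}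
    (hx : x ∈ (extChartAt (𝓡 n) x₀).source) :
    scalarCurvature g x = scalarCoord (gramInChart g x₀) (extChartAt (𝓡 n) x₀ x) := by
  rw [scalarCurvature, (isometryOn_chartChange g x x₀).scalarCoord_eq
    (extChartAt_mem_chartOverlap hx), chartChange_extChartAt]

theorem sigmaTwo_eq (g : SmoothMetric n M) {x x₀ : M}
    (hx : x ∈ (extChartAt (𝓡 n) x₀).source) :
    sigmaTwo g x = sigmaTwoMatrix (schoutenOp (gramInChart g x₀) (extChartAt (𝓡 n) x₀ x)) := by
  have := (isometryOn_chartChange g x x₀).sigmaTwoMatrix_eq (extChartAt_mem_chartOverlap hx)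
  rw [chartChange_extChartAt] at this
  exact this

end Charts

/-! ### The Riemannian measure in a chart -/

section Volume

variable {n : ℕ} {M : Type*} [TopologicalSpace M] [ChartedSpace (EuclideanSpace ℝ (Fin n)) M]
  [IsManifold (𝓡 n) ∞ M]

/-- The density `√(det g)` of the Riemannian measure in a chart. -/
def volDensity (g : SmoothMetric n M) (x₀ : M) (y : Eucl n) : ℝ :=
  Real.sqrt (gramInChart g x₀ y).det

theorem volDensity_pos (g : SmoothMetric n M) {x₀ : M} {y : Eucl n}
    (hy : y ∈ (extChartAt (𝓡 n) x₀).target) : 0 < volDensity g x₀ y :=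
  Real.sqrt_pos.2 ((metricOn_gramInChart g x₀).det_pos hy)

theorem contDiffOn_volDensity (g : SmoothMetric n M) (x₀ : M) :
    ContDiffOn ℝ ∞ (volDensity g x₀) (extChartAt (𝓡 n) x₀).target := fun _ hy =>
  (((metricOn_gramInChart g x₀).contDiffAt_det hy).sqrt
    ((metricOn_gramInChart g x₀).det_pos hy).ne').contDiffWithinAt

theorem measurableSet_chart_target (x₀ : M) : MeasurableSet (extChartAt (𝓡 n) x₀).target :=
  (isOpen_extChartAt_target x₀).measurableSet

theorem aemeasurable_volDensity (g : SmoothMetric n M) (x₀ : M) :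
    AEMeasurable (fun y => ENNReal.ofReal (volDensity g x₀ y))
      (volume.restrict (extChartAt (𝓡 n) x₀).target) :=
  ((contDiffOn_volDensity g x₀).continuousOn.aemeasurable
    (measurableSet_chart_target x₀)).ennreal_ofReal

/-- The determinant of JᵀG₁J is (det J)² det G₁. -/
theorem volDensity_chartChange (g : SmoothMetric n M) {x₀ x₁ : M} {y : Eucl n}
    (hy : y ∈ chartOverlap x₀ x₁) : volDensity g x₀ y =
      |(fderiv ℝ (chartChange x₀ x₁) y).det| * volDensity g x₁ (chartChange x₀ x₁ y) := by
  have e : (fderiv ℝ (chartChange (n := n) x₀ x₁) y).det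
      = (jacobianMatrix (chartChange x₀ x₁) y).det := by
    rw [ContinuousLinearMap.det,
      ← LinearMap.det_toMatrix (EuclideanSpace.basisFun (Fin n) ℝ).toBasis]
    congr 1
  rw [e, volDensity, (isometryOn_chartChange g x₀ x₁).metric_eq y hy, Matrix.det_mul,
    Matrix.det_mul, Matrix.det_transpose, mul_right_comm, Real.sqrt_mul (mul_self_nonneg _),
    Real.sqrt_mul_self_eq_abs, volDensity]

theorem gramInChart_conformalMetric (g : SmoothMetric n M) (u : M → ℝ)
    (hu : ContMDiff (𝓡 n) 𝓘(ℝ, ℝ) ∞ u) (x₀ : M) :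
    gramInChart (conformalMetric g u hu) x₀
      = conformalCoord (gramInChart g x₀) fun y => u ((extChartAt (𝓡 n) x₀).symm y) := rfl

theorem contDiffAt_comp_symm {u : M → ℝ} (hu : ContMDiff (𝓡 n) 𝓘(ℝ, ℝ) ∞ u) {x₀ : M} {y : Eucl n}
    (hy : y ∈ (extChartAt (𝓡 n) x₀).target) :
    ContDiffAt ℝ ∞ (fun z => u ((extChartAt (𝓡 n) x₀).symm z)) y := by
  rw [← contMDiffAt_iff_contDiffAt]
  exact (hu _).comp y
    ((contMDiffOn_extChartAt_symm x₀).contMDiffAt ((isOpen_extChartAt_target x₀).mem_nhds hy))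

theorem volDensity_conformalMetric (g : SmoothMetric n M) (u : M → ℝ)
    (hu : ContMDiff (𝓡 n) 𝓘(ℝ, ℝ) ∞ u) (x₀ : M) (y : Eucl n) :
    volDensity (conformalMetric g u hu) x₀ y
      = Real.exp (n * u ((extChartAt (𝓡 n) x₀).symm y)) * volDensity g x₀ y := by
  have : (Real.exp (2 * u ((extChartAt (𝓡 n) x₀).symm y))) ^ n
      = Real.exp (n * u ((extChartAt (𝓡 n) x₀).symm y)) ^ 2 := by
    rw [← Real.exp_nat_mul, ← Real.exp_nat_mul]
    push_cast
    ring_nf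
  rw [volDensity, gramInChart_conformalMetric, conformalCoord, Matrix.det_smul, Fintype.card_fin,
    this, Real.sqrt_mul (sq_nonneg _), Real.sqrt_sq (Real.exp_pos _).le, volDensity]

variable [MeasurableSpace M] [BorelSpace M]

theorem measurableSet_chart_source (x₀ : M) : MeasurableSet (extChartAt (𝓡 n) x₀).source :=
  (isOpen_extChartAt_source x₀).measurableSet

theorem aemeasurable_chart_symm (x₀ : M) : AEMeasurable (extChartAt (𝓡 n) x₀).symm
    (volume.restrict (extChartAt (𝓡 n) x₀).target) :=
  (continuousOn_extChartAt_symm x₀).aemeasurable (measurableSet_chart_target x₀)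

theorem aemeasurable_chart_symm_withDensity (g : SmoothMetric n M) (x₀ : M) :
    AEMeasurable (extChartAt (𝓡 n) x₀).symm
    ((volume.restrict (extChartAt (𝓡 n) x₀).target).withDensity
      fun y => ENNReal.ofReal (volDensity g x₀ y)) :=
  (aemeasurable_chart_symm x₀).mono_ac (withDensity_absolutelyContinuous _ _)

theorem measurableSet_chart_preimage (x₀ : M) {A : Set M} (hA : MeasurableSet A) :
    MeasurableSet ((extChartAt (𝓡 n) x₀).target ∩ (extChartAt (𝓡 n) x₀).symm ⁻¹' A) := by
  have h := (continuousOn_extChartAt_symm (I := 𝓡 n) x₀).domRestrict.measurable hA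
  have := (measurableSet_chart_target (n := n) x₀).subtype_image h
  convert this using 1
  ext y
  simp [and_comm]

theorem chartVolume_apply (g : SmoothMetric n M) (x₀ : M) {A : Set M} (hA : MeasurableSet A) :
    chartVolume g x₀ A =
      ∫⁻ y in (extChartAt (𝓡 n) x₀).target ∩ (extChartAt (𝓡 n) x₀).symm ⁻¹' A,
        ENNReal.ofReal (volDensity g x₀ y) := by
  change Measure.map _ ((volume.restrict (extChartAt (𝓡 n) x₀).target).withDensity
      fun y => ENNReal.ofReal (volDensity g x₀ y)) A = _
  rw [Measure.map_apply_of_aemeasurable (aemeasurable_chart_symm_withDensity g x₀) hA,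
    withDensity_apply', Measure.restrict_restrict' (measurableSet_chart_target x₀), Set.inter_comm]

theorem chartVolume_eq_of_subset (g : SmoothMetric n M) (x₀ x₁ : M) {A : Set M}
    (hA : MeasurableSet A) (h₀ : A ⊆ (extChartAt (𝓡 n) x₀).source)
    (h₁ : A ⊆ (extChartAt (𝓡 n) x₁).source) : chartVolume g x₀ A = chartVolume g x₁ A := by
  set S := (extChartAt (𝓡 n) x₀).target ∩ (extChartAt (𝓡 n) x₀).symm ⁻¹' A with hS
  have hSo : S ⊆ chartOverlap x₀ x₁ := fun y hy => ⟨hy.1, h₁ hy.2⟩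
  have himg : chartChange x₀ x₁ '' S
      = (extChartAt (𝓡 n) x₁).target ∩ (extChartAt (𝓡 n) x₁).symm ⁻¹' A := by
    ext z
    constructor
    · rintro ⟨y, hy, rfl⟩
      refine ⟨(extChartAt (𝓡 n) x₁).map_source (h₁ hy.2), ?_⟩
      rw [Set.mem_preimage, chartChange, (extChartAt (𝓡 n) x₁).left_inv (h₁ hy.2)]
      exact hy.2
    · rintro ⟨hz, hzA⟩
      refine ⟨extChartAt (𝓡 n) x₀ ((extChartAt (𝓡 n) x₁).symm z), ⟨?_, ?_⟩, ?_⟩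
      · exact (extChartAt (𝓡 n) x₀).map_source (h₀ hzA)
      · rw [Set.mem_preimage, (extChartAt (𝓡 n) x₀).left_inv (h₀ hzA)]
        exact hzA
      · rw [chartChange, (extChartAt (𝓡 n) x₀).left_inv (h₀ hzA),
          (extChartAt (𝓡 n) x₁).right_inv hz]
  have hinj : Set.InjOn (chartChange x₀ x₁) S := by
    intro y hy z hz hyz
    have := (extChartAt (𝓡 n) x₁).injOn (h₁ hy.2) (h₁ hz.2) hyz
    exact (extChartAt (𝓡 n) x₀).symm.injOn hy.1 hz.1 this
  rw [chartVolume_apply g x₀ hA, chartVolume_apply g x₁ hA, ← himg,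
    lintegral_image_eq_lintegral_abs_det_fderiv_mul volume (measurableSet_chart_preimage x₀ hA)
      (fun y hy => ((isometryOn_chartChange g x₀ x₁).hasFDerivAt (hSo hy)).hasFDerivWithinAt) hinj]
  refine setLIntegral_congr_fun (measurableSet_chart_preimage x₀ hA) fun y hy => ?_
  rw [← ENNReal.ofReal_mul (abs_nonneg _), ← volDensity_chartChange g (hSo hy)]

theorem chartVolume_inter_source (g : SmoothMetric n M) (x₀ : M) {A : Set M}
    (hA : MeasurableSet A) :
    chartVolume g x₀ (A ∩ (extChartAt (𝓡 n) x₀).source) = chartVolume g x₀ A := by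
  rw [chartVolume_apply g x₀ hA,
    chartVolume_apply g x₀ (hA.inter (measurableSet_chart_source x₀))]
  congr 2
  ext y
  exact ⟨fun h => ⟨h.1, h.2.1⟩, fun h => ⟨h.1, h.2, (extChartAt (𝓡 n) x₀).map_target h.1⟩⟩

/-- A supremum of measures is not computed setwise, so it is bounded above by one explicit measure
whose restriction to the chart domain is the chart measure. -/
theorem riemannianVolume_restrict_source (g : SmoothMetric n M) (x₀ : M) :
    (riemannianVolume g).restrict (extChartAt (𝓡 n) x₀).source = chartVolume g x₀ := by
  have hs := measurableSet_chart_source (n := n) x₀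
  -- Each chart measure is split along the source of the chart at `x₀`: inside, it agrees with
  -- `chartVolume g x₀`; outside, it is at most the supremum.
  have hle : riemannianVolume g ≤ chartVolume g x₀
      + (riemannianVolume g).restrict (extChartAt (𝓡 n) x₀).sourceᶜ := by
    refine iSup_le fun x₁ => Measure.le_iff.2 fun A hA => ?_
    have hs₁ := measurableSet_chart_source (n := n) x₁
    rw [Measure.add_apply, Measure.restrict_apply hA, ← measure_inter_add_sdiff A hs]
    refine add_le_add ?_ ?_
    · rw [← chartVolume_inter_source g x₁ (hA.inter hs),
        chartVolume_eq_of_subset g x₁ x₀ ((hA.inter hs).inter hs₁) (fun y hy => hy.2)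
          (fun y hy => hy.1.2)]
      exact measure_mono fun y hy => hy.1.1
    · exact Measure.le_iff'.1 (le_iSup (chartVolume g) x₁) _
  refine le_antisymm (Measure.le_iff.2 fun A hA => ?_) (Measure.le_iff.2 fun A hA => ?_)
  · rw [Measure.restrict_apply hA]
    refine (Measure.le_iff'.1 hle _).trans ?_
    rw [Measure.add_apply, Measure.restrict_apply (hA.inter hs), chartVolume_inter_source g x₀ hA,
      Set.inter_assoc, Set.inter_compl_self, Set.inter_empty, measure_empty, add_zero]
  · rw [Measure.restrict_apply hA, ← chartVolume_inter_source g x₀ hA]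
    exact Measure.le_iff'.1 (le_iSup (chartVolume g) x₀) _

theorem riemannianVolume_apply_of_subset (g : SmoothMetric n M) (x₀ : M) {A : Set M}
    (hA : MeasurableSet A) (h : A ⊆ (extChartAt (𝓡 n) x₀).source) :
    riemannianVolume g A = ∫⁻ y in (extChartAt (𝓡 n) x₀).target ∩
      (extChartAt (𝓡 n) x₀).symm ⁻¹' A, ENNReal.ofReal (volDensity g x₀ y) := by
  rw [← chartVolume_apply g x₀ hA, ← riemannianVolume_restrict_source, Measure.restrict_apply hA,
    Set.inter_eq_left.2 h]

theorem setIntegral_source_eq (g : SmoothMetric n M) (x₀ : M) {f : M → ℝ}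
    (hf : AEStronglyMeasurable f (riemannianVolume g)) :
    ∫ x in (extChartAt (𝓡 n) x₀).source, f x ∂(riemannianVolume g)
      = ∫ y in (extChartAt (𝓡 n) x₀).target,
        f ((extChartAt (𝓡 n) x₀).symm y) * volDensity g x₀ y := by
  have hf' := hf.restrict (s := (extChartAt (𝓡 n) x₀).source)
  rw [riemannianVolume_restrict_source] at hf' ⊢
  refine (integral_map (aemeasurable_chart_symm_withDensity g x₀) hf').trans ?_
  rw [integral_withDensity_eq_integral_toReal_smul₀ (aemeasurable_volDensity g x₀) (by simp)]
  refine setIntegral_congr_fun (measurableSet_chart_target x₀) fun y hy => ?_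
  simp only [smul_eq_mul]
  rw [ENNReal.toReal_ofReal (volDensity_pos g hy).le, mul_comm]

/-- The density is bounded on a compact neighbourhood in a chart. On a compact manifold this gives
finite volume and integrability of continuous functions. -/
instance isLocallyFiniteMeasure_riemannianVolume (g : SmoothMetric n M) :
    IsLocallyFiniteMeasure (riemannianVolume g) := by
  refine ⟨fun x₀ => ?_⟩
  have hT := (isOpen_extChartAt_target (I := 𝓡 n) x₀).mem_nhds (mem_extChartAt_target x₀)
  obtain ⟨K, hK, hKT, hKc⟩ := local_compact_nhds hT
  have hmem : (extChartAt (𝓡 n) x₀).source ∩ extChartAt (𝓡 n) x₀ ⁻¹' (interior K) ∈ nhds x₀ :=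
    Filter.inter_mem (extChartAt_source_mem_nhds x₀)
      ((continuousAt_extChartAt x₀).preimage_mem_nhds (isOpen_interior.mem_nhds
        (mem_interior_iff_mem_nhds.2 hK)))
  have hopen : IsOpen ((extChartAt (𝓡 n) x₀).source ∩ extChartAt (𝓡 n) x₀ ⁻¹' (interior K)) :=
    (continuousOn_extChartAt x₀).isOpen_inter_preimage (isOpen_extChartAt_source x₀)
      isOpen_interior
  refine ⟨_, hmem, ?_⟩
  rw [riemannianVolume_apply_of_subset g x₀ hopen.measurableSet Set.inter_subset_left]
  obtain ⟨C, hC⟩ := hKc.bddAbove_image ((contDiffOn_volDensity g x₀).continuousOn.mono hKT)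
  calc _ ≤ ∫⁻ y in K, ENNReal.ofReal C := by
        refine (lintegral_mono_set fun y hy => ?_).trans (setLIntegral_mono' hKc.measurableSet
          fun y hy => ENNReal.ofReal_le_ofReal (hC ⟨y, hy, rfl⟩))
        have := interior_subset hy.2.2
        rwa [(extChartAt (𝓡 n) x₀).right_inv hy.1] at this
    _ < ⊤ := by
        rw [setLIntegral_const]
        exact ENNReal.mul_lt_top ENNReal.ofReal_lt_top hKc.measure_lt_top

instance isOpenPosMeasure_riemannianVolume (g : SmoothMetric n M) :
    (riemannianVolume g).IsOpenPosMeasure := by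
  refine ⟨fun V hV ⟨x₀, hx₀⟩ h0 => ?_⟩
  have hW : IsOpen (V ∩ (extChartAt (𝓡 n) x₀).source) := hV.inter (isOpen_extChartAt_source x₀)
  have h1 := measure_mono_null (Set.inter_subset_left (t := (extChartAt (𝓡 n) x₀).source)) h0
  rw [riemannianVolume_apply_of_subset g x₀ hW.measurableSet Set.inter_subset_right] at h1
  have hS : IsOpen ((extChartAt (𝓡 n) x₀).target ∩
      (extChartAt (𝓡 n) x₀).symm ⁻¹' (V ∩ (extChartAt (𝓡 n) x₀).source)) :=
    (continuousOn_extChartAt_symm x₀).isOpen_inter_preimage (isOpen_extChartAt_target x₀) hW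
  have hpos : 0 < volume ((extChartAt (𝓡 n) x₀).target ∩
      (extChartAt (𝓡 n) x₀).symm ⁻¹' (V ∩ (extChartAt (𝓡 n) x₀).source)) :=
    hS.measure_pos _ ⟨extChartAt (𝓡 n) x₀ x₀, mem_extChartAt_target x₀, by simpa using hx₀⟩
  have hm : AEMeasurable (fun y => ENNReal.ofReal (volDensity g x₀ y))
      (volume.restrict ((extChartAt (𝓡 n) x₀).target ∩
      (extChartAt (𝓡 n) x₀).symm ⁻¹' (V ∩ (extChartAt (𝓡 n) x₀).source))) :=
    (aemeasurable_volDensity g x₀).mono_measure (Measure.restrict_mono_set _ Set.inter_subset_left)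
  rw [setLIntegral_eq_zero_iff' hS.measurableSet hm] at h1
  refine hpos.ne' (measure_mono_null (fun y hy => ?_) h1)
  simp only [Set.mem_ofPred_eq, Set.mem_compl_iff]
  intro hcon
  have := hcon hy
  rw [ENNReal.ofReal_eq_zero] at this
  exact absurd (volDensity_pos g hy.1) (not_lt.2 this)

/-! ### Conformal changes on a manifold -/

theorem exists_finite_cover (n : ℕ) (M : Type*) [TopologicalSpace M]
    [ChartedSpace (EuclideanSpace ℝ (Fin n)) M] [CompactSpace M] :
    ∃ s : Finset M, ⋃ x : s, (extChartAt (𝓡 n) (x : M)).source = Set.univ := by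
  obtain ⟨s, hs⟩ := isCompact_univ.elim_finite_subcover
    (fun x : M => (extChartAt (𝓡 n) x).source) (fun x => isOpen_extChartAt_source x)
    (fun x _ => Set.mem_iUnion.2 ⟨x, mem_extChartAt_source x⟩)
  refine ⟨s, Set.eq_univ_of_forall fun x => ?_⟩
  obtain ⟨y, hy, hx⟩ := Set.mem_iUnion₂.1 (hs (Set.mem_univ x))
  exact Set.mem_iUnion.2 ⟨⟨y, hy⟩, hx⟩

/-- It is enough to compare the measures on the chart domains of a finite cover, where √det is
multiplied by e^{nu}. -/
theorem riemannianVolume_conformalMetric [CompactSpace M] (g : SmoothMetric n M) (u : M → ℝ)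
    (hu : ContMDiff (𝓡 n) 𝓘(ℝ, ℝ) ∞ u) :
    riemannianVolume (conformalMetric g u hu)
      = (riemannianVolume g).withDensity fun x => ENNReal.ofReal (Real.exp (n * u x)) := by
  obtain ⟨s, hs⟩ := exists_finite_cover n M
  refine (Measure.ext_iff_of_iUnion_eq_univ hs).2 fun x₀ => ?_
  have hm : Measurable fun x => ENNReal.ofReal (Real.exp (n * u x)) :=
    (Real.continuous_exp.comp (continuous_const.mul hu.continuous)).measurable.ennreal_ofReal
  rw [restrict_withDensity (measurableSet_chart_source _), riemannianVolume_restrict_source,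
    riemannianVolume_restrict_source]
  ext A hA
  rw [withDensity_apply _ hA, chartVolume_apply _ _ hA, ← lintegral_indicator hA]
  change _ = ∫⁻ a, _ ∂(Measure.map _ ((volume.restrict (extChartAt (𝓡 n) (x₀ : M)).target).withDensity
      fun y => ENNReal.ofReal (volDensity g x₀ y)))
  rw [lintegral_map' (hm.indicator hA).aemeasurable (aemeasurable_chart_symm_withDensity g x₀)]
  refine Eq.trans ?_ (lintegral_withDensity_eq_lintegral_mul₀ (aemeasurable_volDensity g x₀)
    ((hm.indicator hA).comp_aemeasurable (aemeasurable_chart_symm _))).symm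
  rw [← lintegral_indicator (measurableSet_chart_preimage _ hA),
    ← lintegral_indicator (measurableSet_chart_target _)]
  congr 1
  ext y
  by_cases hy : y ∈ (extChartAt (𝓡 n) (x₀ : M)).target
  · by_cases hyA : (extChartAt (𝓡 n) (x₀ : M)).symm y ∈ A
    · rw [Set.indicator_of_mem (show y ∈ _ ∩ _ from ⟨hy, hyA⟩), Set.indicator_of_mem hy,
        volDensity_conformalMetric, Pi.mul_apply, Function.comp_apply,
        Set.indicator_of_mem hyA, ENNReal.ofReal_mul (Real.exp_pos _).le, mul_comm]
    · rw [Set.indicator_of_notMem (fun h => hyA h.2), Set.indicator_of_mem hy, Pi.mul_apply,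
        Function.comp_apply, Set.indicator_of_notMem hyA, mul_zero]
  · rw [Set.indicator_of_notMem (fun h => hy h.1), Set.indicator_of_notMem hy]

theorem integral_conformalMetric [CompactSpace M] (g : SmoothMetric n M) (u : M → ℝ)
    (hu : ContMDiff (𝓡 n) 𝓘(ℝ, ℝ) ∞ u) (f : M → ℝ) :
    ∫ x, f x ∂(riemannianVolume (conformalMetric g u hu))
      = ∫ x, Real.exp (n * u x) * f x ∂(riemannianVolume g) := by
  rw [riemannianVolume_conformalMetric, integral_withDensity_eq_integral_toReal_smul₀ ?_ (by simp)]
  · simp only [smul_eq_mul]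
    congr 1
    ext x
    rw [ENNReal.toReal_ofReal (Real.exp_pos _).le]
  · exact (Real.continuous_exp.comp
      (continuous_const.mul hu.continuous)).measurable.ennreal_ofReal.aemeasurable

end Volume

/-! ### Pointwise expansions of the curvatures -/

section Pointwise

section Coordinates

variable {n : ℕ} {G : Eucl n → Matrix (Fin n) (Fin n) ℝ} {U : Set (Eucl n)}

theorem continuousAt_matrix {f : Eucl n → Matrix (Fin n) (Fin n) ℝ} {y : Eucl n}
    (h : ∀ i j, ContinuousAt (fun z => f z i j) y) : ContinuousAt f y :=
  continuousAt_pi.2 fun i => continuousAt_pi.2 fun j => h i j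

theorem continuousAt_trace {f : Eucl n → Matrix (Fin n) (Fin n) ℝ} {y : Eucl n}
    (h : ContinuousAt f y) : ContinuousAt (fun z => (f z).trace) y :=
  (continuous_id.matrix_trace.continuousAt (x := f y)).comp h

namespace MetricOn

theorem continuousAt_inv (h : MetricOn G U) {y : Eucl n} (hy : y ∈ U) :
    ContinuousAt (fun z => (G z)⁻¹) y :=
  continuousAt_matrix fun i j => (h.contDiffAt_inv hy i j).continuousAt

theorem continuousAt_ricciOp (h : MetricOn G U) {y : Eucl n} (hy : y ∈ U) :
    ContinuousAt (ricciOp G) y := by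
  refine (h.continuousAt_inv hy).mul (continuousAt_matrix fun i j => ?_)
  have hc (k i j : Fin n) : ContinuousAt (christoffel G k i j) y :=
    (h.contDiffAt_christoffel hy k i j).continuousAt
  have hd (l k i j : Fin n) : ContinuousAt (partialDeriv l (christoffel G k i j)) y :=
    (contDiffAt_partialDeriv (h.contDiffAt_christoffel hy k i j) l).continuousAt
  simp only [ricciCoord, Matrix.of_apply]
  exact (tendsto_finsetSum _ fun k _ => (hd _ _ _ _).sub (hd _ _ _ _)).add
    (tendsto_finsetSum _ fun k _ => tendsto_finsetSum _ fun l _ =>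
      ((hc _ _ _).mul (hc _ _ _)).sub ((hc _ _ _).mul (hc _ _ _)))

theorem continuousAt_schoutenOp (h : MetricOn G U) {y : Eucl n} (hy : y ∈ U) :
    ContinuousAt (schoutenOp G) y := by
  have hr := h.continuousAt_ricciOp hy
  refine ContinuousAt.congr (f := fun z => (1 / ((n : ℝ) - 2)) •
      (ricciOp G z - ((ricciOp G z).trace / (2 * ((n : ℝ) - 1))) • 1)) ?_ ?_
  · exact (hr.sub (((continuousAt_trace hr).div_const _).smul continuousAt_const)).const_smul
      (1 / ((n : ℝ) - 2))
  · filter_upwards [h.mem_nhds hy] with z hz using (h.schoutenOp_eq hz).symm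

theorem continuousAt_scalarCoord (h : MetricOn G U) {y : Eucl n} (hy : y ∈ U) :
    ContinuousAt (scalarCoord G) y := by
  refine (continuousAt_trace (h.continuousAt_ricciOp hy)).congr ?_
  filter_upwards [h.mem_nhds hy] with z hz using (h.scalarCoord_eq_trace hz).symm

theorem continuousAt_hessOp (h : MetricOn G U) {t : Eucl n → ℝ} {y : Eucl n} (hy : y ∈ U)
    (ht : ContDiffAt ℝ ∞ t y) : ContinuousAt (hessOp G t) y := by
  refine (h.continuousAt_inv hy).mul (continuousAt_matrix fun i j => ?_)
  have h1 : ContDiffAt ℝ ∞ (fderiv ℝ t) y := ht.fderiv_right (by simp)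
  have h2 : ContDiffAt ℝ ∞ (fderiv ℝ (fderiv ℝ t)) y := h1.fderiv_right (by simp)
  simp only [hessMatrix, Matrix.of_apply]
  exact (((h2.clm_apply contDiffAt_const).clm_apply contDiffAt_const).sub
    (h1.clm_apply (((h.contDiffAt_christoffelMap hy).clm_apply contDiffAt_const).clm_apply
      contDiffAt_const))).continuousAt

theorem continuousAt_diffSqOp (h : MetricOn G U) {t : Eucl n → ℝ} {y : Eucl n} (hy : y ∈ U)
    (ht : ContDiffAt ℝ ∞ t y) : ContinuousAt (diffSqOp G t) y := by
  refine (h.continuousAt_inv hy).mul (continuousAt_matrix fun i j => ?_)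
  exact ((contDiffAt_partialDeriv ht i).mul (contDiffAt_partialDeriv ht j)).continuousAt

theorem contDiffAt_gradSq (h : MetricOn G U) {t : Eucl n → ℝ} {y : Eucl n} (hy : y ∈ U)
    (ht : ContDiffAt ℝ ∞ t y) : ContDiffAt ℝ ∞ (gradSq G t) y := by
  have : gradSq G t = fun z => ∑ k, partialDeriv k t z * gradVec G t z k :=
    funext fun z => gradSq_eq G t z
  rw [this]
  exact ContDiffAt.sum fun k _ => (contDiffAt_partialDeriv ht k).mul
    ((EuclideanSpace.proj k : Eucl n →L[ℝ] ℝ).contDiff.contDiffAt.comp y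
      (h.contDiffAt_gradVec hy ht))

theorem gradSq_nonneg (h : MetricOn G U) (t : Eucl n → ℝ) {y : Eucl n} (hy : y ∈ U) :
    0 ≤ gradSq G t y := by
  rw [← fderiv_gradVec_eq_gradSq, ← h.metricForm_gradVec hy]
  by_cases h0 : gradVec G t y = 0
  · simp [h0]
  · exact (h.metricForm_pos hy h0).le

theorem gradSq_pos (h : MetricOn G U) {t : Eucl n → ℝ} {y : Eucl n} (hy : y ∈ U)
    (hd : fderiv ℝ t y ≠ 0) : 0 < gradSq G t y := by
  rw [← fderiv_gradVec_eq_gradSq, ← h.metricForm_gradVec hy]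
  refine h.metricForm_pos hy fun h0 => hd ?_
  ext w
  rw [← h.metricForm_gradVec hy, h0]
  simp

end MetricOn

theorem IsometryOn.gradSq_eq {φ : Eucl n → Eucl n} {G₀ G₁ : Eucl n → Matrix (Fin n) (Fin n) ℝ}
    {U₀ U₁ : Set (Eucl n)} (h : IsometryOn φ G₀ U₀ G₁ U₁) {t : Eucl n → ℝ} {y : Eucl n}
    (hy : y ∈ U₀) (ht : DifferentiableAt ℝ t (φ y)) :
    gradSq G₀ (t ∘ φ) y = gradSq G₁ t (φ y) := by
  have e : diffSqMatrix (t ∘ φ) y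
      = (jacobianMatrix φ y)ᵀ * diffSqMatrix t (φ y) * jacobianMatrix φ y := by
    have hd (i : Fin n) : partialDeriv i (t ∘ φ) y
        = ∑ a, jacobianMatrix φ y a i * partialDeriv a t (φ y) := by
      rw [partialDeriv, (ht.hasFDerivAt.comp y (h.hasFDerivAt hy)).fderiv,
        ContinuousLinearMap.comp_apply, ← sum_mul_eq_map]
      exact Finset.sum_congr rfl fun a _ => mul_comm _ _
    ext i j
    simp only [diffSqMatrix, Matrix.vecMulVec_apply, hd, Matrix.mul_apply, Matrix.transpose_apply,
      Finset.sum_mul, Finset.mul_sum]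
    refine Finset.sum_congr rfl fun a _ => Finset.sum_congr rfl fun b _ => ?_
    ring
  rw [gradSq, gradSq, diffSqOp, e, h.inv_mul_eq hy, h.trace_conj hy, diffSqOp]

theorem abs_linear_combination_le (c₀ c₁ c₂ c₃ c₄ c₅ a b : ℝ) :
    |c₀ + c₁ * a + c₂ * b + c₃ * a ^ 2 + c₄ * (a * b) + c₅ * a ^ 3| ≤
      (|c₀| + |c₁| + |c₂| + |c₃| + |c₄| + |c₅|) *
        (1 + |a| + |b| + |a| ^ 2 + |a| * |b| + |a| ^ 3) := by
  have h1 : |c₀ + c₁ * a + c₂ * b + c₃ * a ^ 2 + c₄ * (a * b) + c₅ * a ^ 3|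
      ≤ |c₀| + |c₁| * |a| + |c₂| * |b| + |c₃| * |a| ^ 2 + |c₄| * (|a| * |b|) + |c₅| * |a| ^ 3 := by
    refine (abs_add_le _ _).trans (add_le_add ((abs_add_le _ _).trans (add_le_add
      ((abs_add_le _ _).trans (add_le_add ((abs_add_le _ _).trans (add_le_add
        ((abs_add_le _ _).trans (add_le_add le_rfl ?_)) ?_)) ?_)) ?_)) ?_) <;>
    simp [abs_mul, abs_pow]
  have := abs_nonneg c₀
  have := abs_nonneg c₁
  have := abs_nonneg c₂
  have := abs_nonneg c₃
  have := abs_nonneg c₄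
  have := abs_nonneg c₅
  have ha := abs_nonneg a
  have hb := abs_nonneg b
  refine h1.trans ?_
  generalize |a| = a at *
  generalize |b| = b at *
  have hab : 0 ≤ a * b := mul_nonneg ha hb
  have ha2 : 0 ≤ a ^ 2 := by positivity
  have ha3 : 0 ≤ a ^ 3 := by positivity
  set E := 1 + a + b + a ^ 2 + a * b + a ^ 3
  have e0 : |c₀| ≤ |c₀| * E := le_mul_of_one_le_right (abs_nonneg _) (by linarith)
  have e1 : |c₁| * a ≤ |c₁| * E := mul_le_mul_of_nonneg_left (by linarith) (abs_nonneg _)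
  have e2 : |c₂| * b ≤ |c₂| * E := mul_le_mul_of_nonneg_left (by linarith) (abs_nonneg _)
  have e3 : |c₃| * a ^ 2 ≤ |c₃| * E := mul_le_mul_of_nonneg_left (by linarith) (abs_nonneg _)
  have e4 : |c₄| * (a * b) ≤ |c₄| * E := mul_le_mul_of_nonneg_left (by linarith) (abs_nonneg _)
  have e5 : |c₅| * a ^ 3 ≤ |c₅| * E := mul_le_mul_of_nonneg_left (by linarith) (abs_nonneg _)
  linarith

theorem _root_.ContinuousAt.exists_eventually_le {X : Type*} [TopologicalSpace X] {f : X → ℝ}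
    {x : X} (hf : ContinuousAt f x) : ∃ C, 0 ≤ C ∧ ∀ᶠ y in nhds x, f y ≤ C := by
  refine ⟨|f x| + 1, by positivity, ?_⟩
  filter_upwards [hf.eventually (gt_mem_nhds (lt_add_one _))] with y hy
  linarith [le_abs_self (f x)]

/-- A local bound, uniform in `F`, of the lower order terms of `σ₂` and of the scalar curvature of
`e^{2F(t)} G`. -/
theorem MetricOn.exists_lowerOrder_bound (hn : 5 ≤ n) (h : MetricOn G U) {t : Eucl n → ℝ}
    (ht : ∀ y ∈ U, ContDiffAt ℝ ∞ t y) {y₀ : Eucl n} (hy₀ : y₀ ∈ U) :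
    ∃ C, 0 ≤ C ∧ ∀ᶠ y in nhds y₀, ∀ F : ℝ → ℝ, ContDiff ℝ ∞ F →
      |Real.exp (4 * F (t y)) *
        sigmaTwoMatrix (schoutenOp (ConformalGeometry.conformalCoord G fun z => F (t z)) y)
        - ((n : ℝ) - 1) / 2 * gradSq G t y ^ 2 * (deriv F (t y) ^ 2 * deriv (deriv F) (t y)
          + ((n : ℝ) - 4) / 4 * deriv F (t y) ^ 4)|
      ≤ C * (1 + |deriv F (t y)| + |deriv (deriv F) (t y)| + |deriv F (t y)| ^ 2
        + |deriv F (t y)| * |deriv (deriv F) (t y)| + |deriv F (t y)| ^ 3) ∧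
      |Real.exp (2 * F (t y)) * scalarCoord (ConformalGeometry.conformalCoord G fun z => F (t z)) y
        + 2 * ((n : ℝ) - 1) * gradSq G t y * deriv (deriv F) (t y)
        + ((n : ℝ) - 1) * ((n : ℝ) - 2) * gradSq G t y * deriv F (t y) ^ 2|
      ≤ C * (1 + |deriv F (t y)|) := by
  have cS := h.continuousAt_schoutenOp hy₀
  have cH := h.continuousAt_hessOp hy₀ (ht _ hy₀)
  have cP := h.continuousAt_diffSqOp hy₀ (ht _ hy₀)
  have cτ : ContinuousAt (gradSq G t) y₀ := continuousAt_trace cP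
  have tS := continuousAt_trace cS
  have tH := continuousAt_trace cH
  have tSS := continuousAt_trace (cS.mul cS)
  have tSH := continuousAt_trace (cS.mul cH)
  have tSP := continuousAt_trace (cS.mul cP)
  have tHH := continuousAt_trace (cH.mul cH)
  have tPH := continuousAt_trace (cP.mul cH)
  -- `k0` to `k5` are the coefficients of 1, F', F'', F'², F'F'' and F'³ in the expansion of σ₂.
  -- They are continuous and do not involve `F`, hence locally bounded uniformly in `F`.
  have k0 := (((tS.pow 2).sub tSS).div_const 2).abs
  have k1 := (tSH.sub (tS.mul tH)).abs
  have k2 := (tSP.sub (tS.mul cτ)).abs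
  have k3 := (((((tH.pow 2).sub tHH).div_const 2).add
    (((continuousAt_const (y := (3 - (n : ℝ)) / 2)).mul tS).mul cτ)).sub tSP).abs
  have k4 := ((cτ.mul tH).sub tPH).abs
  have k5 := (tPH.add (((continuousAt_const (y := ((n : ℝ) - 3) / 2)).mul cτ).mul tH)).abs
  have kσ := ((((k0.add k1).add k2).add k3).add k4).add k5
  -- For the scalar curvature only R and -2(n-1) F' Δt remain beyond the main terms.
  have kR := (h.continuousAt_scalarCoord hy₀).abs.add
    ((continuousAt_const (y := 2 * ((n : ℝ) - 1))).mul tH).abs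
  obtain ⟨C₁, hC₁, ev1⟩ := kσ.exists_eventually_le
  obtain ⟨C₂, -, ev2⟩ := kR.exists_eventually_le
  refine ⟨max C₁ C₂, le_max_of_le_left hC₁, ?_⟩
  filter_upwards [ev1, ev2, h.mem_nhds hy₀] with y h1 h2 hy F hF
  refine ⟨?_, ?_⟩
  · rw [h.sigmaTwoMatrix_conformalCoord_comp hn hF ht hy _ _ rfl rfl, add_sub_cancel_left]
    refine (abs_linear_combination_le _ _ _ _ _ _ _ _).trans ?_
    refine mul_le_mul_of_nonneg_right (h1.trans (le_max_left _ _)) (by positivity)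
  · have hu : ∀ y ∈ U, ContDiffAt ℝ ∞ (fun z => F (t z)) y := fun y hy =>
      hF.contDiffAt.comp y (ht y hy)
    have e0 : Real.exp (2 * F (t y)) * Real.exp (-(2 * F (t y))) = 1 := by
      rw [← Real.exp_add]
      simp
    rw [h.scalarCoord_conformalCoord hu hy, hessOp_comp hF (ht y hy), gradSq_comp hF (ht y hy),
      ← mul_assoc, e0, one_mul, Matrix.trace_add, Matrix.trace_smul, Matrix.trace_smul, ← gradSq,
      smul_eq_mul, smul_eq_mul]
    have e1 : scalarCoord G y - 2 * ((n : ℝ) - 1) * (deriv (deriv F) (t y) * gradSq G t y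
          + deriv F (t y) * (hessOp G t y).trace)
        - ((n : ℝ) - 1) * ((n : ℝ) - 2) * (deriv F (t y) ^ 2 * gradSq G t y)
        + 2 * ((n : ℝ) - 1) * gradSq G t y * deriv (deriv F) (t y)
        + ((n : ℝ) - 1) * ((n : ℝ) - 2) * gradSq G t y * deriv F (t y) ^ 2
        = scalarCoord G y - (2 * ((n : ℝ) - 1) * (hessOp G t y).trace) * deriv F (t y) := by
      ring
    rw [e1]
    refine (abs_sub _ _).trans ?_
    rw [abs_mul]
    refine le_trans ?_ (mul_le_mul_of_nonneg_right (h2.trans (le_max_right _ _))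
      (by positivity))
    have a1 := abs_nonneg (scalarCoord G y)
    have a2 := abs_nonneg (2 * ((n : ℝ) - 1) * (hessOp G t y).trace)
    have a3 := abs_nonneg (deriv F (t y))
    have a4 := mul_nonneg a1 a3
    change |scalarCoord G y| + |2 * ((n : ℝ) - 1) * (hessOp G t y).trace| * |deriv F (t y)| ≤
      (|scalarCoord G y| + |2 * ((n : ℝ) - 1) * (hessOp G t y).trace|) * (1 + |deriv F (t y)|)
    linarith

end Coordinates

end Pointwise

/-! ### Expansions on a compact manifold -/

section Expansion

theorem gradSq_congr {n : ℕ} {G : Eucl n → Matrix (Fin n) (Fin n) ℝ} {t s : Eucl n → ℝ}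
    {y : Eucl n} (h : t =ᶠ[nhds y] s) : gradSq G t y = gradSq G s y := by
  simp only [gradSq, diffSqOp, diffSqMatrix, partialDeriv, h.fderiv_eq]

variable {n : ℕ} {M : Type*} [TopologicalSpace M] [ChartedSpace (EuclideanSpace ℝ (Fin n)) M]
  [IsManifold (𝓡 n) ∞ M]

/-- `|∇t|²`. -/
def gradNormSq (g : SmoothMetric n M) (t : M → ℝ) (x : M) : ℝ :=
  gradSq (gramInChart g x) (fun y => t ((extChartAt (𝓡 n) x).symm y)) (extChartAt (𝓡 n) x x)

theorem gradNormSq_eq (g : SmoothMetric n M) {t : M → ℝ} (ht : ContMDiff (𝓡 n) 𝓘(ℝ, ℝ) ∞ t)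
    {x x₀ : M} (hx : x ∈ (extChartAt (𝓡 n) x₀).source) :
    gradNormSq g t x = gradSq (gramInChart g x₀) (fun y => t ((extChartAt (𝓡 n) x₀).symm y))
      (extChartAt (𝓡 n) x₀ x) := by
  have hy := extChartAt_mem_chartOverlap (n := n) hx
  have hd := (contDiffAt_comp_symm ht ((extChartAt (𝓡 n) x₀).map_source hx)).differentiableAt
    (by simp)
  have := (isometryOn_chartChange g x x₀).gradSq_eq hy
    (t := fun y => t ((extChartAt (𝓡 n) x₀).symm y)) (by rwa [chartChange_extChartAt])
  rw [chartChange_extChartAt] at this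
  rw [← this, gradNormSq]
  refine gradSq_congr ?_
  filter_upwards [(isOpen_chartOverlap x x₀).mem_nhds hy] with z hz
  simp only [Function.comp, chartChange]
  rw [(extChartAt (𝓡 n) x₀).left_inv hz.2]

theorem gradNormSq_nonneg (g : SmoothMetric n M) (t : M → ℝ) (x : M) : 0 ≤ gradNormSq g t x :=
  (metricOn_gramInChart g x).gradSq_nonneg _ (mem_extChartAt_target x)

theorem continuous_of_forall_chart {f : M → ℝ} (h : ∀ x₀ : M, ∃ φ : Eucl n → ℝ,
    ContinuousAt φ (extChartAt (𝓡 n) x₀ x₀) ∧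
    ∀ x ∈ (extChartAt (𝓡 n) x₀).source, f x = φ (extChartAt (𝓡 n) x₀ x)) : Continuous f := by
  refine continuous_iff_continuousAt.2 fun x₀ => ?_
  obtain ⟨φ, hφ, hf⟩ := h x₀
  refine (hφ.comp (continuousAt_extChartAt (I := 𝓡 n) x₀)).congr ?_
  filter_upwards [extChartAt_source_mem_nhds (I := 𝓡 n) x₀] with x hx using (hf x hx).symm

theorem continuous_gradNormSq (g : SmoothMetric n M) {t : M → ℝ}
    (ht : ContMDiff (𝓡 n) 𝓘(ℝ, ℝ) ∞ t) : Continuous (gradNormSq g t) :=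
  continuous_of_forall_chart fun x₀ => ⟨_, ((metricOn_gramInChart g x₀).contDiffAt_gradSq
    (mem_extChartAt_target x₀) (contDiffAt_comp_symm ht (mem_extChartAt_target x₀))).continuousAt,
    fun _ hx => gradNormSq_eq g ht hx⟩

theorem continuous_scalarCurvature (g : SmoothMetric n M) : Continuous (scalarCurvature g) :=
  continuous_of_forall_chart fun x₀ => ⟨_, (metricOn_gramInChart g x₀).continuousAt_scalarCoord
    (mem_extChartAt_target x₀), fun _ hx => scalarCurvature_eq g hx⟩

theorem continuous_sigmaTwo (g : SmoothMetric n M) : Continuous (sigmaTwo g) := by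
  refine continuous_of_forall_chart fun x₀ => ⟨fun y =>
    sigmaTwoMatrix (schoutenOp (gramInChart g x₀) y), ?_, fun _ hx => sigmaTwo_eq g hx⟩
  have hS := (metricOn_gramInChart g x₀).continuousAt_schoutenOp (mem_extChartAt_target x₀)
  simp only [sigmaTwoMatrix_eq_trace]
  exact (((continuousAt_trace hS).pow 2).sub (continuousAt_trace (hS.mul hS))).div_const 2

/-- The metric `e^{2F(t)} g`. -/
def profileMetric (g : SmoothMetric n M) {t : M → ℝ} (ht : ContMDiff (𝓡 n) 𝓘(ℝ, ℝ) ∞ t)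
    {F : ℝ → ℝ} (hF : ContDiff ℝ ∞ F) : SmoothMetric n M :=
  conformalMetric g (fun x => F (t x)) (hF.contMDiff.comp ht)

/-- The size of the lower order terms of `σ₂`. -/
def lowerOrder (F : ℝ → ℝ) (s : ℝ) : ℝ :=
  1 + |deriv F s| + |deriv (deriv F) s| + |deriv F s| ^ 2 + |deriv F s| * |deriv (deriv F) s|
    + |deriv F s| ^ 3

theorem lowerOrder_nonneg (F : ℝ → ℝ) (s : ℝ) : 0 ≤ lowerOrder F s := by
  unfold lowerOrder
  positivity

/-- Compactness turns the local constants into a single one. It is chosen before `F`, so it stays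
fixed along the families of profiles used later. -/
theorem exists_expansion_bound (hn : 5 ≤ n) [CompactSpace M] (g : SmoothMetric n M) {t : M → ℝ}
    (ht : ContMDiff (𝓡 n) 𝓘(ℝ, ℝ) ∞ t) :
    ∃ C, 0 ≤ C ∧ ∀ (F : ℝ → ℝ) (hF : ContDiff ℝ ∞ F) (x : M),
      |Real.exp (4 * F (t x)) * sigmaTwo (profileMetric g ht hF) x
        - ((n : ℝ) - 1) / 2 * gradNormSq g t x ^ 2 * (deriv F (t x) ^ 2 * deriv (deriv F) (t x)
          + ((n : ℝ) - 4) / 4 * deriv F (t x) ^ 4)| ≤ C * lowerOrder F (t x) ∧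
      |Real.exp (2 * F (t x)) * scalarCurvature (profileMetric g ht hF) x
        + 2 * ((n : ℝ) - 1) * gradNormSq g t x * deriv (deriv F) (t x)
        + ((n : ℝ) - 1) * ((n : ℝ) - 2) * gradNormSq g t x * deriv F (t x) ^ 2|
      ≤ C * (1 + |deriv F (t x)|) := by
  let P (S : Set M) : Prop := ∃ C, 0 ≤ C ∧ ∀ (F : ℝ → ℝ) (hF : ContDiff ℝ ∞ F), ∀ x ∈ S,
      |Real.exp (4 * F (t x)) * sigmaTwo (profileMetric g ht hF) x
        - ((n : ℝ) - 1) / 2 * gradNormSq g t x ^ 2 * (deriv F (t x) ^ 2 * deriv (deriv F) (t x)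
          + ((n : ℝ) - 4) / 4 * deriv F (t x) ^ 4)| ≤ C * lowerOrder F (t x) ∧
      |Real.exp (2 * F (t x)) * scalarCurvature (profileMetric g ht hF) x
        + 2 * ((n : ℝ) - 1) * gradNormSq g t x * deriv (deriv F) (t x)
        + ((n : ℝ) - 1) * ((n : ℝ) - 2) * gradNormSq g t x * deriv F (t x) ^ 2|
      ≤ C * (1 + |deriv F (t x)|)
  suffices h : P Set.univ by
    obtain ⟨C, h0, h⟩ := h
    exact ⟨C, h0, fun F hF x => h F hF x (Set.mem_univ x)⟩
  refine isCompact_univ.induction_on (p := P) ⟨0, le_rfl, fun F hF x hx => hx.elim⟩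
    (fun S T hST ⟨C, h0, h⟩ => ⟨C, h0, fun F hF x hx => h F hF x (hST hx)⟩) ?_ fun x₀ _ => ?_
  · rintro S T ⟨C, hC, h⟩ ⟨D, hD, k⟩
    refine ⟨max C D, le_max_of_le_left hC, fun F hF x hx => ?_⟩
    have p1 := lowerOrder_nonneg F (t x)
    have p2 : 0 ≤ 1 + |deriv F (t x)| := by positivity
    rcases hx with hx | hx
    · exact ⟨(h F hF x hx).1.trans (mul_le_mul_of_nonneg_right (le_max_left _ _) p1),
        (h F hF x hx).2.trans (mul_le_mul_of_nonneg_right (le_max_left _ _) p2)⟩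
    · exact ⟨(k F hF x hx).1.trans (mul_le_mul_of_nonneg_right (le_max_right _ _) p1),
        (k F hF x hx).2.trans (mul_le_mul_of_nonneg_right (le_max_right _ _) p2)⟩
  · obtain ⟨C, hC, h⟩ := (metricOn_gramInChart g x₀).exists_lowerOrder_bound hn
      (t := fun y => t ((extChartAt (𝓡 n) x₀).symm y)) (fun y hy => contDiffAt_comp_symm ht hy)
      (mem_extChartAt_target x₀)
    refine ⟨_, mem_nhdsWithin_of_mem_nhds (Filter.inter_mem (extChartAt_source_mem_nhds (I := 𝓡 n) x₀)
      ((continuousAt_extChartAt (I := 𝓡 n) x₀).eventually h)), C, hC, fun F hF x hx => ?_⟩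
    have h1 := hx.2 F hF
    rw [sigmaTwo_eq _ hx.1, scalarCurvature_eq _ hx.1, gradNormSq_eq g ht hx.1]
    rw [(extChartAt (𝓡 n) x₀).left_inv hx.1] at h1
    exact h1

end Expansion

/-! ### Integration by parts on a compact manifold -/

section IntegrationByParts

variable {n : ℕ}

theorem integrable_of_continuousOn_of_support {f : Eucl n → ℝ} {K U : Set (Eucl n)}
    (hK : IsCompact K) (hKU : K ⊆ U) (hf : ContinuousOn f U) (h0 : ∀ y, y ∉ K → f y = 0) :
    Integrable f := by
  refine (integrableOn_iff_integrable_of_support_subset (s := K) fun y hy => ?_).1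
    ((hf.mono hKU).integrableOn_compact hK)
  by_contra h
  exact hy (h0 y h)

variable {M : Type*} [TopologicalSpace M] [ChartedSpace (EuclideanSpace ℝ (Fin n)) M]
  [IsManifold (𝓡 n) ∞ M]

/-- The components of the vector field `χ |∇t|^{2j} √(det g) ∇t` in a chart. -/
def chartField (g : SmoothMetric n M) (x₀ : M) (t χ : M → ℝ) (j : ℕ) (a : Fin n) : Eucl n → ℝ :=
  (extChartAt (𝓡 n) x₀).target.indicator fun y => χ ((extChartAt (𝓡 n) x₀).symm y) *
    gradSq (gramInChart g x₀) (fun z => t ((extChartAt (𝓡 n) x₀).symm z)) y ^ j *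
    volDensity g x₀ y *
    gradVec (gramInChart g x₀) (fun z => t ((extChartAt (𝓡 n) x₀).symm z)) y a

section

variable {g : SmoothMetric n M} {x₀ : M} {t χ : M → ℝ} (ht : ContMDiff (𝓡 n) 𝓘(ℝ, ℝ) ∞ t)
  (hχ : ContMDiff (𝓡 n) 𝓘(ℝ, ℝ) ∞ χ)

include ht hχ in
theorem contDiffAt_chartField_of_mem {y : Eucl n} (hy : y ∈ (extChartAt (𝓡 n) x₀).target)
    (j : ℕ) (a : Fin n) : ContDiffAt ℝ ∞ (chartField g x₀ t χ j a) y := by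
  have h := metricOn_gramInChart g x₀
  have ht' := contDiffAt_comp_symm ht hy
  have : ContDiffAt ℝ ∞ (fun y => χ ((extChartAt (𝓡 n) x₀).symm y) *
      gradSq (gramInChart g x₀) (fun z => t ((extChartAt (𝓡 n) x₀).symm z)) y ^ j *
      volDensity g x₀ y *
      gradVec (gramInChart g x₀) (fun z => t ((extChartAt (𝓡 n) x₀).symm z)) y a) y :=
    (((contDiffAt_comp_symm hχ hy).mul ((h.contDiffAt_gradSq hy ht').pow j)).mul
      ((contDiffOn_volDensity g x₀).contDiffAt (h.mem_nhds hy))).mul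
      ((EuclideanSpace.proj a : Eucl n →L[ℝ] ℝ).contDiff.contDiffAt.comp y
        (h.contDiffAt_gradVec hy ht'))
  refine this.congr_of_eventuallyEq ?_
  filter_upwards [h.mem_nhds hy] with z hz
  exact Set.indicator_of_mem hz _

/-- Thus the field, cut off by χ and set to zero off the chart, is smooth on all of ℝⁿ, and
integration by parts has no boundary term. -/
theorem chartField_eventuallyEq_zero {K : Set M} (hK : IsCompact K)
    (hKs : K ⊆ (extChartAt (𝓡 n) x₀).source) (hχK : ∀ x, x ∉ K → χ x = 0) {y : Eucl n}
    (hy : y ∉ extChartAt (𝓡 n) x₀ '' K) (j : ℕ) (a : Fin n) :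
    chartField g x₀ t χ j a =ᶠ[nhds y] fun _ => 0 := by
  have hc : IsClosed (extChartAt (𝓡 n) x₀ '' K) :=
    (hK.image_of_continuousOn ((continuousOn_extChartAt x₀).mono hKs)).isClosed
  filter_upwards [hc.isOpen_compl.mem_nhds hy] with z hz
  by_cases hzT : z ∈ (extChartAt (𝓡 n) x₀).target
  · have : (extChartAt (𝓡 n) x₀).symm z ∉ K := fun h =>
      hz ⟨_, h, (extChartAt (𝓡 n) x₀).right_inv hzT⟩
    rw [chartField, Set.indicator_of_mem hzT, hχK _ this]
    ring
  · exact Set.indicator_of_notMem hzT _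

end

variable [MeasurableSpace M] [BorelSpace M]

theorem integrableOn_chart_target (g : SmoothMetric n M) (x₀ : M) {f : M → ℝ}
    (hf : Integrable f (riemannianVolume g)) :
    IntegrableOn (fun y => f ((extChartAt (𝓡 n) x₀).symm y) * volDensity g x₀ y)
      (extChartAt (𝓡 n) x₀).target := by
  have h1 := hf.restrict (s := (extChartAt (𝓡 n) x₀).source)
  rw [riemannianVolume_restrict_source] at h1
  have h2 := (integrable_map_measure h1.aestronglyMeasurable
    (aemeasurable_chart_symm_withDensity g x₀)).1 h1
  have h3 := (integrable_withDensity_iff_integrable_smul₀' (aemeasurable_volDensity g x₀)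
    (by simp)).1 h2
  refine IntegrableOn.congr_fun h3 (fun y hy => ?_) (measurableSet_chart_target x₀)
  simp only [smul_eq_mul, Function.comp_apply]
  rw [ENNReal.toReal_ofReal (volDensity_pos g hy).le, mul_comm]

/-- Since Φ'(t)|∇t|² = d(Φ∘t)(∇t), the integral pairs d(Φ∘t) with the compactly supported field X =
χ|∇t|^{2j} √(det g) ∇t. Integration by parts moves the derivative to X, which does not depend on Φ.
-/
theorem exists_local_integral_bound [T2Space M] [CompactSpace M] (g : SmoothMetric n M) (x₀ : M)
    {t χ : M → ℝ}
    (ht : ContMDiff (𝓡 n) 𝓘(ℝ, ℝ) ∞ t) (hχ : ContMDiff (𝓡 n) 𝓘(ℝ, ℝ) ∞ χ)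
    (hs : tsupport χ ⊆ (extChartAt (𝓡 n) x₀).source) (j : ℕ) :
    ∃ C, 0 ≤ C ∧ ∀ Φ : ℝ → ℝ, ContDiff ℝ ∞ Φ →
      |∫ x, χ x * (deriv Φ (t x) * gradNormSq g t x ^ (j + 1)) ∂(riemannianVolume g)|
        ≤ C * ∫ x, |Φ (t x)| ∂(riemannianVolume g) := by
  have : IsFiniteMeasure (riemannianVolume g) := CompactSpace.isFiniteMeasure
  set T := (extChartAt (𝓡 n) x₀).target with hT
  set σ := (extChartAt (𝓡 n) x₀).symm with hσ
  set t' : Eucl n → ℝ := fun z => t (σ z) with ht'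
  set X := chartField g x₀ t χ j with hX
  set K := extChartAt (𝓡 n) x₀ '' tsupport χ with hK
  have hχc : IsCompact (tsupport χ) := (isClosed_tsupport χ).isCompact
  have hKc : IsCompact K := hχc.image_of_continuousOn ((continuousOn_extChartAt x₀).mono hs)
  have hKT : K ⊆ T := by
    rintro _ ⟨x, hx, rfl⟩
    exact (extChartAt (𝓡 n) x₀).map_source (hs hx)
  have hTo : IsOpen T := isOpen_extChartAt_target x₀
  have hG := metricOn_gramInChart g x₀
  have hχ0 : ∀ x, x ∉ tsupport χ → χ x = 0 := fun x hx => image_eq_zero_of_notMem_tsupport hx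
  have hX0 (a : Fin n) (y : Eucl n) (hy : y ∉ K) : X a =ᶠ[nhds y] fun _ => 0 :=
    chartField_eventuallyEq_zero hχc hs hχ0 hy j a
  have hXd (a : Fin n) (y : Eucl n) : ContDiffAt ℝ ∞ (X a) y := by
    by_cases hy : y ∈ T
    · exact contDiffAt_chartField_of_mem ht hχ hy j a
    · exact contDiffAt_const.congr_of_eventuallyEq (hX0 a y fun h => hy (hKT h))
  have hdX0 (a : Fin n) (y : Eucl n) (hy : y ∉ K) : fderiv ℝ (X a) y (stdVec a) = 0 := by
    rw [(hX0 a y hy).fderiv_eq]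
    simp
  have hdXc (a : Fin n) : Continuous fun y => fderiv ℝ (X a) y (stdVec a) :=
    continuous_iff_continuousAt.2 fun y => (contDiffAt_partialDeriv (hXd a y) a).continuousAt
  -- The constant bounds |div X| / √(det g) on K. The later `max C 0` covers an empty K, for which
  -- this bound may be negative.
  obtain ⟨C, hC⟩ := hKc.bddAbove_image (f := fun y =>
    |∑ a, fderiv ℝ (X a) y (stdVec a)| / volDensity g x₀ y) (by
      refine ContinuousOn.div (continuous_finsetSum _ fun a _ => hdXc a).abs.continuousOn
        ((contDiffOn_volDensity g x₀).continuousOn.mono hKT) fun y hy =>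
          (volDensity_pos g (hKT hy)).ne')
  have hC' : ∀ y ∈ T, |∑ a, fderiv ℝ (X a) y (stdVec a)| ≤ max C 0 * volDensity g x₀ y := by
    intro y hy
    by_cases hyK : y ∈ K
    · have := hC ⟨y, hyK, rfl⟩
      rw [div_le_iff₀ (volDensity_pos g hy)] at this
      exact this.trans (mul_le_mul_of_nonneg_right (le_max_left _ _) (volDensity_pos g hy).le)
    · rw [Finset.sum_eq_zero fun a _ => hdX0 a y hyK, abs_zero]
      exact mul_nonneg (le_max_right _ _) (volDensity_pos g hy).le
  refine ⟨max C 0, le_max_right _ _, fun Φ hΦ => ?_⟩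
  have hΦ' : Continuous (deriv Φ) := hΦ.continuous_deriv (by simp)
  have htd (y : Eucl n) (hy : y ∈ T) : ContDiffAt ℝ ∞ t' y := contDiffAt_comp_symm ht hy
  have hΦt (y : Eucl n) (hy : y ∈ T) : ContDiffAt ℝ ∞ (fun y => Φ (t' y)) y :=
    hΦ.contDiffAt.comp y (htd y hy)
  have hΦtd (y : Eucl n) (hy : y ∈ T) :
      fderiv ℝ (fun y => Φ (t' y)) y = deriv Φ (t' y) • fderiv ℝ t' y :=
    ((hΦ.differentiable (by simp)).differentiableAt.hasDerivAt.comp_hasFDerivAt y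
      ((htd y hy).differentiableAt (by simp)).hasFDerivAt).fderiv
  have hXz (a : Fin n) (y : Eucl n) (hy : y ∉ K) : X a y = 0 := (hX0 a y hy).self_of_nhds
  have i1 (a : Fin n) : Integrable fun y => X a y * fderiv ℝ (fun y => Φ (t' y)) y (stdVec a) :=
    integrable_of_continuousOn_of_support hKc hKT (fun y hy => ((hXd a y).continuousAt.mul
      (contDiffAt_partialDeriv (hΦt y hy) a).continuousAt).continuousWithinAt)
      fun y hy => by rw [hXz a y hy, zero_mul]
  have i2 (a : Fin n) : Integrable fun y => fderiv ℝ (X a) y (stdVec a) * Φ (t' y) :=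
    integrable_of_continuousOn_of_support hKc hKT (fun y hy => ((hdXc a).continuousAt.mul
      (hΦt y hy).continuousAt).continuousWithinAt)
      fun y hy => by rw [hdX0 a y hy, zero_mul]
  have i3 (a : Fin n) : Integrable fun y => X a y * Φ (t' y) :=
    integrable_of_continuousOn_of_support hKc hKT (fun y hy => ((hXd a y).continuousAt.mul
      (hΦt y hy).continuousAt).continuousWithinAt)
      fun y hy => by rw [hXz a y hy, zero_mul]
  have ibp (a : Fin n) : ∫ y, X a y * fderiv ℝ (fun y => Φ (t' y)) y (stdVec a)
      = - ∫ y, fderiv ℝ (X a) y (stdVec a) * Φ (t' y) := by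
    -- Φ∘t is smooth only on the chart target, but its differentiability is needed only on the
    -- support of `X a`, which lies in K.
    refine integral_mul_fderiv_eq_neg_fderiv_mul_of_integrable (i2 a) (i1 a) (i3 a)
      (fun y _ => (hXd a y).differentiableAt (by simp)) fun y hy => ?_
    refine (hΦt y (hKT ?_)).differentiableAt (by simp)
    by_contra h
    exact notMem_tsupport_iff_eventuallyEq.2 (hX0 a y h) hy
  have hcont : Continuous fun x => χ x * (deriv Φ (t x) * gradNormSq g t x ^ (j + 1)) :=
    hχ.continuous.mul ((hΦ'.comp ht.continuous).mul ((continuous_gradNormSq g ht).pow _))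
  have hcontΦ : Continuous fun x => |Φ (t x)| := (hΦ.continuous.comp ht.continuous).abs
  have hsupp : ∫ y in T, ∑ a, X a y * fderiv ℝ (fun y => Φ (t' y)) y (stdVec a)
      = ∫ y, ∑ a, X a y * fderiv ℝ (fun y => Φ (t' y)) y (stdVec a) := by
    refine setIntegral_eq_integral_of_forall_compl_eq_zero fun y hy =>
      Finset.sum_eq_zero fun a _ => ?_
    rw [hXz a y fun h => hy (hKT h), zero_mul]
  have step1 : ∫ x, χ x * (deriv Φ (t x) * gradNormSq g t x ^ (j + 1)) ∂(riemannianVolume g)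
      = ∫ y, ∑ a, X a y * fderiv ℝ (fun y => Φ (t' y)) y (stdVec a) := by
    rw [← setIntegral_eq_integral_of_forall_compl_eq_zero
      (s := (extChartAt (𝓡 n) x₀).source) (fun x hx => by
        rw [hχ0 x fun h => hx (hs h), zero_mul]),
      setIntegral_source_eq g x₀ hcont.aestronglyMeasurable, ← hsupp]
    refine setIntegral_congr_fun hTo.measurableSet fun y hy => ?_
    have hsrc : σ y ∈ (extChartAt (𝓡 n) x₀).source := (extChartAt (𝓡 n) x₀).map_target hy
    simp only [hΦtd y hy, smul_apply, smul_eq_mul, X, chartField]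
    rw [gradNormSq_eq g ht hsrc, (extChartAt (𝓡 n) x₀).right_inv hy]
    simp only [Set.indicator_of_mem hy]
    -- One of the j + 1 factors |∇t|² is written as a sum of ∂ₐt times the a-th component of ∇t; the
    -- other j belong to X.
    rw [pow_succ]
    nth_rewrite 2 [gradSq_eq]
    simp only [Finset.mul_sum, Finset.sum_mul]
    refine Finset.sum_congr rfl fun a _ => ?_
    simp only [partialDeriv]
    ring
  have step2 : ∫ y, ∑ a, X a y * fderiv ℝ (fun y => Φ (t' y)) y (stdVec a)
      = - ∫ y in T, (∑ a, fderiv ℝ (X a) y (stdVec a)) * Φ (t' y) := by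
    rw [setIntegral_eq_integral_of_forall_compl_eq_zero fun y hy => by
      rw [Finset.sum_eq_zero fun a _ => hdX0 a y fun h => hy (hKT h), zero_mul]]
    simp only [Finset.sum_mul]
    rw [integral_finsetSum _ fun a _ => i1 a, integral_finsetSum _ fun a _ => i2 a,
      ← Finset.sum_neg_distrib]
    exact Finset.sum_congr rfl fun a _ => ibp a
  have hint : Integrable (fun x => |Φ (t x)|) (riemannianVolume g) :=
    hcontΦ.integrable_of_hasCompactSupport (HasCompactSupport.of_compactSpace _)
  rw [step1, step2, abs_neg]
  refine (abs_integral_le_integral_abs).trans ?_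
  calc ∫ y in T, |(∑ a, fderiv ℝ (X a) y (stdVec a)) * Φ (t' y)|
      ≤ ∫ y in T, max C 0 * (|Φ (t' y)| * volDensity g x₀ y) := by
        refine integral_mono_of_nonneg (Filter.Eventually.of_forall fun y => abs_nonneg _)
          ((integrableOn_chart_target g x₀ hint).const_mul _)
          ((ae_restrict_iff' hTo.measurableSet).2 (Filter.Eventually.of_forall fun y hy => ?_))
        simp only [abs_mul]
        calc _ ≤ max C 0 * volDensity g x₀ y * |Φ (t' y)| :=
              mul_le_mul_of_nonneg_right (hC' y hy) (abs_nonneg _)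
          _ = _ := by ring
    _ = max C 0 * ∫ x in (extChartAt (𝓡 n) x₀).source, |Φ (t x)| ∂(riemannianVolume g) := by
        rw [integral_const_mul, setIntegral_source_eq g x₀ hcontΦ.aestronglyMeasurable]
    _ ≤ _ := mul_le_mul_of_nonneg_left
        (setIntegral_le_integral hint (Filter.Eventually.of_forall fun x => abs_nonneg _))
        (le_max_right _ _)

/-- The local bounds are summed over a finite partition of unity subordinate to chart domains. -/
theorem exists_integral_bound [T2Space M] [CompactSpace M] (g : SmoothMetric n M) {t : M → ℝ}
    (ht : ContMDiff (𝓡 n) 𝓘(ℝ, ℝ) ∞ t) (j : ℕ) :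
    ∃ C, 0 ≤ C ∧ ∀ Φ : ℝ → ℝ, ContDiff ℝ ∞ Φ →
      |∫ x, deriv Φ (t x) * gradNormSq g t x ^ (j + 1) ∂(riemannianVolume g)|
        ≤ C * ∫ x, |Φ (t x)| ∂(riemannianVolume g) := by
  have : IsFiniteMeasure (riemannianVolume g) := CompactSpace.isFiniteMeasure
  obtain ⟨s, hs⟩ := exists_finite_cover n M
  obtain ⟨ρ, hρ⟩ := SmoothPartitionOfUnity.exists_isSubordinate (𝓡 n) isClosed_univ
    (fun x : s => (extChartAt (𝓡 n) (x : M)).source) (fun x => isOpen_extChartAt_source _)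
    (by rw [hs])
  choose C hC0 hC using fun x : s =>
    exists_local_integral_bound g (x : M) ht (ρ x).contMDiff (hρ x) j
  refine ⟨∑ x, C x, Finset.sum_nonneg fun x _ => hC0 x, fun Φ hΦ => ?_⟩
  have hΦ' : Continuous (deriv Φ) := hΦ.continuous_deriv (by simp)
  have hsum (x : M) : ∑ i, ρ i x = 1 := by
    rw [← finsum_eq_sum_of_fintype]
    exact ρ.sum_eq_one (Set.mem_univ x)
  have hcont (i : s) : Continuous
      fun x => ρ i x * (deriv Φ (t x) * gradNormSq g t x ^ (j + 1)) :=
    (ρ i).contMDiff.continuous.mul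
      ((hΦ'.comp ht.continuous).mul ((continuous_gradNormSq g ht).pow _))
  have key : ∫ x, deriv Φ (t x) * gradNormSq g t x ^ (j + 1) ∂(riemannianVolume g)
      = ∑ i, ∫ x, ρ i x * (deriv Φ (t x) * gradNormSq g t x ^ (j + 1)) ∂(riemannianVolume g) := by
    rw [← integral_finsetSum _ fun i _ =>
      (hcont i).integrable_of_hasCompactSupport (HasCompactSupport.of_compactSpace _)]
    simp only [← Finset.sum_mul, hsum, one_mul]
  rw [key, Finset.sum_mul]
  exact (Finset.abs_sum_le_sum_abs _ _).trans (Finset.sum_le_sum fun i _ => hC i Φ hΦ)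

end IntegrationByParts

/-! ### Total curvatures of the metrics `e^{2F(t)} g` -/

section Totals

variable {n : ℕ} {M : Type*} [TopologicalSpace M] [ChartedSpace (EuclideanSpace ℝ (Fin n)) M]
  [IsManifold (𝓡 n) ∞ M] [MeasurableSpace M] [BorelSpace M] [CompactSpace M]

theorem integrable_of_continuous (g : SmoothMetric n M) {f : M → ℝ} (hf : Continuous f) :
    Integrable f (riemannianVolume g) :=
  hf.integrable_of_hasCompactSupport (HasCompactSupport.of_compactSpace _)

theorem totalVolume_profileMetric (g : SmoothMetric n M) {t : M → ℝ}
    (ht : ContMDiff (𝓡 n) 𝓘(ℝ, ℝ) ∞ t) {F : ℝ → ℝ} (hF : ContDiff ℝ ∞ F) :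
    totalVolume (profileMetric g ht hF) = ∫ x, Real.exp (n * F (t x)) ∂(riemannianVolume g) := by
  have h := integral_conformalMetric g (fun x => F (t x)) (hF.contMDiff.comp ht) (fun _ => 1)
  simp only [mul_one, integral_const, smul_eq_mul] at h
  exact h

theorem abs_integral_sub_le (g : SmoothMetric n M) {a b c : M → ℝ} (ha : Continuous a)
    (hb : Continuous b) (hc : Continuous c) (h : ∀ x, |a x - b x| ≤ c x) :
    |∫ x, a x ∂(riemannianVolume g) - ∫ x, b x ∂(riemannianVolume g)|
      ≤ ∫ x, c x ∂(riemannianVolume g) := by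
  rw [← integral_sub (integrable_of_continuous g ha) (integrable_of_continuous g hb)]
  exact (abs_integral_le_integral_abs).trans (integral_mono
    (integrable_of_continuous g (ha.sub hb).abs) (integrable_of_continuous g hc) h)

theorem continuous_lowerOrder {F : ℝ → ℝ} (hF : ContDiff ℝ ∞ F) : Continuous (lowerOrder F) := by
  have h1 : ContDiff ℝ ∞ (deriv F) := ((contDiff_succ_iff_deriv (n := ∞)).1 (by simpa using hF)).2.2
  have h2 : Continuous (deriv (deriv F)) := h1.continuous_deriv (by simp)
  have h1 := h1.continuous
  unfold lowerOrder
  fun_prop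

theorem hasDerivAt_exp_mul_pow {F : ℝ → ℝ} (hF : ContDiff ℝ ∞ F) (a : ℝ) (m : ℕ) (s : ℝ) :
    HasDerivAt (fun s => Real.exp (a * F s) * deriv F s ^ m)
      (Real.exp (a * F s) * (m * deriv F s ^ (m - 1) * deriv (deriv F) s
        + a * deriv F s ^ (m + 1))) s := by
  have h1 : ContDiff ℝ ∞ (deriv F) := ((contDiff_succ_iff_deriv (n := ∞)).1 (by simpa using hF)).2.2
  have d0 := (hF.differentiable (by simp) s).hasDerivAt
  have d1 := (h1.differentiable (by simp) s).hasDerivAt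
  refine (((d0.const_mul a).exp).mul (d1.pow m)).congr_deriv ?_
  simp only [Pi.pow_apply]
  ring

theorem contDiff_exp_mul_pow {F : ℝ → ℝ} (hF : ContDiff ℝ ∞ F) (a : ℝ) (m : ℕ) :
    ContDiff ℝ ∞ fun s => Real.exp (a * F s) * deriv F s ^ m := by
  have h1 : ContDiff ℝ ∞ (deriv F) := ((contDiff_succ_iff_deriv (n := ∞)).1 (by simpa using hF)).2.2
  exact ((contDiff_const.mul hF).exp).mul (h1.pow m)

/-- The term F'² F'' is traded for -(n-4)/3 F'⁴ modulo an exact derivative. The coefficient (n-4)/4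
- (n-4)/3 = -(n-4)/12 then makes the main term negative, although the pointwise expression has no
sign. -/
theorem exists_totalSigmaTwo_bound [T2Space M] (hn : 5 ≤ n) (g : SmoothMetric n M) {t : M → ℝ}
    (ht : ContMDiff (𝓡 n) 𝓘(ℝ, ℝ) ∞ t) :
    ∃ C, 0 ≤ C ∧ ∀ (F : ℝ → ℝ) (hF : ContDiff ℝ ∞ F),
      |totalSigmaTwo (profileMetric g ht hF) + ((n : ℝ) - 1) * ((n : ℝ) - 4) / 24 *
        ∫ x, Real.exp (((n : ℝ) - 4) * F (t x)) * deriv F (t x) ^ 4 * gradNormSq g t x ^ 2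
          ∂(riemannianVolume g)|
      ≤ C * ∫ x, Real.exp (((n : ℝ) - 4) * F (t x)) * lowerOrder F (t x)
          ∂(riemannianVolume g) := by
  obtain ⟨C₁, hC₁, h1⟩ := exists_expansion_bound hn g ht
  obtain ⟨C₂, hC₂, h2⟩ := exists_integral_bound g ht 1
  have hn1 : (0 : ℝ) ≤ (n : ℝ) - 1 := by
    have : (5 : ℝ) ≤ n := by exact_mod_cast hn
    linarith
  refine ⟨C₁ + ((n : ℝ) - 1) / 6 * C₂, by positivity, fun F hF => ?_⟩
  have hF1 : ContDiff ℝ ∞ (deriv F) :=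
    ((contDiff_succ_iff_deriv (n := ∞)).1 (by simpa using hF)).2.2
  have ct : Continuous t := ht.continuous
  have c2 : Continuous (deriv (deriv F)) := hF1.continuous_deriv (by simp)
  have c1 : Continuous (deriv F) := hF1.continuous
  have c0 : Continuous F := hF.continuous
  have cτ := continuous_gradNormSq g ht
  have cL : Continuous (lowerOrder F) := continuous_lowerOrder hF
  have cσ := continuous_sigmaTwo (profileMetric g ht hF)
  have e1 : totalSigmaTwo (profileMetric g ht hF)
      = ∫ x, Real.exp (n * F (t x)) * sigmaTwo (profileMetric g ht hF) x ∂(riemannianVolume g) :=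
    integral_conformalMetric g (fun x => F (t x)) (hF.contMDiff.comp ht) _
  have b1 := abs_integral_sub_le g
    (a := fun x => Real.exp (n * F (t x)) * sigmaTwo (profileMetric g ht hF) x)
    (b := fun x => Real.exp (((n : ℝ) - 4) * F (t x)) * (((n : ℝ) - 1) / 2 * gradNormSq g t x ^ 2 *
      (deriv F (t x) ^ 2 * deriv (deriv F) (t x) + ((n : ℝ) - 4) / 4 * deriv F (t x) ^ 4)))
    (c := fun x => C₁ * (Real.exp (((n : ℝ) - 4) * F (t x)) * lowerOrder F (t x)))
    (by fun_prop) (by fun_prop) (by fun_prop) (fun x => by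
      have e : Real.exp (n * F (t x))
          = Real.exp (((n : ℝ) - 4) * F (t x)) * Real.exp (4 * F (t x)) := by
        rw [← Real.exp_add]
        ring_nf
      rw [e, mul_assoc, ← mul_sub, abs_mul, Real.abs_exp]
      calc _ ≤ Real.exp (((n : ℝ) - 4) * F (t x)) * (C₁ * lowerOrder F (t x)) :=
            mul_le_mul_of_nonneg_left (h1 F hF x).1 (Real.exp_pos _).le
        _ = _ := by ring)
  -- Φ = e^{(n-4)F} F'³ is the primitive suited to e^{(n-4)F} F'² F''; its own size has weight 3, so
  -- it counts as lower order.
  have b2 := h2 _ (contDiff_exp_mul_pow hF ((n : ℝ) - 4) 3)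
  have hder : deriv (fun s => Real.exp (((n : ℝ) - 4) * F s) * deriv F s ^ 3) = _ :=
    funext fun s => (hasDerivAt_exp_mul_pow hF ((n : ℝ) - 4) 3 s).deriv
  rw [hder] at b2
  have b3 : ∫ x, |Real.exp (((n : ℝ) - 4) * F (t x)) * deriv F (t x) ^ 3| ∂(riemannianVolume g)
      ≤ ∫ x, Real.exp (((n : ℝ) - 4) * F (t x)) * lowerOrder F (t x) ∂(riemannianVolume g) := by
    refine integral_mono (integrable_of_continuous g (by fun_prop))
      (integrable_of_continuous g (by fun_prop)) fun x => ?_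
    simp only [abs_mul, Real.abs_exp, abs_pow]
    refine mul_le_mul_of_nonneg_left ?_ (Real.exp_pos _).le
    unfold lowerOrder
    have : 0 ≤ 1 + |deriv F (t x)| + |deriv (deriv F) (t x)| + |deriv F (t x)| ^ 2
      + |deriv F (t x)| * |deriv (deriv F) (t x)| := by positivity
    linarith
  have e2 : ∫ x, Real.exp (((n : ℝ) - 4) * F (t x)) * (((n : ℝ) - 1) / 2 * gradNormSq g t x ^ 2 *
      (deriv F (t x) ^ 2 * deriv (deriv F) (t x) + ((n : ℝ) - 4) / 4 * deriv F (t x) ^ 4))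
        ∂(riemannianVolume g)
      = ((n : ℝ) - 1) / 6 * (∫ x, Real.exp (((n : ℝ) - 4) * F (t x)) *
          (((3 : ℕ) : ℝ) * deriv F (t x) ^ (3 - 1) * deriv (deriv F) (t x)
            + ((n : ℝ) - 4) * deriv F (t x) ^ (3 + 1)) * gradNormSq g t x ^ (1 + 1)
              ∂(riemannianVolume g))
        - ((n : ℝ) - 1) * ((n : ℝ) - 4) / 24 * ∫ x, Real.exp (((n : ℝ) - 4) * F (t x)) *
            deriv F (t x) ^ 4 * gradNormSq g t x ^ 2 ∂(riemannianVolume g) := by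
    rw [← integral_const_mul, ← integral_const_mul, ← integral_sub
      (integrable_of_continuous g (by fun_prop)) (integrable_of_continuous g (by fun_prop))]
    congr 1
    ext x
    norm_num
    ring
  rw [e2, integral_const_mul, ← e1] at b1
  have b4 := mul_le_mul_of_nonneg_left (b2.trans (mul_le_mul_of_nonneg_left b3 hC₂))
    (show 0 ≤ ((n : ℝ) - 1) / 6 by positivity)
  rw [← abs_of_nonneg (show 0 ≤ ((n : ℝ) - 1) / 6 by positivity), ← abs_mul,
    abs_of_nonneg (show 0 ≤ ((n : ℝ) - 1) / 6 by positivity)] at b4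
  refine le_trans ?_ ((add_le_add b1 b4).trans (le_of_eq (by ring)))
  refine le_trans (le_of_eq ?_) (abs_add_le _ _)
  congr 1
  ring

/-- The same argument with Φ = e^{(n-2)F} F': removing F'' changes the coefficient of F'² from
-(n-1)(n-2) to +(n-1)(n-2). -/
theorem exists_totalScalar_bound [T2Space M] (hn : 5 ≤ n) (g : SmoothMetric n M) {t : M → ℝ}
    (ht : ContMDiff (𝓡 n) 𝓘(ℝ, ℝ) ∞ t) :
    ∃ C, 0 ≤ C ∧ ∀ (F : ℝ → ℝ) (hF : ContDiff ℝ ∞ F),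
      |totalScalar (profileMetric g ht hF) - ((n : ℝ) - 1) * ((n : ℝ) - 2) *
        ∫ x, Real.exp (((n : ℝ) - 2) * F (t x)) * deriv F (t x) ^ 2 * gradNormSq g t x
          ∂(riemannianVolume g)|
      ≤ C * ∫ x, Real.exp (((n : ℝ) - 2) * F (t x)) * (1 + |deriv F (t x)|)
          ∂(riemannianVolume g) := by
  obtain ⟨C₁, hC₁, h1⟩ := exists_expansion_bound hn g ht
  obtain ⟨C₂, hC₂, h2⟩ := exists_integral_bound g ht 0
  have hn1 : (0 : ℝ) ≤ (n : ℝ) - 1 := by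
    have : (5 : ℝ) ≤ n := by exact_mod_cast hn
    linarith
  refine ⟨C₁ + 2 * ((n : ℝ) - 1) * C₂, by positivity, fun F hF => ?_⟩
  have hF1 : ContDiff ℝ ∞ (deriv F) :=
    ((contDiff_succ_iff_deriv (n := ∞)).1 (by simpa using hF)).2.2
  have ct : Continuous t := ht.continuous
  have c2 : Continuous (deriv (deriv F)) := hF1.continuous_deriv (by simp)
  have c1 : Continuous (deriv F) := hF1.continuous
  have c0 : Continuous F := hF.continuous
  have cτ := continuous_gradNormSq g ht
  have cσ := continuous_scalarCurvature (profileMetric g ht hF)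
  have e1 : totalScalar (profileMetric g ht hF) = ∫ x, Real.exp (n * F (t x)) *
      scalarCurvature (profileMetric g ht hF) x ∂(riemannianVolume g) :=
    integral_conformalMetric g (fun x => F (t x)) (hF.contMDiff.comp ht) _
  have b1 := abs_integral_sub_le g
    (a := fun x => Real.exp (n * F (t x)) * scalarCurvature (profileMetric g ht hF) x)
    (b := fun x => Real.exp (((n : ℝ) - 2) * F (t x)) *
      (-(2 * ((n : ℝ) - 1) * gradNormSq g t x * deriv (deriv F) (t x))
        - ((n : ℝ) - 1) * ((n : ℝ) - 2) * gradNormSq g t x * deriv F (t x) ^ 2))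
    (c := fun x => C₁ * (Real.exp (((n : ℝ) - 2) * F (t x)) * (1 + |deriv F (t x)|)))
    (by fun_prop) (by fun_prop) (by fun_prop) (fun x => by
      have e : Real.exp (n * F (t x))
          = Real.exp (((n : ℝ) - 2) * F (t x)) * Real.exp (2 * F (t x)) := by
        rw [← Real.exp_add]
        ring_nf
      rw [e, mul_assoc, ← mul_sub, abs_mul, Real.abs_exp, sub_sub_eq_add_sub, sub_neg_eq_add,
        add_right_comm]
      calc _ ≤ Real.exp (((n : ℝ) - 2) * F (t x)) * (C₁ * (1 + |deriv F (t x)|)) :=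
            mul_le_mul_of_nonneg_left (h1 F hF x).2
              (Real.exp_pos _).le
        _ = _ := by ring)
  have b2 := h2 _ (contDiff_exp_mul_pow hF ((n : ℝ) - 2) 1)
  have hder : deriv (fun s => Real.exp (((n : ℝ) - 2) * F s) * deriv F s ^ 1) = _ :=
    funext fun s => (hasDerivAt_exp_mul_pow hF ((n : ℝ) - 2) 1 s).deriv
  rw [hder] at b2
  have b3 : ∫ x, |Real.exp (((n : ℝ) - 2) * F (t x)) * deriv F (t x) ^ 1| ∂(riemannianVolume g)
      ≤ ∫ x, Real.exp (((n : ℝ) - 2) * F (t x)) * (1 + |deriv F (t x)|) ∂(riemannianVolume g) := by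
    refine integral_mono (integrable_of_continuous g (by fun_prop))
      (integrable_of_continuous g (by fun_prop)) fun x => ?_
    simp only [abs_mul, Real.abs_exp, pow_one]
    exact mul_le_mul_of_nonneg_left (by linarith) (Real.exp_pos _).le
  have e2 : ∫ x, Real.exp (((n : ℝ) - 2) * F (t x)) *
      (-(2 * ((n : ℝ) - 1) * gradNormSq g t x * deriv (deriv F) (t x))
        - ((n : ℝ) - 1) * ((n : ℝ) - 2) * gradNormSq g t x * deriv F (t x) ^ 2)
        ∂(riemannianVolume g)
      = ((n : ℝ) - 1) * ((n : ℝ) - 2) * (∫ x, Real.exp (((n : ℝ) - 2) * F (t x)) *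
            deriv F (t x) ^ 2 * gradNormSq g t x ∂(riemannianVolume g))
        - 2 * ((n : ℝ) - 1) * (∫ x, Real.exp (((n : ℝ) - 2) * F (t x)) *
          (((1 : ℕ) : ℝ) * deriv F (t x) ^ (1 - 1) * deriv (deriv F) (t x)
            + ((n : ℝ) - 2) * deriv F (t x) ^ (1 + 1)) * gradNormSq g t x ^ (0 + 1)
              ∂(riemannianVolume g)) := by
    rw [← integral_const_mul, ← integral_const_mul, ← integral_sub
      (integrable_of_continuous g (by fun_prop)) (integrable_of_continuous g (by fun_prop))]
    congr 1
    ext x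
    norm_num
    ring
  rw [e2, integral_const_mul, ← e1] at b1
  have b4 := mul_le_mul_of_nonneg_left (b2.trans (mul_le_mul_of_nonneg_left b3 hC₂))
    (show 0 ≤ 2 * ((n : ℝ) - 1) by positivity)
  rw [← abs_of_nonneg (show 0 ≤ 2 * ((n : ℝ) - 1) by positivity), ← abs_mul,
    abs_of_nonneg (show 0 ≤ 2 * ((n : ℝ) - 1) by positivity), ← abs_neg] at b4
  refine le_trans ?_ ((add_le_add b1 b4).trans (le_of_eq (by ring)))
  refine le_trans (le_of_eq ?_) (abs_add_le _ _)
  congr 1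
  ring

end Totals

/-! ### The infima over a conformal class -/

section ConformalInfimum

/-- For exponents in [0, 1] and D ≥ 1 one has B^p ≤ D. This crude bound is enough, so the exact
exponents of the quotients never enter. -/
theorem div_rpow_le_neg_div {A B D a p : ℝ} (ha : 0 ≤ a) (hA : A ≤ -a) (hB : 0 < B) (hBD : B ≤ D)
    (hD : 1 ≤ D) (hp0 : 0 ≤ p) (hp1 : p ≤ 1) : A / B ^ p ≤ -(a / D) := by
  have h1 : B ^ p ≤ D := by
    calc B ^ p ≤ D ^ p := Real.rpow_le_rpow hB.le hBD hp0
      _ ≤ D ^ (1 : ℝ) := Real.rpow_le_rpow_of_exponent_le hD hp1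
      _ = D := Real.rpow_one D
  have h2 : 0 < B ^ p := Real.rpow_pos_of_pos hB p
  calc A / B ^ p ≤ -a / B ^ p := div_le_div_of_nonneg_right hA h2.le
    _ = -(a / B ^ p) := neg_div _ _
    _ ≤ -(a / D) := neg_le_neg (div_le_div_of_nonneg_left ha h2 h1)

theorem biInf_coe_eq_bot {α : Type*} {S : Set α} {q : α → ℝ} (h : ∀ K : ℝ, ∃ g ∈ S, q g < K) :
    (⨅ g ∈ S, (q g : EReal)) = ⊥ := by
  refine EReal.eq_bot_iff_forall_lt _ |>.2 fun K => ?_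
  obtain ⟨g, hg, hK⟩ := h K
  exact (biInf_le _ hg).trans_lt (EReal.coe_lt_coe_iff.2 hK)

theorem exponent_mem {n : ℕ} (hn : 5 ≤ n) :
    0 ≤ ((n : ℝ) - 4) / n ∧ ((n : ℝ) - 4) / n ≤ 1 ∧
    0 ≤ ((n : ℝ) - 4) / ((n : ℝ) - 2) ∧ ((n : ℝ) - 4) / ((n : ℝ) - 2) ≤ 1 := by
  have h : (5 : ℝ) ≤ n := by exact_mod_cast hn
  refine ⟨div_nonneg (by linarith) (by linarith), (div_le_one (by linarith)).2 (by linarith),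
    div_nonneg (by linarith) (by linarith), (div_le_one (by linarith)).2 (by linarith)⟩

variable {n : ℕ} {M : Type*} [TopologicalSpace M] [ChartedSpace (EuclideanSpace ℝ (Fin n)) M]
  [IsManifold (𝓡 n) ∞ M]

/-- A coordinate function multiplied by a bump function that is 1 near `x₀`. -/
theorem exists_contMDiff_gradNormSq_pos [T2Space M] (hn : 0 < n) (g : SmoothMetric n M) (x₀ : M) :
    ∃ t : M → ℝ, ContMDiff (𝓡 n) 𝓘(ℝ, ℝ) ∞ t ∧ 0 < gradNormSq g t x₀ := by
  let f : SmoothBumpFunction (𝓡 n) x₀ := Classical.arbitrary _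
  let p : Eucl n →L[ℝ] ℝ := EuclideanSpace.proj (⟨0, hn⟩ : Fin n)
  have ht : ContMDiff (𝓡 n) 𝓘(ℝ, ℝ) ∞ fun x => f x • p (extChartAt (𝓡 n) x₀ x) := by
    refine f.contMDiff_smul ?_
    exact p.contDiff.contMDiff.comp_contMDiffOn contMDiffOn_extChartAt
  refine ⟨_, ht, ?_⟩
  rw [gradNormSq_eq g ht (mem_extChartAt_source x₀)]
  have hT := mem_extChartAt_target (I := 𝓡 n) x₀
  refine (metricOn_gramInChart g x₀).gradSq_pos hT ?_
  have he : (fun y => f ((extChartAt (𝓡 n) x₀).symm y) •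
      p (extChartAt (𝓡 n) x₀ ((extChartAt (𝓡 n) x₀).symm y)))
      =ᶠ[nhds (extChartAt (𝓡 n) x₀ x₀)] p := by
    have h1 := (continuousAt_extChartAt_symm (I := 𝓡 n) x₀).eventually
      (by rw [extChartAt_to_inv]; exact f.eventuallyEq_one)
    filter_upwards [h1, (isOpen_extChartAt_target (I := 𝓡 n) x₀).mem_nhds hT] with y hy hyT
    rw [(extChartAt (𝓡 n) x₀).right_inv hyT, hy]
    simp
  rw [he.fderiv_eq, p.fderiv]
  intro h0
  have := congrArg (fun q : Eucl n →L[ℝ] ℝ => q (stdVec ⟨0, hn⟩)) h0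
  simp [p, stdVec] at this

variable [MeasurableSpace M] [BorelSpace M] [CompactSpace M]

theorem volume_pos_and_integrable [Nonempty M] (g : SmoothMetric n M) :
    0 < riemannianVolume g Set.univ ∧ riemannianVolume g Set.univ < ⊤ ∧
      Integrable (sigmaTwo g) (riemannianVolume g) ∧
      Integrable (scalarCurvature g) (riemannianVolume g) := by
  have : IsFiniteMeasure (riemannianVolume g) := CompactSpace.isFiniteMeasure
  exact ⟨isOpen_univ.measure_pos _ Set.univ_nonempty, measure_lt_top _ _,
    integrable_of_continuous g (continuous_sigmaTwo g),
    integrable_of_continuous g (continuous_scalarCurvature g)⟩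

theorem totalVolume_pos [Nonempty M] (g : SmoothMetric n M) : 0 < totalVolume g :=
  ENNReal.toReal_pos (volume_pos_and_integrable g).1.ne' (volume_pos_and_integrable g).2.1.ne

theorem integral_le_const_mul (g : SmoothMetric n M) {f : M → ℝ} (hf : Continuous f) {c : ℝ}
    (h : ∀ x, f x ≤ c) : ∫ x, f x ∂(riemannianVolume g) ≤ c * totalVolume g := by
  have := integral_mono (integrable_of_continuous g hf)
    (integrable_of_continuous g (continuous_const (y := c))) h
  rwa [integral_const, smul_eq_mul, mul_comm] at this

/-- Oscillating conformal factors. -/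
theorem exists_profile [T2Space M] (g : SmoothMetric n M) {t : M → ℝ}
    (ht : ContMDiff (𝓡 n) 𝓘(ℝ, ℝ) ∞ t) {lam : ℝ} (hlam : 1 ≤ lam) :
    ∃ F : ℝ → ℝ, ContDiff ℝ ∞ F ∧ (∀ s, |F s| ≤ 1) ∧ (∀ s, |deriv F s| ≤ lam) ∧
      (∀ s, |deriv (deriv F) s| ≤ lam ^ 2) ∧
      lam ^ 4 / 4 * (∫ x, gradNormSq g t x ^ 2 ∂(riemannianVolume g))
        ≤ ∫ x, deriv F (t x) ^ 4 * gradNormSq g t x ^ 2 ∂(riemannianVolume g) := by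
  have h0 : 0 ≤ lam := by linarith
  have ds : deriv (fun s => Real.sin (lam * s)) = fun s => lam * Real.cos (lam * s) := by
    ext s
    have := ((hasDerivAt_id s).const_mul lam).sin.deriv
    simp only [id, mul_one] at this
    rw [this, mul_comm]
  have dc : deriv (fun s => Real.cos (lam * s)) = fun s => -lam * Real.sin (lam * s) := by
    ext s
    have := ((hasDerivAt_id s).const_mul lam).cos.deriv
    simp only [id, mul_one] at this
    rw [this]
    ring
  have dds : deriv (fun s => lam * Real.cos (lam * s)) = fun s => -lam ^ 2 * Real.sin (lam * s) := by
    ext s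
    rw [deriv_const_mul_field, dc]
    ring
  have ddc : deriv (fun s => -lam * Real.sin (lam * s))
      = fun s => -lam ^ 2 * Real.cos (lam * s) := by
    ext s
    rw [deriv_const_mul_field, ds]
    ring
  have ct : Continuous t := ht.continuous
  have cτ := continuous_gradNormSq g ht
  -- As sin⁴ + cos⁴ ≥ 1/2, the integrals for the sine and the cosine profile add up to at least this
  -- much, so one of them reaches half of it. This avoids any equidistribution argument.
  have key : lam ^ 4 / 2 * (∫ x, gradNormSq g t x ^ 2 ∂(riemannianVolume g))
      ≤ (∫ x, (lam * Real.cos (lam * t x)) ^ 4 * gradNormSq g t x ^ 2 ∂(riemannianVolume g))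
        + ∫ x, (-lam * Real.sin (lam * t x)) ^ 4 * gradNormSq g t x ^ 2 ∂(riemannianVolume g) := by
    rw [← integral_add (integrable_of_continuous g (by fun_prop))
      (integrable_of_continuous g (by fun_prop)), ← integral_const_mul]
    refine integral_mono (integrable_of_continuous g (by fun_prop))
      (integrable_of_continuous g (by fun_prop)) fun x => ?_
    have h1 := Real.sin_sq_add_cos_sq (lam * t x)
    set a := Real.sin (lam * t x)
    set b := Real.cos (lam * t x)
    have h2 : 1 / 2 ≤ a ^ 4 + b ^ 4 := by nlinarith [sq_nonneg (a ^ 2 - b ^ 2)]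
    have h3 : 0 ≤ lam ^ 4 * gradNormSq g t x ^ 2 := by positivity
    calc lam ^ 4 / 2 * gradNormSq g t x ^ 2 = 1 / 2 * (lam ^ 4 * gradNormSq g t x ^ 2) := by ring
      _ ≤ (a ^ 4 + b ^ 4) * (lam ^ 4 * gradNormSq g t x ^ 2) := mul_le_mul_of_nonneg_right h2 h3
      _ = _ := by ring
  by_cases hcase : lam ^ 4 / 4 * (∫ x, gradNormSq g t x ^ 2 ∂(riemannianVolume g))
      ≤ ∫ x, (lam * Real.cos (lam * t x)) ^ 4 * gradNormSq g t x ^ 2 ∂(riemannianVolume g)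
  · refine ⟨fun s => Real.sin (lam * s), by fun_prop, fun s => Real.abs_sin_le_one _, fun s => ?_,
      fun s => ?_, ?_⟩
    · rw [ds, abs_mul, abs_of_nonneg h0]
      exact mul_le_of_le_one_right h0 (Real.abs_cos_le_one _)
    · rw [ds, dds, abs_mul, abs_neg, abs_of_nonneg (sq_nonneg lam)]
      exact mul_le_of_le_one_right (sq_nonneg lam) (Real.abs_sin_le_one _)
    · simpa only [ds] using hcase
  · refine ⟨fun s => Real.cos (lam * s), by fun_prop, fun s => Real.abs_cos_le_one _, fun s => ?_,
      fun s => ?_, ?_⟩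
    · rw [dc, abs_mul, abs_neg, abs_of_nonneg h0]
      exact mul_le_of_le_one_right h0 (Real.abs_sin_le_one _)
    · rw [dc, ddc, abs_mul, abs_neg, abs_of_nonneg (sq_nonneg lam)]
      exact mul_le_of_le_one_right (sq_nonneg lam) (Real.abs_cos_le_one _)
    · simp only [dc]
      linarith

-- Since |F| ≤ 1, all exponential weights lie between positive constants. Only powers of λ matter:
-- λ⁴ against λ³ for σ₂, and λ² against λ for the scalar curvature.
set_option maxHeartbeats 1000000 in
theorem exists_oscillating_family [T2Space M] [Nonempty M] (hn : 5 ≤ n) (g : SmoothMetric n M) :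
    ∃ c C : ℝ, 0 < c ∧ 1 ≤ C ∧ ∀ lam : ℝ, 1 ≤ lam → ∃ h ∈ conformalClass g,
      totalSigmaTwo h ≤ -(c * lam ^ 4) + C * lam ^ 3 ∧ totalVolume h ≤ C ∧
      c * lam ^ 2 - C * lam ≤ totalScalar h ∧ totalScalar h ≤ C * lam ^ 2 := by
  have hn5 : (5 : ℝ) ≤ n := by exact_mod_cast hn
  obtain ⟨t, ht, hpos⟩ := exists_contMDiff_gradNormSq_pos (by omega) g (Classical.arbitrary M)
  have ct : Continuous t := ht.continuous
  have cτ := continuous_gradNormSq g ht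
  obtain ⟨V, hV⟩ : ∃ V, V = totalVolume g := ⟨_, rfl⟩
  have hV0 : 0 < V := hV ▸ totalVolume_pos g
  have hle {f : M → ℝ} (hf : Continuous f) {c : ℝ} (h : ∀ x, f x ≤ c) :
      ∫ x, f x ∂(riemannianVolume g) ≤ c * V := hV ▸ integral_le_const_mul g hf h
  obtain ⟨S, hS⟩ : ∃ S, S = ∫ x, gradNormSq g t x ^ 2 ∂(riemannianVolume g) := ⟨_, rfl⟩
  have hS0 : 0 < S := by
    rw [hS]
    refine (cτ.pow 2).integral_pos_of_hasCompactSupport_nonneg_nonzero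
      (HasCompactSupport.of_compactSpace _) (fun x => sq_nonneg _) (x := Classical.arbitrary M) ?_
    simpa using hpos.ne'
  obtain ⟨T, hT⟩ := isCompact_univ.bddAbove_image cτ.continuousOn
  have hT' (x : M) : gradNormSq g t x ≤ T := hT ⟨x, Set.mem_univ x, rfl⟩
  have hT0 : 0 < T := hpos.trans_le (hT' _)
  obtain ⟨C₁, hC₁, h1⟩ := exists_totalSigmaTwo_bound hn g ht
  obtain ⟨C₂, hC₂, h2⟩ := exists_totalScalar_bound hn g ht
  obtain ⟨k, hk⟩ : ∃ k, k = (n : ℝ) - 4 := ⟨_, rfl⟩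
  obtain ⟨m, hm⟩ : ∃ m, m = (n : ℝ) - 2 := ⟨_, rfl⟩
  simp only [← hk] at h1
  simp only [← hm] at h2
  have hk0 : 0 < k := by linarith
  have hm0 : 0 < m := by linarith
  have hn1 : 0 < (n : ℝ) - 1 := by linarith
  have hexp {a s : ℝ} (ha : 0 ≤ a) (hs : |s| ≤ 1) :
      Real.exp (-a) ≤ Real.exp (a * s) ∧ Real.exp (a * s) ≤ Real.exp a := by
    have := abs_le.1 hs
    constructor <;> refine Real.exp_le_exp.2 ?_ <;> nlinarith
  -- `c₁` and `c₂` are the coefficients of λ⁴ and λ² in the lower bounds `i1` and `i3` of the main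
  -- terms, `D₁`, `D₂` those of the errors, and `D₃` that of the upper bound of the scalar main
  -- term.
  obtain ⟨c₁, hc₁⟩ : ∃ x, x = ((n : ℝ) - 1) * k / 24 * (Real.exp (-k) * (S / 4)) := ⟨_, rfl⟩
  obtain ⟨c₂, hc₂⟩ : ∃ x, x = ((n : ℝ) - 1) * m * (Real.exp (-m) * (S / (4 * T))) := ⟨_, rfl⟩
  have hc₁0 : 0 < c₁ := by rw [hc₁]; positivity
  have hc₂0 : 0 < c₂ := by rw [hc₂]; positivity
  obtain ⟨D₁, hD₁⟩ : ∃ x, x = C₁ * (Real.exp k * 6 * V) := ⟨_, rfl⟩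
  obtain ⟨D₂, hD₂⟩ : ∃ x, x = C₂ * (Real.exp m * 2 * V) := ⟨_, rfl⟩
  obtain ⟨D₃, hD₃⟩ : ∃ x, x = ((n : ℝ) - 1) * m * (Real.exp m * T * V) := ⟨_, rfl⟩
  have hD₁0 : 0 ≤ D₁ := by rw [hD₁]; positivity
  have hD₂0 : 0 ≤ D₂ := by rw [hD₂]; positivity
  have hD₃0 : 0 ≤ D₃ := by rw [hD₃]; positivity
  have hD₄0 : 0 ≤ Real.exp n * V := by positivity
  refine ⟨min c₁ c₂, 1 + D₁ + D₂ + D₃ + Real.exp n * V, lt_min hc₁0 hc₂0, by linarith,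
    fun lam hlam => ?_⟩
  obtain ⟨F, hF, hF0, hF1, hF2, hF4⟩ := exists_profile g ht hlam
  rw [← hS] at hF4
  have hF' : ContDiff ℝ ∞ (deriv F) :=
    ((contDiff_succ_iff_deriv (n := ∞)).1 (by simpa using hF)).2.2
  have c2 : Continuous (deriv (deriv F)) := hF'.continuous_deriv (by simp)
  have c1 : Continuous (deriv F) := hF'.continuous
  have c0 : Continuous F := hF.continuous
  have cL : Continuous (lowerOrder F) := continuous_lowerOrder hF
  have hl0 : 0 < lam := by linarith
  refine ⟨profileMetric g ht hF, ⟨_, _, rfl⟩, ?_⟩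
  have b1 := abs_le.1 (h1 F hF)
  have b2 := abs_le.1 (h2 F hF)
  have i1 : Real.exp (-k) * (lam ^ 4 / 4 * S) ≤ ∫ x, Real.exp (k * F (t x)) * deriv F (t x) ^ 4 *
      gradNormSq g t x ^ 2 ∂(riemannianVolume g) := by
    refine (mul_le_mul_of_nonneg_left hF4 (Real.exp_pos _).le).trans ?_
    rw [← integral_const_mul]
    refine integral_mono (integrable_of_continuous g (by fun_prop))
      (integrable_of_continuous g (by fun_prop)) fun x => ?_
    simp only [mul_assoc]
    exact mul_le_mul_of_nonneg_right (hexp hk0.le (hF0 _)).1 (by positivity)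
  have hl1 : lam ≤ lam ^ 2 := by nlinarith
  have hl2 : lam ^ 2 ≤ lam ^ 3 := by nlinarith [sq_nonneg lam]
  have hLO (s : ℝ) : lowerOrder F s ≤ 6 * lam ^ 3 := by
    have a1 := hF1 s
    have a2 := hF2 s
    have a3 : |deriv F s| ^ 2 ≤ lam ^ 2 := pow_le_pow_left₀ (abs_nonneg _) a1 2
    have a4 : |deriv F s| ^ 3 ≤ lam ^ 3 := pow_le_pow_left₀ (abs_nonneg _) a1 3
    have a5 : |deriv F s| * |deriv (deriv F) s| ≤ lam * lam ^ 2 :=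
      mul_le_mul a1 a2 (abs_nonneg _) hl0.le
    have a6 : lam * lam ^ 2 = lam ^ 3 := by ring
    unfold lowerOrder
    linarith
  have i2 : ∫ x, Real.exp (k * F (t x)) * lowerOrder F (t x) ∂(riemannianVolume g)
      ≤ Real.exp k * (6 * lam ^ 3) * V :=
    hle (by fun_prop) fun x => mul_le_mul (hexp hk0.le (hF0 _)).2 (hLO _)
      (lowerOrder_nonneg _ _) (Real.exp_pos _).le
  -- The profile controls F'⁴|∇t|⁴ from below; dividing by the pointwise bound F'²|∇t|² ≤ λ²T gives
  -- the estimate for F'²|∇t|².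
  have i3 : Real.exp (-m) * (lam ^ 2 * S / (4 * T)) ≤ ∫ x, Real.exp (m * F (t x)) *
      deriv F (t x) ^ 2 * gradNormSq g t x ∂(riemannianVolume g) := by
    have : lam ^ 2 * S / (4 * T) ≤ (lam ^ 2 * T)⁻¹ *
        ∫ x, deriv F (t x) ^ 4 * gradNormSq g t x ^ 2 ∂(riemannianVolume g) := by
      refine le_trans (le_of_eq ?_) (mul_le_mul_of_nonneg_left hF4 (by positivity))
      field_simp
    refine (mul_le_mul_of_nonneg_left this (Real.exp_pos _).le).trans ?_
    rw [← integral_const_mul, ← integral_const_mul]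
    refine integral_mono (integrable_of_continuous g (by fun_prop))
      (integrable_of_continuous g (by fun_prop)) fun x => ?_
    simp only [mul_assoc]
    refine mul_le_mul (hexp hm0.le (hF0 _)).1 ?_ (by positivity) (Real.exp_pos _).le
    rw [inv_mul_le_iff₀ (by positivity)]
    have a1 : deriv F (t x) ^ 2 ≤ lam ^ 2 := sq_le_sq' (abs_le.1 (hF1 _)).1 (abs_le.1 (hF1 _)).2
    have a2 := gradNormSq_nonneg g t x
    calc deriv F (t x) ^ 4 * gradNormSq g t x ^ 2
        = (deriv F (t x) ^ 2 * gradNormSq g t x) * (deriv F (t x) ^ 2 * gradNormSq g t x) := by ring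
      _ ≤ (lam ^ 2 * T) * (deriv F (t x) ^ 2 * gradNormSq g t x) :=
        mul_le_mul_of_nonneg_right (mul_le_mul a1 (hT' x) a2 (sq_nonneg _)) (by positivity)
  have i4 : ∫ x, Real.exp (m * F (t x)) * deriv F (t x) ^ 2 * gradNormSq g t x
      ∂(riemannianVolume g) ≤ Real.exp m * lam ^ 2 * T * V :=
    hle (by fun_prop) fun x => mul_le_mul (mul_le_mul (hexp hm0.le (hF0 _)).2
      (sq_le_sq' (abs_le.1 (hF1 _)).1 (abs_le.1 (hF1 _)).2) (sq_nonneg _) (Real.exp_pos _).le)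
      (hT' x) (gradNormSq_nonneg g t x) (by positivity)
  have i5 : ∫ x, Real.exp (m * F (t x)) * (1 + |deriv F (t x)|) ∂(riemannianVolume g)
      ≤ Real.exp m * (2 * lam) * V :=
    hle (by fun_prop) fun x => mul_le_mul (hexp hm0.le (hF0 _)).2
      (by linarith [hF1 (t x)]) (by positivity) (Real.exp_pos _).le
  have i6 : totalVolume (profileMetric g ht hF) ≤ Real.exp n * V := by
    rw [totalVolume_profileMetric]
    exact hle (by fun_prop) fun x => (hexp (by linarith) (hF0 _)).2
  have j1 := mul_le_mul_of_nonneg_left i1 (show 0 ≤ ((n : ℝ) - 1) * k / 24 by positivity)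
  have j2 := mul_le_mul_of_nonneg_left i2 hC₁
  have j3 := mul_le_mul_of_nonneg_left i3 (show 0 ≤ ((n : ℝ) - 1) * m by positivity)
  have j4 := mul_le_mul_of_nonneg_left i4 (show 0 ≤ ((n : ℝ) - 1) * m by positivity)
  have j5 := mul_le_mul_of_nonneg_left i5 hC₂
  have e1 : ((n : ℝ) - 1) * k / 24 * (Real.exp (-k) * (lam ^ 4 / 4 * S)) = c₁ * lam ^ 4 := by
    rw [hc₁]; ring
  have e2 : C₁ * (Real.exp k * (6 * lam ^ 3) * V) = D₁ * lam ^ 3 := by rw [hD₁]; ring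
  have e3 : ((n : ℝ) - 1) * m * (Real.exp (-m) * (lam ^ 2 * S / (4 * T))) = c₂ * lam ^ 2 := by
    rw [hc₂]; ring
  have e4 : ((n : ℝ) - 1) * m * (Real.exp m * lam ^ 2 * T * V) = D₃ * lam ^ 2 := by rw [hD₃]; ring
  have e5 : C₂ * (Real.exp m * (2 * lam) * V) = D₂ * lam := by rw [hD₂]; ring
  rw [e1] at j1
  rw [e2] at j2
  rw [e3] at j3
  rw [e4] at j4
  rw [e5] at j5
  have m1 := mul_le_mul_of_nonneg_right (min_le_left c₁ c₂) (show 0 ≤ lam ^ 4 by positivity)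
  have m2 := mul_le_mul_of_nonneg_right (min_le_right c₁ c₂) (show 0 ≤ lam ^ 2 by positivity)
  have p3 : 0 ≤ lam ^ 3 := by positivity
  have p2 : 0 ≤ lam ^ 2 := by positivity
  have q1 : D₁ * lam ^ 3 ≤ (1 + D₁ + D₂ + D₃ + Real.exp n * V) * lam ^ 3 :=
    mul_le_mul_of_nonneg_right (by linarith) p3
  have q2 : D₂ * lam ≤ (1 + D₁ + D₂ + D₃ + Real.exp n * V) * lam :=
    mul_le_mul_of_nonneg_right (by linarith) hl0.le
  have q3 : (D₂ + D₃) * lam ^ 2 ≤ (1 + D₁ + D₂ + D₃ + Real.exp n * V) * lam ^ 2 :=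
    mul_le_mul_of_nonneg_right (by linarith) p2
  have q4 : D₂ * lam ≤ D₂ * lam ^ 2 := mul_le_mul_of_nonneg_left hl1 hD₂0
  refine ⟨by linarith, by linarith, by linarith, by linarith⟩

theorem exists_quotients_lt [T2Space M] [Nonempty M] (hn : 5 ≤ n) (g : SmoothMetric n M) (K : ℝ) :
    ∃ h ∈ conformalClass g, 0 < totalScalar h ∧ volumeQuotient h < K ∧ scalarQuotient h < K := by
  obtain ⟨c, C, hc, hC, H⟩ := exists_oscillating_family hn g
  -- Chosen so that cλ exceeds both 2C, which lets the main terms absorb the errors, and 2C|K|,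
  -- which makes cλ²/(2C) exceed |K|.
  set lam := 1 + 2 * C / c + 2 * C * |K| / c with hlam
  have hC0 : 0 < C := by linarith
  have p1 : 0 < 2 * C / c := by positivity
  have p2 : 0 ≤ 2 * C * |K| / c := by positivity
  have hl1 : 1 ≤ lam := by linarith
  have hl0 : 0 < lam := by linarith
  obtain ⟨h, hmem, h1, h2, h3, h4⟩ := H lam hl1
  have k1 : 2 * C < c * lam := by
    have : c * lam = c + 2 * C + 2 * C * |K| := by rw [hlam]; field_simp
    have : 0 ≤ C * |K| := by positivity
    linarith
  have k2 : 2 * C * |K| < c * lam := by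
    have : c * lam = c + 2 * C + 2 * C * |K| := by rw [hlam]; field_simp
    linarith
  have s1 : totalSigmaTwo h ≤ -(c / 2 * lam ^ 4) := by
    have := mul_le_mul_of_nonneg_right k1.le (show 0 ≤ lam ^ 3 by positivity)
    nlinarith
  have s2 : 0 < totalScalar h := by
    have : C * lam < c * lam ^ 2 := by nlinarith
    linarith
  obtain ⟨e1, e2, e3, e4⟩ := exponent_mem hn
  have hl2 : lam ≤ lam ^ 2 := by nlinarith
  have key : -(c / 2 * lam ^ 2 / C) < K := by
    have : |K| < c / 2 * lam ^ 2 / C := by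
      rw [lt_div_iff₀ hC0]
      nlinarith
    linarith [neg_abs_le K]
  refine ⟨h, hmem, s2, ?_, ?_⟩
  · refine (div_rpow_le_neg_div (by positivity) s1 (totalVolume_pos h) h2 hC e1 e2).trans_lt
      (lt_of_le_of_lt ?_ key)
    refine neg_le_neg (div_le_div_of_nonneg_right (mul_le_mul_of_nonneg_left ?_ (by positivity))
      hC0.le)
    exact pow_le_pow_right₀ hl1 (by norm_num)
  · refine (div_rpow_le_neg_div (by positivity) s1 s2 h4 (by nlinarith) e3 e4).trans_lt
      (lt_of_le_of_lt (le_of_eq ?_) key)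
    field_simp

end ConformalInfimum

/-! ### The round sphere in stereographic coordinates -/

section SphereGeometry

variable {n : ℕ}

/-- The unit sphere `Sⁿ ⊆ ℝⁿ⁺¹`. -/
abbrev UnitSphere (n : ℕ) : Type := Metric.sphere (0 : EuclideanSpace ℝ (Fin (n + 1))) 1

/-- The last coordinate on `Sⁿ`. -/
def height (n : ℕ) (x : UnitSphere n) : ℝ := (x : EuclideanSpace ℝ (Fin (n + 1))) (Fin.last n)

theorem contMDiff_height (n : ℕ) : ContMDiff (𝓡 n) 𝓘(ℝ, ℝ) ∞ (height n) := by
  have : Fact (Module.finrank ℝ (EuclideanSpace ℝ (Fin (n + 1))) = n + 1) := ⟨by simp⟩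
  have hs := contMDiff_coe_sphere (n := n) (m := ∞) (E := EuclideanSpace ℝ (Fin (n + 1)))
  have h : ContDiff ℝ ∞ fun y : EuclideanSpace ℝ (Fin (n + 1)) => y (Fin.last n) := by
    fun_prop
  exact h.contMDiff.comp hs

/-- The point of `Sⁿ` with last coordinate `-1`. -/
def southPole (n : ℕ) : UnitSphere n := -⟨EuclideanSpace.single (Fin.last n) 1, by simp⟩

theorem extChartAt_southPole_target :
    (extChartAt (𝓡 n) (southPole n)).target = Set.univ := by
  have : Fact (Module.finrank ℝ (EuclideanSpace ℝ (Fin (n + 1))) = n + 1) := ⟨by simp⟩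
  have h : (chartAt (EuclideanSpace ℝ (Fin n)) (southPole n)).target = Set.univ :=
    stereographic'_target (-southPole n)
  simp [h]

theorem extChartAt_southPole_source :
    (extChartAt (𝓡 n) (southPole n)).source = {-southPole n}ᶜ := by
  have : Fact (Module.finrank ℝ (EuclideanSpace ℝ (Fin (n + 1))) = n + 1) := ⟨by simp⟩
  rw [extChartAt_source]
  exact stereographic'_source (-southPole n)

theorem height_neg_southPole : height n (-southPole n) = 1 := by
  simp [height, southPole]

/-- Stereographic projection from the north pole. In its normalization the equator is the sphere ‖y‖
= 2. -/
theorem height_symm (y : Eucl n) :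
    height n ((extChartAt (𝓡 n) (southPole n)).symm y) = 1 - 8 / (‖y‖ ^ 2 + 4) := by
  have : Fact (Module.finrank ℝ (EuclideanSpace ℝ (Fin (n + 1))) = n + 1) := ⟨by simp⟩
  have h : height n ((extChartAt (𝓡 n) (southPole n)).symm y)
      = ((stereographic' n (-southPole n)).symm y : EuclideanSpace ℝ (Fin (n + 1)))
        (Fin.last n) := rfl
  rw [h, stereographic'_symm_apply]
  set U := (OrthonormalBasis.fromOrthogonalSpanSingleton (𝕜 := ℝ) n
    (ne_zero_of_mem_unit_sphere (-southPole n))).repr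
  have hv : ((-southPole n : UnitSphere n) : EuclideanSpace ℝ (Fin (n + 1)))
      = EuclideanSpace.single (Fin.last n) 1 := by simp [southPole]
  have hw := (Submodule.mem_orthogonal_singleton_iff_inner_right.1 (U.symm y).2)
  have hw : inner ℝ (EuclideanSpace.single (Fin.last n) (1 : ℝ))
      ((U.symm y : _) : EuclideanSpace ℝ (Fin (n + 1))) = 0 := by
    rw [← hv]
    exact hw
  rw [EuclideanSpace.inner_single_left] at hw
  have hnorm : ‖((U.symm y : _) : EuclideanSpace ℝ (Fin (n + 1)))‖ = ‖y‖ := by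
    rw [← U.symm.norm_map y]
    rfl
  simp only [map_one, one_mul] at hw
  simp only [PiLp.add_apply, PiLp.smul_apply, smul_eq_mul, hw, hnorm, hv]
  have hp : ‖y‖ ^ 2 + 4 ≠ 0 := by positivity
  simp
  field_simp
  ring

theorem hasFDerivAt_height_symm (y : Eucl n) :
    HasFDerivAt (fun y => height n ((extChartAt (𝓡 n) (southPole n)).symm y))
      ((16 / (‖y‖ ^ 2 + 4) ^ 2) • innerSL ℝ y) y := by
  simp only [height_symm]
  have hp : ‖y‖ ^ 2 + 4 ≠ 0 := by positivity
  have h1 := ((hasStrictFDerivAt_norm_sq y).hasFDerivAt).add_const 4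
  have h2 : HasDerivAt (fun q : ℝ => 1 - 8 / q) (8 / (‖y‖ ^ 2 + 4) ^ 2) (‖y‖ ^ 2 + 4) := by
    refine (((hasDerivAt_inv hp).const_mul 8).const_sub 1).congr_deriv ?_
    field_simp
  refine (h2.comp_hasFDerivAt y h1).congr_fderiv ?_
  ext z
  simp
  ring

theorem gradSq_height_pos {y : Eucl n} (hy : y ≠ 0) :
    0 < gradSq (gramInChart (roundMetric n) (southPole n))
      (fun y => height n ((extChartAt (𝓡 n) (southPole n)).symm y)) y := by
  refine (metricOn_gramInChart (roundMetric n) (southPole n)).gradSq_pos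
    (by rw [extChartAt_southPole_target]; trivial) ?_
  rw [(hasFDerivAt_height_symm y).fderiv]
  intro h
  have h1 := congrArg (fun q : Eucl n →L[ℝ] ℝ => q y) h
  have hp : (‖y‖ ^ 2 + 4) ^ 2 ≠ 0 := by positivity
  simp [hp, hy] at h1

theorem riemannianVolume_equator (hn : 0 < n) :
    riemannianVolume (roundMetric n) {x | height n x = 0} = 0 := by
  have : Nonempty (Fin n) := ⟨⟨0, hn⟩⟩
  have : Nontrivial (Eucl n) := inferInstance
  have hm : MeasurableSet {x : UnitSphere n | height n x = 0} :=
    (isClosed_singleton.preimage (contMDiff_height n).continuous).measurableSet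
  rw [riemannianVolume_apply_of_subset _ (southPole n) hm]
  · refine setLIntegral_measure_zero _ _ (measure_mono_null (fun y hy => ?_)
      (Measure.addHaar_sphere volume (0 : Eucl n) 2))
    have h1 : height n ((extChartAt (𝓡 n) (southPole n)).symm y) = 0 := hy.2
    rw [height_symm] at h1
    have hp : ‖y‖ ^ 2 + 4 ≠ 0 := by positivity
    field_simp at h1
    rw [mem_sphere_zero_iff_norm]
    nlinarith [norm_nonneg y]
  · intro x hx
    rw [extChartAt_southPole_source, Set.mem_compl_singleton_iff]
    rintro rfl
    rw [Set.mem_ofPred_eq, height_neg_southPole] at hx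
    exact one_ne_zero hx

/-- The difference (2+2δ)ⁿ - (2+δ)ⁿ is at least δ(2+δ)ⁿ⁻¹ ≥ δ. -/
theorem volume_annulus_ge (hn : 0 < n) {δ : ℝ} (hδ : 0 < δ) :
    ENNReal.ofReal δ * volume (Metric.ball (0 : Eucl n) 1)
      ≤ volume (Metric.ball (0 : Eucl n) (2 + 2 * δ) \ Metric.closedBall 0 (2 + δ)) := by
  have hsub : Metric.closedBall (0 : Eucl n) (2 + δ) ⊆ Metric.ball 0 (2 + 2 * δ) :=
    Metric.closedBall_subset_ball (by linarith)
  rw [measure_sdiff hsub Metric.isClosed_closedBall.measurableSet.nullMeasurableSet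
    (isCompact_closedBall _ _).measure_lt_top.ne, Measure.addHaar_closedBall _ _ (by linarith),
    Measure.addHaar_ball_of_pos _ _ (r := 2 + 2 * δ) (by linarith), ← ENNReal.sub_mul fun _ _ =>
      measure_ball_lt_top.ne, ← ENNReal.ofReal_sub _ (by positivity)]
  refine mul_le_mul_left (ENNReal.ofReal_le_ofReal ?_) _
  obtain ⟨m, hm⟩ : ∃ m, n = m + 1 := ⟨n - 1, by omega⟩
  have hf : Module.finrank ℝ (Eucl n) = m + 1 := by simp [hm]
  rw [hf, pow_succ, pow_succ]
  have h1 : (1 : ℝ) ≤ (2 + δ) ^ m := one_le_pow₀ (by linarith)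
  have h2 : (2 + δ) ^ m ≤ (2 + 2 * δ) ^ m := pow_le_pow_left₀ (by linarith) (by linarith) m
  nlinarith

/-- The slab is the annulus 2+δ < ‖y‖ < 2+2δ in stereographic coordinates. All these annuli lie in
the compact shell 1 ≤ ‖y‖ ≤ 4, where volume density and |∇s|² have positive minima, so `c` does not
depend on δ. -/
theorem exists_slab_bound (hn : 0 < n) : ∃ c > 0, ∀ δ : ℝ, 0 < δ → δ ≤ 1 →
    ∃ A : Set (UnitSphere n), MeasurableSet A ∧
      c * δ ≤ (riemannianVolume (roundMetric n)).real A ∧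
      ∀ x ∈ A, δ / 5 ≤ height n x ∧ height n x ≤ 3 / 2 * δ ∧
        c ≤ gradNormSq (roundMetric n) (height n) x := by
  have hfin : IsFiniteMeasure (riemannianVolume (roundMetric n)) := CompactSpace.isFiniteMeasure
  have hT := extChartAt_southPole_target (n := n)
  have hmem (y : Eucl n) : y ∈ (extChartAt (𝓡 n) (southPole n)).target := by rw [hT]; trivial
  have hG := metricOn_gramInChart (roundMetric n) (southPole n)
  set φ : Eucl n → ℝ := fun y => height n ((extChartAt (𝓡 n) (southPole n)).symm y) with hφ
  have : Nonempty (Fin n) := ⟨⟨0, hn⟩⟩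
  have hK : IsCompact (Metric.closedBall (0 : Eucl n) 4 \ Metric.ball 0 1) :=
    (isCompact_closedBall _ _).diff Metric.isOpen_ball
  have hne : (Metric.closedBall (0 : Eucl n) 4 \ Metric.ball 0 1).Nonempty := by
    refine ⟨stdVec ⟨0, hn⟩, ?_⟩
    simp [stdVec]
  have hcτ : ContinuousOn (gradSq (gramInChart (roundMetric n) (southPole n)) φ)
      (Metric.closedBall (0 : Eucl n) 4 \ Metric.ball 0 1) := fun y _ =>
    (hG.contDiffAt_gradSq (hmem y)
      (contDiffAt_comp_symm (contMDiff_height n) (hmem y))).continuousAt.continuousWithinAt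
  have hcd : ContinuousOn (volDensity (roundMetric n) (southPole n))
      (Metric.closedBall (0 : Eucl n) 4 \ Metric.ball 0 1) :=
    (contDiffOn_volDensity (roundMetric n) (southPole n)).continuousOn.mono fun y _ => hmem y
  obtain ⟨y₁, hy₁, h1⟩ := hK.exists_isMinOn hne hcτ
  obtain ⟨y₂, hy₂, h2⟩ := hK.exists_isMinOn hne hcd
  have hy₁0 : y₁ ≠ 0 := by
    rintro rfl
    simp at hy₁
  have p1 : 0 < gradSq (gramInChart (roundMetric n) (southPole n)) φ y₁ := gradSq_height_pos hy₁0
  have p2 := volDensity_pos (roundMetric n) (hmem y₂)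
  set b := volume (Metric.ball (0 : Eucl n) 1) with hb
  have hb0 : 0 < b := Metric.measure_ball_pos _ _ one_pos
  have hbt : b ≠ ⊤ := measure_ball_lt_top.ne
  have p3 : 0 < b.toReal := ENNReal.toReal_pos hb0.ne' hbt
  refine ⟨min (gradSq (gramInChart (roundMetric n) (southPole n)) φ y₁)
    (volDensity (roundMetric n) (southPole n) y₂ * b.toReal), lt_min p1 (by positivity),
    fun δ hδ hδ1 => ?_⟩
  set W := Metric.ball (0 : Eucl n) (2 + 2 * δ) \ Metric.closedBall 0 (2 + δ) with hW
  have hWo : IsOpen W := Metric.isOpen_ball.sdiff Metric.isClosed_closedBall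
  have hWn (y : Eucl n) (hy : y ∈ W) : 2 + δ < ‖y‖ ∧ ‖y‖ < 2 + 2 * δ := by
    simpa [hW, and_comm] using hy
  have hWK : W ⊆ Metric.closedBall (0 : Eucl n) 4 \ Metric.ball 0 1 := fun y hy => by
    have := hWn y hy
    simp only [Set.mem_sdiff, Metric.mem_closedBall, dist_zero_right, Metric.mem_ball, not_lt]
    constructor <;> linarith
  set A := (extChartAt (𝓡 n) (southPole n)).source ∩ extChartAt (𝓡 n) (southPole n) ⁻¹' W with hA
  have hAo : IsOpen A := (continuousOn_extChartAt _).isOpen_inter_preimage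
    (isOpen_extChartAt_source _) hWo
  refine ⟨A, hAo.measurableSet, ?_, fun x hx => ?_⟩
  · have hle : ENNReal.ofReal (volDensity (roundMetric n) (southPole n) y₂) *
        (ENNReal.ofReal δ * b) ≤ riemannianVolume (roundMetric n) A := by
      rw [riemannianVolume_apply_of_subset _ (southPole n) hAo.measurableSet Set.inter_subset_left]
      calc _ ≤ ENNReal.ofReal (volDensity (roundMetric n) (southPole n) y₂) * volume W :=
            mul_le_mul_right (volume_annulus_ge hn hδ) _
        _ = ∫⁻ _ in W, ENNReal.ofReal (volDensity (roundMetric n) (southPole n) y₂) := by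
            rw [setLIntegral_const]
        _ ≤ ∫⁻ y in W, ENNReal.ofReal (volDensity (roundMetric n) (southPole n) y) :=
            setLIntegral_mono' hWo.measurableSet fun y hy =>
              ENNReal.ofReal_le_ofReal (h2 (hWK hy))
        _ ≤ _ := by
            refine lintegral_mono_set fun y hy => ⟨hmem y, ?_, ?_⟩
            · exact (extChartAt (𝓡 n) (southPole n)).map_target (hmem y)
            · rw [Set.mem_preimage, (extChartAt (𝓡 n) (southPole n)).right_inv (hmem y)]
              exact hy
    have h3 := ENNReal.toReal_mono (measure_ne_top _ _) hle
    rw [ENNReal.toReal_mul, ENNReal.toReal_mul, ENNReal.toReal_ofReal p2.le,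
      ENNReal.toReal_ofReal hδ.le] at h3
    refine le_trans ?_ h3
    calc _ ≤ volDensity (roundMetric n) (southPole n) y₂ * b.toReal * δ :=
          mul_le_mul_of_nonneg_right (min_le_right _ _) hδ.le
      _ = _ := by ring
  · obtain ⟨hxs, hxW⟩ := hx
    have hn2 := hWn _ hxW
    have hh : height n x = 1 - 8 / (‖extChartAt (𝓡 n) (southPole n) x‖ ^ 2 + 4) := by
      rw [← height_symm, (extChartAt (𝓡 n) (southPole n)).left_inv hxs]
    rw [gradNormSq_eq _ (contMDiff_height n) hxs]
    -- Inserted in the height formula, these give s ≥ δ/(2+δ) and s ≤ 12δ/(8+12δ); with δ ≤ 1 the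
    -- first is at least δ/3.
    have q1 : 4 + 4 * δ ≤ ‖extChartAt (𝓡 n) (southPole n) x‖ ^ 2 := by nlinarith
    have q2 : ‖extChartAt (𝓡 n) (southPole n) x‖ ^ 2 ≤ 4 + 12 * δ := by
      nlinarith [norm_nonneg (extChartAt (𝓡 n) (southPole n) x)]
    refine ⟨?_, ?_, (min_le_left _ _).trans (h1 (hWK hxW))⟩
    · rw [hh, le_sub_comm, div_le_iff₀ (by positivity)]
      nlinarith
    · rw [hh, sub_le_comm, le_div_iff₀ (by positivity)]
      nlinarith

end SphereGeometry

/-! ### Concentration of the conformal factor along the equator -/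

section Band

variable {n : ℕ}

theorem deriv_neg_mul_sq (a : ℝ) : deriv (fun s : ℝ => -a * s ^ 2) = fun s => -(2 * a * s) := by
  ext s
  have := ((hasDerivAt_pow 2 s).const_mul (-a)).deriv
  rw [this]
  norm_num
  ring

theorem deriv_deriv_neg_mul_sq (a : ℝ) :
    deriv (deriv fun s : ℝ => -a * s ^ 2) = fun _ => -(2 * a) := by
  rw [deriv_neg_mul_sq]
  ext s
  simp

theorem one_add_pow_four_le_exp {w : ℝ} : 1 + w ^ 4 ≤ 8 * Real.exp (w ^ 2 / 2) := by
  have h := Real.quadratic_le_exp_of_nonneg (show 0 ≤ w ^ 2 / 2 by positivity)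
  nlinarith [sq_nonneg w]

/-- With w = r|s| one has |F'| = 2rw and |F''| = 2r², so the errors are at most r³, respectively r,
times polynomials in w, which a Gaussian absorbs. -/
theorem lowerOrder_neg_sq_mul_sq_le {r : ℝ} (hr : 1 ≤ r) (s : ℝ) :
    lowerOrder (fun s => -(r ^ 2) * s ^ 2) s ≤ 168 * r ^ 3 * Real.exp ((r * s) ^ 2 / 2) ∧
    1 + |deriv (fun s => -(r ^ 2) * s ^ 2) s| ≤ 24 * r * Real.exp ((r * s) ^ 2 / 2) := by
  have h0 : 0 ≤ r := by linarith
  obtain ⟨w, hw⟩ : ∃ w, w = r * |s| := ⟨_, rfl⟩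
  have hw0 : 0 ≤ w := by rw [hw]; positivity
  have hw2 : (r * s) ^ 2 = w ^ 2 := by rw [hw, mul_pow, mul_pow, sq_abs]
  have hE := one_add_pow_four_le_exp (w := w)
  rw [hw2]
  set E := Real.exp (w ^ 2 / 2)
  have d1 : |deriv (fun s => -(r ^ 2) * s ^ 2) s| = 2 * r * w := by
    rw [deriv_neg_mul_sq, abs_neg, abs_mul, abs_of_nonneg (by positivity), hw]
    ring
  have d2 : |deriv (deriv (fun s => -(r ^ 2) * s ^ 2)) s| = 2 * r ^ 2 := by
    rw [deriv_deriv_neg_mul_sq, abs_neg, abs_of_nonneg (by positivity)]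
  have w1 : w ≤ 1 + w ^ 4 := by nlinarith [sq_nonneg (w ^ 2 - 1), sq_nonneg (w - 1)]
  have w2 : w ^ 2 ≤ 1 + w ^ 4 := by nlinarith [sq_nonneg (w ^ 2 - 1)]
  have w3 : w ^ 3 ≤ 1 + w ^ 4 := by
    nlinarith [sq_nonneg (w ^ 2 - w), sq_nonneg (w ^ 2 - 1)]
  have w0 : 1 ≤ 1 + w ^ 4 := by nlinarith [sq_nonneg (w ^ 2)]
  have r1 : r ≤ r ^ 3 := le_self_pow₀ hr (by norm_num)
  have r2 : r ^ 2 ≤ r ^ 3 := pow_le_pow_right₀ hr (by norm_num)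
  have r0 : 1 ≤ r ^ 3 := one_le_pow₀ hr
  have r30 : 0 ≤ r ^ 3 := by positivity
  have hp {a b : ℝ} (ha : a ≤ r ^ 3) (hb0 : 0 ≤ b) (hb : b ≤ 1 + w ^ 4) :
      a * b ≤ r ^ 3 * (1 + w ^ 4) := mul_le_mul ha hb hb0 r30
  have hp1 {b : ℝ} (hb : b ≤ 1 + w ^ 4) : r * b ≤ r * (1 + w ^ 4) :=
    mul_le_mul_of_nonneg_left hb h0
  constructor
  · have q0 := hp r0 zero_le_one w0
    have q1 := hp r1 hw0 w1
    have q2 := hp r2 zero_le_one w0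
    have q3 := hp r2 (sq_nonneg w) w2
    have q4 := hp le_rfl hw0 w1
    have q5 := hp le_rfl (pow_nonneg hw0 3) w3
    have q6 := mul_le_mul_of_nonneg_left hE r30
    unfold lowerOrder
    rw [d1, d2]
    -- The coefficients sum to 21, and 168 = 21 · 8 with the 8 from `one_add_pow_four_le_exp`.
    calc _ = 1 * 1 + 2 * (r * w) + 2 * (r ^ 2 * 1) + 4 * (r ^ 2 * w ^ 2) + 4 * (r ^ 3 * w)
          + 8 * (r ^ 3 * w ^ 3) := by ring
      _ ≤ 21 * (r ^ 3 * (1 + w ^ 4)) := by linarith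
      _ ≤ 168 * r ^ 3 * E := by linarith
  · have q0 := hp1 w0
    have q1 := hp1 w1
    have q2 := mul_le_mul_of_nonneg_left hE h0
    rw [d1]
    linarith

theorem mul_measureReal_le_integral {g : SmoothMetric n (UnitSphere n)} {f : UnitSphere n → ℝ}
    (hf : Continuous f) (h0 : ∀ x, 0 ≤ f x) {A : Set (UnitSphere n)} (hA : MeasurableSet A) {a : ℝ}
    (h : ∀ x ∈ A, a ≤ f x) : a * (riemannianVolume g).real A ≤ ∫ x, f x ∂(riemannianVolume g) := by
  have : IsFiniteMeasure (riemannianVolume g) := CompactSpace.isFiniteMeasure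
  have hi := integrable_of_continuous g hf
  calc a * (riemannianVolume g).real A = ∫ _ in A, a ∂(riemannianVolume g) := by
        rw [setIntegral_const, smul_eq_mul, mul_comm]
    _ ≤ ∫ x in A, f x ∂(riemannianVolume g) :=
        setIntegral_mono_on (integrable_const a).integrableOn hi.integrableOn hA h
    _ ≤ _ := setIntegral_le_integral hi (Filter.Eventually.of_forall h0)

/-- The mass near the equator. -/
def equatorMass (n : ℕ) (r : ℝ) : ℝ :=
  ∫ x, Real.exp (-((r * height n x) ^ 2 / 2)) ∂(riemannianVolume (roundMetric n))

/-- Dominated convergence: the integrand tends to 0 off the equator, which is a null set. No rate is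
needed. -/
theorem tendsto_equatorMass (hn : 0 < n) :
    Filter.Tendsto (equatorMass n) Filter.atTop (nhds 0) := by
  have : IsFiniteMeasure (riemannianVolume (roundMetric n)) := CompactSpace.isFiniteMeasure
  have ct : Continuous (height n) := (contMDiff_height n).continuous
  have h0 : (0 : ℝ) = ∫ _, (0 : ℝ) ∂(riemannianVolume (roundMetric n)) := by simp
  rw [h0]
  refine tendsto_integral_filter_of_dominated_convergence (fun _ => 1)
    (Filter.Eventually.of_forall fun r => Continuous.aestronglyMeasurable (by fun_prop))
    (Filter.Eventually.of_forall fun r => Filter.Eventually.of_forall fun x => ?_)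
    (integrable_const _) ?_
  · rw [Real.norm_eq_abs, Real.abs_exp, Real.exp_le_one_iff, neg_nonpos]
    positivity
  · have hae : ∀ᵐ x ∂(riemannianVolume (roundMetric n)), height n x ≠ 0 := by
      rw [ae_iff]
      simpa using riemannianVolume_equator hn
    filter_upwards [hae] with x hx
    refine Real.tendsto_exp_neg_atTop_nhds_zero.comp ?_
    refine Filter.Tendsto.atTop_div_const two_pos ?_
    simp only [mul_pow]
    exact (Filter.tendsto_pow_atTop two_ne_zero).atTop_mul_const (by positivity)

theorem bandMetric_eq (n : ℕ) (a : ℝ) (hF : ContDiff ℝ ∞ fun s : ℝ => -a * s ^ 2) :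
    bandMetric n a = profileMetric (roundMetric n) (contMDiff_height n) hF := rfl

-- In w = rs the main terms have density r⁴w⁴e^{-kw²} and r²w²e^{-mw²}. A slab of volume at least
-- c/r gives r³ and r from below, while the errors are r³ and r times `equatorMass`, hence of
-- smaller order.
set_option maxHeartbeats 1000000 in
theorem exists_bandMetric_bounds (hn : 5 ≤ n) : ∃ c C : ℝ, 0 < c ∧ 1 ≤ C ∧ ∀ r : ℝ, 1 ≤ r →
    totalSigmaTwo (bandMetric n (r ^ 2)) ≤ -(c * r ^ 3) + C * r ^ 3 * equatorMass n r ∧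
    totalVolume (bandMetric n (r ^ 2)) ≤ C ∧
    c * r - C * r * equatorMass n r ≤ totalScalar (bandMetric n (r ^ 2)) ∧
    totalScalar (bandMetric n (r ^ 2)) ≤ C * r ^ 2 := by
  have hn5 : (5 : ℝ) ≤ n := by exact_mod_cast hn
  have ht := contMDiff_height n
  have ct : Continuous (height n) := ht.continuous
  have cτ := continuous_gradNormSq (roundMetric n) ht
  obtain ⟨x₁⟩ : Nonempty (UnitSphere n) := ⟨southPole n⟩
  have : Nonempty (UnitSphere n) := ⟨x₁⟩
  obtain ⟨V, hV⟩ : ∃ V, V = totalVolume (roundMetric n) := ⟨_, rfl⟩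
  have hV0 : 0 < V := hV ▸ totalVolume_pos (roundMetric n)
  have hle {f : UnitSphere n → ℝ} (hf : Continuous f) {c : ℝ} (h : ∀ x, f x ≤ c) :
      ∫ x, f x ∂(riemannianVolume (roundMetric n)) ≤ c * V :=
    hV ▸ integral_le_const_mul (roundMetric n) hf h
  obtain ⟨T, hT⟩ := isCompact_univ.bddAbove_image cτ.continuousOn
  have hT' (x : UnitSphere n) : gradNormSq (roundMetric n) (height n) x ≤ T :=
    hT ⟨x, Set.mem_univ x, rfl⟩
  have hT0 : 0 ≤ T := (gradNormSq_nonneg _ _ x₁).trans (hT' x₁)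
  obtain ⟨C₁, hC₁, h1⟩ := exists_totalSigmaTwo_bound hn (roundMetric n) ht
  obtain ⟨C₂, hC₂, h2⟩ := exists_totalScalar_bound hn (roundMetric n) ht
  obtain ⟨c₀, hc₀, hslab⟩ := exists_slab_bound (n := n) (by omega)
  obtain ⟨k, hk⟩ : ∃ k, k = (n : ℝ) - 4 := ⟨_, rfl⟩
  obtain ⟨m, hm⟩ : ∃ m, m = (n : ℝ) - 2 := ⟨_, rfl⟩
  simp only [← hk] at h1
  simp only [← hm] at h2
  have hk1 : 1 ≤ k := by linarith
  have hm1 : 1 ≤ m := by linarith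
  have hn1 : 0 < (n : ℝ) - 1 := by linarith
  -- On the slab 1/5 ≤ w ≤ 3/2, so e^{aF} ≥ e^{-9a/4}, F'⁴ = 16r⁴w⁴ ≥ (16/625)r⁴ and F'² ≥ (4/25)r².
  -- The last factor `c₀` is the volume bound, the other power of `c₀` comes from |∇s|².
  obtain ⟨c₁, hc₁⟩ : ∃ x, x = ((n : ℝ) - 1) * k / 24 *
    (Real.exp (-(k * (9 / 4))) * (16 / 625) * c₀ ^ 2 * c₀) := ⟨_, rfl⟩
  obtain ⟨c₂, hc₂⟩ : ∃ x, x = ((n : ℝ) - 1) * m *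
    (Real.exp (-(m * (9 / 4))) * (4 / 25) * c₀ * c₀) := ⟨_, rfl⟩
  have hc₁0 : 0 < c₁ := by rw [hc₁]; positivity
  have hc₂0 : 0 < c₂ := by rw [hc₂]; positivity
  obtain ⟨D₁, hD₁⟩ : ∃ x, x = C₁ * 168 := ⟨_, rfl⟩
  obtain ⟨D₂, hD₂⟩ : ∃ x, x = C₂ * 24 := ⟨_, rfl⟩
  obtain ⟨D₃, hD₃⟩ : ∃ x, x = ((n : ℝ) - 1) * m * (4 * T * V) := ⟨_, rfl⟩
  have hD₁0 : 0 ≤ D₁ := by rw [hD₁]; positivity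
  have hD₂0 : 0 ≤ D₂ := by rw [hD₂]; positivity
  have hD₃0 : 0 ≤ D₃ := by rw [hD₃]; positivity
  have hD₂V : 0 ≤ D₂ * V := by positivity
  refine ⟨min c₁ c₂, 1 + D₁ + D₂ + D₂ * V + D₃ + V, lt_min hc₁0 hc₂0, by linarith,
    fun r hr => ?_⟩
  have hr0 : 0 < r := by linarith
  have hF : ContDiff ℝ ∞ fun s : ℝ => -(r ^ 2) * s ^ 2 := by fun_prop
  rw [bandMetric_eq n (r ^ 2) hF]
  have b1 := abs_le.1 (h1 _ hF)
  have b2 := abs_le.1 (h2 _ hF)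
  have cL := continuous_lowerOrder hF
  have hLO (s : ℝ) := lowerOrder_neg_sq_mul_sq_le hr s
  simp only [deriv_neg_mul_sq] at b1 b2 hLO
  -- Half of the decay e^{-w²} pays for the polynomial growth of the errors; the other half is the
  -- integrand of `equatorMass`.
  have hexp {a : ℝ} (ha : 1 ≤ a) (s : ℝ) :
      Real.exp (a * (-(r ^ 2) * s ^ 2)) * Real.exp ((r * s) ^ 2 / 2)
        ≤ Real.exp (-((r * s) ^ 2 / 2)) := by
    rw [← Real.exp_add]
    refine Real.exp_le_exp.2 ?_
    nlinarith [sq_nonneg (r * s)]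
  obtain ⟨J, hJ⟩ : ∃ J, J = equatorMass n r := ⟨_, rfl⟩
  rw [← hJ]
  have hJ0 : 0 ≤ J := hJ ▸ integral_nonneg fun x => (Real.exp_pos _).le
  have hJV : J ≤ V := by
    rw [hJ, ← one_mul V]
    refine hle (by fun_prop) fun x => ?_
    rw [Real.exp_le_one_iff, neg_nonpos]
    positivity
  have i2 : ∫ x, Real.exp (k * (-(r ^ 2) * height n x ^ 2)) *
      lowerOrder (fun s => -(r ^ 2) * s ^ 2) (height n x) ∂(riemannianVolume (roundMetric n))
      ≤ 168 * r ^ 3 * J := by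
    rw [hJ, equatorMass, ← integral_const_mul]
    refine integral_mono (integrable_of_continuous _ (by fun_prop))
      (integrable_of_continuous _ (by fun_prop)) fun x => ?_
    calc _ ≤ Real.exp (k * (-(r ^ 2) * height n x ^ 2)) *
          (168 * r ^ 3 * Real.exp ((r * height n x) ^ 2 / 2)) :=
          mul_le_mul_of_nonneg_left (hLO _).1 (Real.exp_pos _).le
      _ = 168 * r ^ 3 * (Real.exp (k * (-(r ^ 2) * height n x ^ 2)) *
          Real.exp ((r * height n x) ^ 2 / 2)) := by ring
      _ ≤ _ := mul_le_mul_of_nonneg_left (hexp hk1 _) (by positivity)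
  have i5 : ∫ x, Real.exp (m * (-(r ^ 2) * height n x ^ 2)) *
      (1 + |-(2 * r ^ 2 * height n x)|) ∂(riemannianVolume (roundMetric n)) ≤ 24 * r * J := by
    rw [hJ, equatorMass, ← integral_const_mul]
    refine integral_mono (integrable_of_continuous _ (by fun_prop))
      (integrable_of_continuous _ (by fun_prop)) fun x => ?_
    calc _ ≤ Real.exp (m * (-(r ^ 2) * height n x ^ 2)) *
          (24 * r * Real.exp ((r * height n x) ^ 2 / 2)) :=
          mul_le_mul_of_nonneg_left (hLO _).2 (Real.exp_pos _).le
      _ = 24 * r * (Real.exp (m * (-(r ^ 2) * height n x ^ 2)) *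
          Real.exp ((r * height n x) ^ 2 / 2)) := by ring
      _ ≤ _ := mul_le_mul_of_nonneg_left (hexp hm1 _) (by positivity)
  -- The slab width 1/r is the scale on which w = rs is of order one.
  obtain ⟨A, hA, hAm, hAx⟩ := hslab r⁻¹ (by positivity) (inv_le_one_of_one_le₀ hr)
  have hAw (x : UnitSphere n) (hx : x ∈ A) :
      1 / 5 ≤ r * height n x ∧ (r * height n x) ^ 2 ≤ 9 / 4 := by
    obtain ⟨u1, u2, -⟩ := hAx x hx
    have v1 := mul_le_mul_of_nonneg_left u1 hr0.le
    have v2 := mul_le_mul_of_nonneg_left u2 hr0.le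
    have e1 : r * (r⁻¹ / 5) = 1 / 5 := by field_simp
    have e2 : r * (3 / 2 * r⁻¹) = 3 / 2 := by field_simp
    rw [e1] at v1
    rw [e2] at v2
    exact ⟨v1, by nlinarith⟩
  have hAe {a : ℝ} (ha : 1 ≤ a) (x : UnitSphere n) (hx : x ∈ A) :
      Real.exp (-(a * (9 / 4))) ≤ Real.exp (a * (-(r ^ 2) * height n x ^ 2)) := by
    refine Real.exp_le_exp.2 ?_
    nlinarith [(hAw x hx).2]
  have i1 : Real.exp (-(k * (9 / 4))) * (16 / 625) * c₀ ^ 2 * c₀ * r ^ 3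
      ≤ ∫ x, Real.exp (k * (-(r ^ 2) * height n x ^ 2)) * (-(2 * r ^ 2 * height n x)) ^ 4 *
        gradNormSq (roundMetric n) (height n) x ^ 2 ∂(riemannianVolume (roundMetric n)) := by
    refine le_trans ?_ (mul_measureReal_le_integral
      (a := Real.exp (-(k * (9 / 4))) * (16 / 625 * r ^ 4) * c₀ ^ 2) (by fun_prop)
      (fun x => by positivity) hA fun x hx => ?_)
    · refine le_trans (le_of_eq ?_) (mul_le_mul_of_nonneg_left hAm (by positivity))
      field_simp
    · have w4 : (1 / 5 : ℝ) ^ 4 ≤ (r * height n x) ^ 4 :=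
        pow_le_pow_left₀ (by norm_num) (hAw x hx).1 4
      have w5 : 16 / 625 * r ^ 4 ≤ (-(2 * r ^ 2 * height n x)) ^ 4 := by
        have e : (-(2 * r ^ 2 * height n x)) ^ 4 = 16 * r ^ 4 * (r * height n x) ^ 4 := by ring
        rw [e]
        calc 16 / 625 * r ^ 4 = 16 * r ^ 4 * (1 / 5 : ℝ) ^ 4 := by ring
          _ ≤ _ := mul_le_mul_of_nonneg_left w4 (by positivity)
      exact mul_le_mul (mul_le_mul (hAe hk1 x hx) w5 (by positivity) (Real.exp_pos _).le)
        (pow_le_pow_left₀ hc₀.le (hAx x hx).2.2 2) (by positivity) (by positivity)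
  have i3 : Real.exp (-(m * (9 / 4))) * (4 / 25) * c₀ * c₀ * r
      ≤ ∫ x, Real.exp (m * (-(r ^ 2) * height n x ^ 2)) * (-(2 * r ^ 2 * height n x)) ^ 2 *
        gradNormSq (roundMetric n) (height n) x ∂(riemannianVolume (roundMetric n)) := by
    refine le_trans ?_ (mul_measureReal_le_integral
      (a := Real.exp (-(m * (9 / 4))) * (4 / 25 * r ^ 2) * c₀) (by fun_prop)
      (fun x => mul_nonneg (by positivity) (gradNormSq_nonneg _ _ x)) hA fun x hx => ?_)
    · refine le_trans (le_of_eq ?_) (mul_le_mul_of_nonneg_left hAm (by positivity))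
      field_simp
    · have w4 : (1 / 5 : ℝ) ^ 2 ≤ (r * height n x) ^ 2 :=
        pow_le_pow_left₀ (by norm_num) (hAw x hx).1 2
      have w5 : 4 / 25 * r ^ 2 ≤ (-(2 * r ^ 2 * height n x)) ^ 2 := by
        have e : (-(2 * r ^ 2 * height n x)) ^ 2 = 4 * r ^ 2 * (r * height n x) ^ 2 := by ring
        rw [e]
        calc 4 / 25 * r ^ 2 = 4 * r ^ 2 * (1 / 5 : ℝ) ^ 2 := by ring
          _ ≤ _ := mul_le_mul_of_nonneg_left w4 (by positivity)
      exact mul_le_mul (mul_le_mul (hAe hm1 x hx) w5 (by positivity) (Real.exp_pos _).le)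
        (hAx x hx).2.2 hc₀.le (by positivity)
  -- Only w²e^{-mw²} ≤ 1 is used. The resulting r² is cruder than needed, but still below the r³ of
  -- the numerator.
  have i4 : ∫ x, Real.exp (m * (-(r ^ 2) * height n x ^ 2)) * (-(2 * r ^ 2 * height n x)) ^ 2 *
        gradNormSq (roundMetric n) (height n) x ∂(riemannianVolume (roundMetric n))
      ≤ 4 * r ^ 2 * T * V := by
    refine hle (by fun_prop) fun x => ?_
    refine mul_le_mul ?_ (hT' x) (gradNormSq_nonneg _ _ x) (by positivity)
    have e1 : Real.exp (m * (-(r ^ 2) * height n x ^ 2)) * (-(2 * r ^ 2 * height n x)) ^ 2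
        = 4 * r ^ 2 * ((r * height n x) ^ 2 * Real.exp (-(m * (r * height n x) ^ 2))) := by
      ring_nf
    have e2 : (r * height n x) ^ 2 * Real.exp (-(m * (r * height n x) ^ 2)) ≤ 1 := by
      rw [Real.exp_neg, ← div_eq_mul_inv, div_le_one (Real.exp_pos _)]
      have := Real.add_one_le_exp (m * (r * height n x) ^ 2)
      nlinarith [sq_nonneg (r * height n x)]
    rw [e1]
    exact mul_le_of_le_one_right (by positivity) e2
  have i6 : totalVolume (profileMetric (roundMetric n) (contMDiff_height n) hF) ≤ V := by
    rw [totalVolume_profileMetric, ← one_mul V]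
    refine hle (by fun_prop) fun x => ?_
    rw [Real.exp_le_one_iff]
    have : 0 ≤ (n : ℝ) * (r ^ 2 * height n x ^ 2) := by positivity
    linarith
  have j1 := mul_le_mul_of_nonneg_left i1 (show 0 ≤ ((n : ℝ) - 1) * k / 24 by positivity)
  have j2 := mul_le_mul_of_nonneg_left i2 hC₁
  have j3 := mul_le_mul_of_nonneg_left i3 (show 0 ≤ ((n : ℝ) - 1) * m by positivity)
  have j4 := mul_le_mul_of_nonneg_left i4 (show 0 ≤ ((n : ℝ) - 1) * m by positivity)
  have j5 := mul_le_mul_of_nonneg_left i5 hC₂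
  have e1 : ((n : ℝ) - 1) * k / 24 *
      (Real.exp (-(k * (9 / 4))) * (16 / 625) * c₀ ^ 2 * c₀ * r ^ 3) = c₁ * r ^ 3 := by
    rw [hc₁]; ring
  have e2 : C₁ * (168 * r ^ 3 * J) = D₁ * (r ^ 3 * J) := by rw [hD₁]; ring
  have e3 : ((n : ℝ) - 1) * m * (Real.exp (-(m * (9 / 4))) * (4 / 25) * c₀ * c₀ * r)
      = c₂ * r := by rw [hc₂]; ring
  have e4 : ((n : ℝ) - 1) * m * (4 * r ^ 2 * T * V) = D₃ * r ^ 2 := by rw [hD₃]; ring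
  have e5 : C₂ * (24 * r * J) = D₂ * (r * J) := by rw [hD₂]; ring
  rw [e1] at j1
  rw [e2] at j2
  rw [e3] at j3
  rw [e4] at j4
  rw [e5] at j5
  have m1 := mul_le_mul_of_nonneg_right (min_le_left c₁ c₂) (show 0 ≤ r ^ 3 by positivity)
  have m2 := mul_le_mul_of_nonneg_right (min_le_right c₁ c₂) hr0.le
  have q1 : D₁ * (r ^ 3 * J) ≤ (1 + D₁ + D₂ + D₂ * V + D₃ + V) * r ^ 3 * J := by
    rw [mul_assoc]
    exact mul_le_mul_of_nonneg_right (by linarith) (by positivity)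
  have q2 : D₂ * (r * J) ≤ (1 + D₁ + D₂ + D₂ * V + D₃ + V) * r * J := by
    rw [mul_assoc]
    exact mul_le_mul_of_nonneg_right (by linarith) (by positivity)
  have q3 : (D₂ * V + D₃) * r ^ 2 ≤ (1 + D₁ + D₂ + D₂ * V + D₃ + V) * r ^ 2 :=
    mul_le_mul_of_nonneg_right (by linarith) (by positivity)
  have q4 : D₂ * (r * J) ≤ D₂ * V * r ^ 2 := by
    have : r * J ≤ r ^ 2 * V := mul_le_mul (by nlinarith) hJV hJ0 (by positivity)
    calc D₂ * (r * J) ≤ D₂ * (r ^ 2 * V) := mul_le_mul_of_nonneg_left this hD₂0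
      _ = _ := by ring
  refine ⟨by linarith, by linarith, by linarith, by linarith⟩

/-- With r = √ℓ, the numerator is at most -(c/2)r³ for large r, and the powers in the denominators
are at most C and Cr²; both quotients are at most -(c/(2C))√ℓ. -/
theorem bandMetric_tendsto (hn : 5 ≤ n) :
    Filter.Tendsto (fun ℓ : ℝ => volumeQuotient (bandMetric n ℓ)) Filter.atTop Filter.atBot ∧
    (∀ᶠ ℓ : ℝ in Filter.atTop, 0 < totalScalar (bandMetric n ℓ)) ∧
    Filter.Tendsto (fun ℓ : ℝ => scalarQuotient (bandMetric n ℓ)) Filter.atTop Filter.atBot := by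
  obtain ⟨c, C, hc, hC, H⟩ := exists_bandMetric_bounds hn
  have hC0 : 0 < C := by linarith
  have : Nonempty (UnitSphere n) := ⟨southPole n⟩
  obtain ⟨e1, e2, e3, e4⟩ := exponent_mem hn
  have hJ : ∀ᶠ r in Filter.atTop, equatorMass n r < c / (2 * C) :=
    (tendsto_equatorMass (by omega)).eventually (gt_mem_nhds (by positivity))
  have key : ∀ᶠ ℓ : ℝ in Filter.atTop, 0 < totalScalar (bandMetric n ℓ) ∧
      volumeQuotient (bandMetric n ℓ) ≤ -(c / (2 * C) * Real.sqrt ℓ) ∧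
      scalarQuotient (bandMetric n ℓ) ≤ -(c / (2 * C) * Real.sqrt ℓ) := by
    filter_upwards [Real.tendsto_sqrt_atTop.eventually hJ,
      Real.tendsto_sqrt_atTop.eventually (Filter.eventually_ge_atTop 1),
      Filter.eventually_ge_atTop 0] with ℓ h1 h2 h3
    obtain ⟨r, hr⟩ : ∃ r, r = Real.sqrt ℓ := ⟨_, rfl⟩
    have hl : ℓ = r ^ 2 := by rw [hr, Real.sq_sqrt h3]
    rw [← hr] at h1 h2 ⊢
    rw [hl]
    have hr0 : 0 < r := by linarith
    obtain ⟨b1, b2, b3, b4⟩ := H r h2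
    -- Once the equatorial mass is below c/(2C), the errors consume at most half of the main terms.
    have hCJ : C * equatorMass n r ≤ c / 2 := by
      calc C * equatorMass n r ≤ C * (c / (2 * C)) := mul_le_mul_of_nonneg_left h1.le hC0.le
        _ = c / 2 := by field_simp
    have s1 : totalSigmaTwo (bandMetric n (r ^ 2)) ≤ -(c / 2 * r ^ 3) := by
      have := mul_le_mul_of_nonneg_right hCJ (show 0 ≤ r ^ 3 by positivity)
      linarith
    have s2 : 0 < totalScalar (bandMetric n (r ^ 2)) := by
      have h5 := mul_le_mul_of_nonneg_right hCJ hr0.le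
      have h6 : 0 < c * r := by positivity
      linarith
    refine ⟨s2, ?_, ?_⟩
    · refine (div_rpow_le_neg_div (by positivity) s1 (totalVolume_pos _) b2 hC e1 e2).trans
        (neg_le_neg ?_)
      have h7 : r ≤ r ^ 3 := le_self_pow₀ h2 (by norm_num)
      calc c / (2 * C) * r ≤ c / (2 * C) * r ^ 3 := mul_le_mul_of_nonneg_left h7 (by positivity)
        _ = c / 2 * r ^ 3 / C := by field_simp
    · refine (div_rpow_le_neg_div (by positivity) s1 s2 b4 (by nlinarith) e3 e4).trans
        (neg_le_neg (le_of_eq ?_))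
      field_simp
  have hlim : Filter.Tendsto (fun ℓ => -(c / (2 * C) * Real.sqrt ℓ)) Filter.atTop Filter.atBot :=
    Filter.tendsto_neg_atTop_atBot.comp
      (Real.tendsto_sqrt_atTop.const_mul_atTop (by positivity))
  exact ⟨Filter.tendsto_atBot_mono' _ (key.mono fun _ h => h.2.1) hlim, key.mono fun _ h => h.1,
    Filter.tendsto_atBot_mono' _ (key.mono fun _ h => h.2.2) hlim⟩

end Band

end ConformalGeometry

end

/-! ### The main theorem -/

open ConformalGeometry in
theorem mainTheorem9 (n : ℕ) (hn : 5 ≤ n) :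
    (∀ (M : Type*) [TopologicalSpace M] [ChartedSpace (EuclideanSpace ℝ (Fin n)) M]
        [IsManifold (𝓡 n) ∞ M] [CompactSpace M] [T2Space M] [Nonempty M]
        [MeasurableSpace M] [BorelSpace M] (g₀ : SmoothMetric n M),
      -- for every metric of the class the quantities below are well defined
      (∀ g ∈ conformalClass g₀,
        0 < riemannianVolume g Set.univ ∧ riemannianVolume g Set.univ < ⊤ ∧
        Integrable (sigmaTwo g) (riemannianVolume g) ∧
        Integrable (scalarCurvature g) (riemannianVolume g)) ∧
      (⨅ g ∈ conformalClass g₀, (volumeQuotient g : EReal)) = ⊥ ∧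
      (⨅ g ∈ {g ∈ conformalClass g₀ | 0 < totalScalar g}, (scalarQuotient g : EReal)) = ⊥) ∧
    Filter.Tendsto (fun ℓ : ℝ => volumeQuotient (bandMetric n ℓ)) Filter.atTop Filter.atBot ∧
    (∀ᶠ ℓ : ℝ in Filter.atTop, 0 < totalScalar (bandMetric n ℓ)) ∧
    Filter.Tendsto (fun ℓ : ℝ => scalarQuotient (bandMetric n ℓ)) Filter.atTop Filter.atBot := by
  refine ⟨fun M _ _ _ _ _ _ _ _ g₀ => ⟨fun g _ => volume_pos_and_integrable g,
    biInf_coe_eq_bot fun K => ?_, biInf_coe_eq_bot fun K => ?_⟩, ?_⟩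
  · obtain ⟨h, hmem, -, h1, -⟩ := exists_quotients_lt hn g₀ K
    exact ⟨h, hmem, h1⟩
  · obtain ⟨h, hmem, h0, -, h2⟩ := exists_quotients_lt hn g₀ K
    exact ⟨h, ⟨hmem, h0⟩, h2⟩
  · exact bandMetric_tendsto hn
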